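/- **Setting.** Let $V$ be a finite set of variables and $\mathsf{Dom}=\mathbb N$ the (countably infinite) domain. A schema is a finite set of atoms with distinct attribute sets $X\subseteq V$ (so an atom is identified with its attribute set); an instance $D$ of a schema $\Sigma$ assigns to each atom $X\in\Sigma$ a finite relation $D_X\subseteq\mathsf{Dom}^X$, and $\|D\|=\sum_{X\in\Sigma}|D_X|$. A disjunctive datalog rule (DDR) is given by an input schema $\Sigma_{in}$ and an output schema $\Sigma_{out}$. A feasible output (model) for an input instance $D$ is an instance $E$ of $\Sigma_{out}$ such that every $t\in\mathsf{Dom}^V$ with $\pi_X(t)\in D_X$ for all $X\in\Sigma_{in}$ satisfies $\pi_Z(t)\in E_Z$ for some $Z\in\Sigma_{out}$. A monotonicity measure is a pair $\delta=(Y|X)$ of disjoint subsets of $V$; for $h:2^V\to\mathbb R$ put $h(\delta)=h(X\cup Y)-h(X)$. A polymatroid is an $h$ with $h(\emptyset)=0$, $h(X\cup Y)\ge h(X)$ for disjoint $X,Y$, and $h(X\cup Y)+h(X\cup Z)\ge h(X)+h(X\cup Y\cup Z)$ for pairwise disjoint $X,Y,Z$. For a relation $R$ over attributes $A$, $\deg_R(Y|X)\in\mathbb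 N\cup\{\infty\}$ is the maximum over $x\in\mathsf{Dom}^X$ of the number of tuples $u\in\mathsf{Dom}^{X\cup Y}$ that extend $x$ and agree with some tuple of $R$ on $A\cap(X\cup Y)$; and $\deg_D(\delta)=\min_{X'\in\Sigma_{in}}\deg_{D_{X'}}(\delta)$ (with $\min\emptyset=\infty$). For a finite set $\Delta$ of monotonicity measures and $N:\Delta\to\mathbb R_{\ge0}$, $D\models(\Delta,N)$ means $\deg_D(\delta)\le N_\delta$ for all $\delta\in\Delta$. **Machine model.** Running time is counted on a pointer machine whose values are natural numbers and cells holding two values. Each program is built, by composition, branching and while-loops, from constants, building and taking apart a cell, comparison of two numbers (unit cost each) and $+$, truncated $-$, $\times$ on numbers. Writing $|a|$ for the bit length of $a$, $+$ and $-$ cost $|a|+|b|+1$ and $\times$ costs $(|a|+1)(|b|+1)$. Composition, the construction of a cell, each branching and each loop test add one step. Instances are stored as lists of relations (the atoms in a fixed order), relations as lists of tuples without repetition in arbitrary order, tuples as lists of domain values. **Theorem.** Fix a DDR $(\Sigma_{in},\Sigma_{out})$ over $V$, a set $\Delta$ of monotonicity measures, and non-negative real weights $\lambda=(\lambda_Z)_{Z\in\Sigma_{out}}$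 with $\|\lambda\|_1=1$ and $w=(w_\delta)_{\delta\in\Delta}$ such that $$\sum_{Z\in\Sigma_{out}}\lambda_Z\,h(Z)\;\le\;\sum_{\delta\in\Delta}w_\delta\,h(\delta)$$ is a Shannon inequality, i.e. holds for all polymatroids $h$. Then there are a program $P$ and constants $C,k$, depending only on these data, such that for all instances $D$ of $\Sigma_{in}$ and all $N:\Delta\to\mathbb R_{\ge0}$ with $D\models(\Delta,N)$, writing $B=\prod_{\delta\in\Delta}N_\delta^{w_\delta}$ (with $0^0=1$), the program $P$, started on any stored form of $D$, halts with a stored form of a feasible output $E$ of the DDR after at most $$C\,(\|D\|+B+1)\,\log^k(\|D\|+2)$$ steps, and $$\|E\|\;\le\;C\,B\,\log^k(\|D\|+2).$$ -/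

import Mathlib

open scoped NNReal ENNReal

namespace Panda

/-! ### Schemas, instances, disjunctive datalog rules -/

/-- The countably infinite domain of values. -/
abbrev Dom : Type := ℕ

/-- Tuples with attribute set `X`, i.e. elements of `Dom ^ X`. -/
abbrev Tuple {V : Type*} (X : Finset V) : Type _ := {v // v ∈ X} → Dom

/-- A schema. Distinct atoms of a schema have distinct attribute sets, so an atom `R(X)` is
identified with its attribute set `X` and a schema is a finite set of attribute sets. -/
abbrev Schema (V : Type*) : Type _ := Finset (Finset V)

/-- An instance of a schema assigns to every atom a finite relation over its attributes. -/
abbrev Instance {V : Type*} (S : Schema V) : Type _ := (X : {X // X ∈ S}) → Finset (Tuple X.1)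

/-- The size of an instance: the total number of its tuples. -/
def Instance.size {V : Type*} {S : Schema V} (D : Instance S) : ℕ := ∑ X, (D X).card

/-- The projection of a tuple over all variables to the attributes `X`. -/
def proj {V : Type*} (X : Finset V) (t : V → Dom) : Tuple X := fun v => t v.1

/-- The full natural join of an instance. -/
def fullJoin {V : Type*} {S : Schema V} (D : Instance S) : Set (V → Dom) :=
  {t | ∀ X, proj X.1 t ∈ D X}

/-- `E` is a model (feasible output), for the input instance `D`, of the disjunctive datalog
rule with input schema `S` and output schema `S'`. -/
def IsModel {V : Type*} {S S' : Schema V} (D : Instance S) (E : Instance S') : Prop :=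
  ∀ t ∈ fullJoin D, ∃ Z, proj Z.1 t ∈ E Z

/-! ### Information measures and polymatroids -/

/-- A monotonicity measure `(Y | X)`, with `X` and `Y` disjoint. -/
structure Mon (V : Type*) where
  Y : Finset V
  X : Finset V
  disj : Disjoint Y X

/-- A submodularity measure `(Y ; Z | X)`, with `X`, `Y`, `Z` pairwise disjoint. -/
structure Sub (V : Type*) where
  Y : Finset V
  Z : Finset V
  X : Finset V
  disjYZ : Disjoint Y Z
  disjYX : Disjoint Y X
  disjZX : Disjoint Z X

/-- `h(Y | X) = h(XY) - h(X)`. -/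
def Mon.val {V : Type*} [DecidableEq V] (μ : Mon V) (h : Finset V → ℝ) : ℝ :=
  h (μ.X ∪ μ.Y) - h μ.X

/-- `h(Y ; Z | X) = h(XY) + h(XZ) - h(X) - h(XYZ)`. -/
def Sub.val {V : Type*} [DecidableEq V] (σ : Sub V) (h : Finset V → ℝ) : ℝ :=
  h (σ.X ∪ σ.Y) + h (σ.X ∪ σ.Z) - h σ.X - h (σ.X ∪ σ.Y ∪ σ.Z)

/-- Polymatroids: the vectors that satisfy the basic Shannon inequalities. -/
structure IsPolymatroid {V : Type*} [DecidableEq V] (h : Finset V → ℝ) : Prop where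
  empty : h ∅ = 0
  mono : ∀ μ : Mon V, 0 ≤ μ.val h
  submod : ∀ σ : Sub V, 0 ≤ σ.val h

/-- `∑ Z ∈ S', lam Z * h(Z) ≤ ∑ δ ∈ Δ, w δ * h(δ)` is a Shannon inequality, i.e. it holds for all
polymatroids `h`. -/
def IsShannon {V : Type*} [DecidableEq V] (S' : Schema V) (Δ : Finset (Mon V))
    (lam : Finset V → ℝ) (w : Mon V → ℝ) : Prop :=
  ∀ h : Finset V → ℝ, IsPolymatroid h → ∑ Z ∈ S', lam Z * h Z ≤ ∑ δ ∈ Δ, w δ * δ.val h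

/-! ### Degree constraints -/

/-- The restriction of a relation `R` over attributes `A` to arbitrary attributes `W`: the tuples
over `W` that agree with some tuple of `R` on the common attributes. When `W ⊆ A` this is the
projection of `R` to `W`. -/
def restriction {V : Type*} {A : Finset V} (R : Finset (Tuple A)) (W : Finset V) :
    Set (Tuple W) :=
  {u | ∃ r ∈ R, ∀ (v : V) (hW : v ∈ W) (hA : v ∈ A), u ⟨v, hW⟩ = r ⟨v, hA⟩}

/-- `deg_R(Y | X = x)`: the number of tuples over `XY` in the restriction of `R` to `XY` whose
`X`-part is `x`. -/
noncomputable def degAt {V : Type*} [DecidableEq V] {A : Finset V} (R : Finset (Tuple A))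
    (δ : Mon V) (x : Tuple δ.X) : ℕ∞ :=
  {u ∈ restriction R (δ.X ∪ δ.Y) |
    ∀ v : {v // v ∈ δ.X}, u ⟨v.1, Finset.mem_union_left _ v.2⟩ = x v}.encard

/-- `deg_R(Y | X)`: the maximum of `deg_R(Y | X = x)` over all `x`, possibly infinite. -/
noncomputable def deg {V : Type*} [DecidableEq V] {A : Finset V} (R : Finset (Tuple A))
    (δ : Mon V) : ℕ∞ :=
  ⨆ x : Tuple δ.X, degAt R δ x

/-- The degree of `δ` in an instance: the minimum of the degrees in its relations. -/
noncomputable def Instance.deg {V : Type*} [DecidableEq V] {S : Schema V} (D : Instance S)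
    (δ : Mon V) : ℕ∞ :=
  ⨅ X, Panda.deg (D X) δ

/-- The instance `D` satisfies the degree constraints `(Δ, N)`. -/
def Satisfies {V : Type*} [DecidableEq V] {S : Schema V} (D : Instance S) (Δ : Finset (Mon V))
    (N : Mon V → ℝ≥0) : Prop :=
  ∀ δ ∈ Δ, ((D.deg δ : ℕ∞) : ℝ≥0∞) ≤ (N δ : ℝ≥0∞)

/-- The bound `B = ∏ δ ∈ Δ, N_δ ^ w_δ`. -/
noncomputable def bound {V : Type*} (Δ : Finset (Mon V)) (N : Mon V → ℝ≥0) (w : Mon V → ℝ) : ℝ :=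
  ∏ δ ∈ Δ, (N δ : ℝ) ^ w δ

/-! ### The machine model

Programs of a pointer machine. A value is a number or (a pointer to) a heap cell holding two
values. Building, copying and taking apart cells, branching and comparing two numbers cost
one step each, so domain values are atomic; arithmetic is charged by the bit length of its operands.
Every primitive takes at most its charge, up to a constant factor, on a random access machine. -/

/-- Machine values. -/
inductive Val : Type
  | atom (n : ℕ) : Val
  | cell (a b : Val) : Val

namespace Val

/-- The number stored in a value (`0` for a cell). -/
def num : Val → ℕ
  | atom n => n
  | cell _ _ => 0

/-- First component of a cell (`0` for a number). -/
def fst : Val → Val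
  | atom _ => atom 0
  | cell a _ => a

/-- Second component of a cell (`0` for a number). -/
def snd : Val → Val
  | atom _ => atom 0
  | cell _ b => b

/-- Linked lists; the number `0` terminates a list. -/
def ofList : List Val → Val
  | [] => atom 0
  | a :: l => cell a (ofList l)

end Val

/-- Programs; each transforms one value into another. -/
inductive Prog : Type
  | id : Prog
  | const (n : ℕ) : Prog
  | fst : Prog
  | snd : Prog
  | lt : Prog
  | add : Prog
  | sub : Prog
  | mul : Prog
  | cell (p q : Prog) : Prog
  | comp (p q : Prog) : Prog
  | cond (c p q : Prog) : Prog
  | loop (c p : Prog) : Prog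

/-- `Prog.Runs p x y t`: on input `x`, the program `p` halts with output `y` after `t` steps.
The number `0` counts as false, every other value as true. -/
inductive Prog.Runs : Prog → Val → Val → ℕ → Prop
  | id (x : Val) : Runs .id x x 1
  | const (n : ℕ) (x : Val) : Runs (.const n) x (.atom n) 1
  | fst (x : Val) : Runs .fst x x.fst 1
  | snd (x : Val) : Runs .snd x x.snd 1
  | lt (x : Val) : Runs .lt x (.atom (if x.fst.num < x.snd.num then 1 else 0)) 1
  | add (x : Val) : Runs .add x (.atom (x.fst.num + x.snd.num))
      (x.fst.num.size + x.snd.num.size + 1)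
  | sub (x : Val) : Runs .sub x (.atom (x.fst.num - x.snd.num))
      (x.fst.num.size + x.snd.num.size + 1)
  | mul (x : Val) : Runs .mul x (.atom (x.fst.num * x.snd.num))
      ((x.fst.num.size + 1) * (x.snd.num.size + 1))
  /-- Run `p` and `q` on `x` and build a cell from the two results. -/
  | cell {p q : Prog} {x a b : Val} {s t : ℕ} :
      Runs p x a s → Runs q x b t → Runs (.cell p q) x (.cell a b) (s + t + 1)
  /-- Run `p`, then run `q` on its result. -/
  | comp {p q : Prog} {x y z : Val} {s t : ℕ} :
      Runs p x y s → Runs q y z t → Runs (.comp p q) x z (s + t + 1)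
  | cond_true {c p q : Prog} {x a y : Val} {s t : ℕ} :
      Runs c x a s → a ≠ .atom 0 → Runs p x y t → Runs (.cond c p q) x y (s + t + 1)
  | cond_false {c p q : Prog} {x y : Val} {s t : ℕ} :
      Runs c x (.atom 0) s → Runs q x y t → Runs (.cond c p q) x y (s + t + 1)
  /-- `loop c p` repeats `p` as long as the test `c` is true. -/
  | loop_stop {c p : Prog} {x : Val} {s : ℕ} :
      Runs c x (.atom 0) s → Runs (.loop c p) x x (s + 1)
  | loop_step {c p : Prog} {x a y z : Val} {s t u : ℕ} :
      Runs c x a s → a ≠ .atom 0 → Runs p x y t → Runs (.loop c p) y z u →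
      Runs (.loop c p) x z (s + t + u + 1)

/-! ### Input and output format -/

/-- A tuple is stored as the list of its values, in a fixed order of the variables. -/
noncomputable def encodeTuple {V : Type*} [Fintype V] [DecidableEq V] {X : Finset V}
    (t : Tuple X) : Val :=
  Val.ofList ((Finset.univ : Finset V).toList.filterMap
    fun v => if h : v ∈ X then some (Val.atom (t ⟨v, h⟩)) else none)

/-- `x` is a stored form of the instance `D`: the list, in a fixed order of the atoms, of its
relations, each of them listed without repetition but in an arbitrary order. -/
def Stores {V : Type*} [Fintype V] [DecidableEq V] {S : Schema V} (D : Instance S)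
    (x : Val) : Prop :=
  ∃ l : (X : {X // X ∈ S}) → List (Tuple X.1),
    (∀ X, (l X).Nodup ∧ ∀ t, t ∈ l X ↔ t ∈ D X) ∧
    x = Val.ofList (S.attach.toList.map fun X => Val.ofList ((l X).map encodeTuple))

end Panda

/-!
By Farkas' lemma (`farkas`), the slack of a Shannon inequality is a nonnegative combination of basic
Shannon inequalities. The coefficients of such identities are the feasible points of a linear program
with rational data, and its basic solutions (`exists_basic`) provide finitely many integral
certificates, i.e. identities `∑ h(Z) + ∑ h(μ) + ∑ h(σ) = ∑ h(δ)` with `q` targets `Z`,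
monotonicity measures `μ` and submodularity measures `σ`. Since the logarithm of `∏ d_δ ^ w_δ`
is a linear objective, for each vector `d ≥ 1` of degrees some certificate satisfies
`∏ d_δ ≤ (∏ d_δ ^ w_δ) ^ q` (`exists_certs`).

A certificate is turned into a program by induction on the number of its terms (`solvableUpTo`). Each
term `h(Y | X)` on the right hand side is guarded by a relation whose degrees are at most some `n`,
and the product of all these bounds `n` is at most `B ^ q` for a budget `B`. Comparing coefficients
shows that an unconditional term `h(Y)` with `Y ≠ ∅` has a partner in the identity
(`Ident.partner`), and each kind of partner tells what to do with the guard of `h(Y)`: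

* a target `Y`: the guard is an answer;
* a term `h(W | Y)`: the guard is joined with that of `h(W | Y)`, and guards `h(Y ∪ W)`;
* a monotonicity measure `h(Y) - h(X)`: the guard is projected to `X`;
* a submodularity measure `h(Y ; Z | X)` with `h(X ∪ Y)` in the role of `h(Y)`: the guard is
  decomposed, according to the degrees of its tuples over `X`, into logarithmically many pairs of
  guards of `h(X)` and `h(Y | X ∪ Z)`. The product of their bounds is at most twice the old bound;
  therefore the budget includes a reserve of a factor `2` for each submodularity measure.

If the answer or the join could be larger than `B`, its term is dropped instead. By the reset lemma
(`Ident.reset`) this costs at most one target, and the product of the remaining bounds is at most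
`B ^ (q - 1)`, because a factor larger than `B` has been removed. So all relations stay within the
budget, up to logarithmic factors.

The degrees of the input can be computed. The program therefore determines the budget of each
certificate and each choice of input relations as guards, which is a power of two obtained from
integer arithmetic (`budget`), and uses the least one (`Answers.exists_min`). The degree constraints
enter only through the comparison of this budget with the bound (`exists_cost_le`). An input with an
empty relation has an empty join, and is answered by empty relations.

Programs are written by means of the predicates `Computes` and `Const`, for functions that are computed
within a given time and in constant time; they are closed under composition, branching, loops and
the operations on lists that are used. Sorting by merging (`groupBy`) underlies the removal of
duplicates, the computation of degrees, joins and decompositions.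
-/

open scoped NNReal ENNReal

namespace Panda

set_option linter.unusedSectionVars false

/-! ### Certificates of Shannon inequalities -/

/-- Farkas' lemma: a linear functional that is nonnegative wherever finitely many functionals are
nonnegative is a combination of them with nonnegative coefficients. -/
theorem farkas {ι E : Type*} [AddCommGroup E] [Module ℝ E] (s : Finset ι) :
    ∀ (f : ι → E →ₗ[ℝ] ℝ) (φ : E →ₗ[ℝ] ℝ), (∀ x, (∀ i ∈ s, 0 ≤ f i x) → 0 ≤ φ x) →
      ∃ c : ι → ℝ, (∀ i, 0 ≤ c i) ∧ φ = ∑ i ∈ s, c i • f i := by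
  classical
  induction s using Finset.induction_on with
  | empty =>
    intro f φ h
    refine ⟨fun _ => 0, fun _ => le_rfl, ?_⟩
    ext x
    have h1 := h x (by simp)
    have h2 := h (-x) (by simp)
    simp only [map_neg] at h2
    simp only [Finset.sum_empty, LinearMap.zero_apply]
    linarith
  | insert j s hj ih =>
    intro f φ h
    by_cases hs : ∀ x, (∀ i ∈ s, 0 ≤ f i x) → 0 ≤ φ x
    · obtain ⟨c, hc, hφ⟩ := ih f φ hs
      refine ⟨Function.update c j 0, fun i => ?_, ?_⟩
      · by_cases hij : i = j
        · subst hij; simp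
        · simpa [hij] using hc i
      · rw [Finset.sum_insert hj, hφ]
        simp only [Function.update_self, zero_smul, zero_add]
        refine Finset.sum_congr rfl fun i hi => ?_
        rw [Function.update_of_ne (ne_of_mem_of_not_mem hi hj)]
    · push Not at hs
      obtain ⟨v, hv, hφv⟩ := hs
      have hfj : f j v < 0 := by
        by_contra hcon
        refine absurd (h v fun i hi => ?_) (not_le.2 hφv)
        rcases Finset.mem_insert.1 hi with rfl | hi
        · exact not_lt.1 hcon
        · exact hv i hi
      -- rescale `v` so that `f j` takes the value `-1` on it, and project along it to `ker (f j)`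
      obtain ⟨r, hr, hrj⟩ : ∃ r : ℝ, 0 < r ∧ r * f j v = -1 :=
        ⟨-(f j v)⁻¹, by simpa using hfj, by rw [neg_mul, inv_mul_cancel₀ hfj.ne]⟩
      obtain ⟨c, hc, hφ⟩ := ih (fun i => f i + f i (r • v) • f j) (φ + φ (r • v) • f j) (by
        intro x hx
        have := h (x + f j x • r • v) (fun i hi => by
          rcases Finset.mem_insert.1 hi with rfl | hi
          · simp only [map_add, map_smul, smul_eq_mul, hrj]; simp
          · have := hx i hi
            simp only [LinearMap.add_apply, LinearMap.smul_apply, map_add, map_smul,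
              smul_eq_mul] at this ⊢
            linarith)
        simp only [LinearMap.add_apply, LinearMap.smul_apply, map_add, map_smul,
              smul_eq_mul] at this ⊢
        linarith)
      refine ⟨Function.update c j (∑ i ∈ s, c i * f i (r • v) - φ (r • v)), fun i => ?_, ?_⟩
      · by_cases hij : i = j
        · subst hij
          simp only [Function.update_self, map_smul, smul_eq_mul]
          have : 0 ≤ ∑ k ∈ s, c k * (r * f k v) :=
            Finset.sum_nonneg fun k hk => mul_nonneg (hc k) (mul_nonneg hr.le (hv k hk))
          nlinarith
        · simpa [hij] using hc i
      · rw [Finset.sum_insert hj, Function.update_self]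
        rw [Finset.sum_congr rfl (g := fun i => c i • f i) (fun i hi => by
          rw [Function.update_of_ne (ne_of_mem_of_not_mem hi hj)])]
        ext x
        have := congrArg (fun g : E →ₗ[ℝ] ℝ => g x) hφ
        simp only [LinearMap.add_apply, LinearMap.smul_apply, smul_eq_mul, LinearMap.sum_apply,
          mul_add, Finset.sum_add_distrib, ← mul_assoc, ← Finset.sum_mul] at this ⊢
        linarith

/-- A linear program in equality form with rational data has a finite set of rational feasible
points that contains, for each nonnegative objective, points at least as good as any given feasible
real point. These are the basic solutions, i.e. those that are determined by their support. -/
theorem exists_basic {K I : Type*} [Fintype I] (A : K → I → ℚ) (b : K → ℚ) :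
    ∃ F : Set (I → ℚ), F.Finite ∧
      (∀ y ∈ F, (∀ i, 0 ≤ y i) ∧ ∀ k, ∑ i, A k i * y i = b k) ∧
      ∀ (x c : I → ℝ), (∀ i, 0 ≤ x i) → (∀ i, 0 ≤ c i) → (∀ k, ∑ i, (A k i : ℝ) * x i = b k) →
        ∃ y ∈ F, ∑ i, c i * (y i : ℝ) ≤ ∑ i, c i * x i := by
  classical
  refine ⟨{y | ((∀ i, 0 ≤ y i) ∧ ∀ k, ∑ i, A k i * y i = b k) ∧
    ∀ z : I → ℚ, (∀ i, y i = 0 → z i = 0) → (∀ k, ∑ i, A k i * z i = b k) → z = y}, ?_,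
    fun y hy => hy.1, ?_⟩
  · refine Set.Finite.of_injOn (f := fun y : I → ℚ => {i | y i = 0}) (t := Set.univ)
      (fun _ _ => Set.mem_univ _) ?_ Set.finite_univ
    intro y hy z hz hyz
    refine (hy.2 z (fun i hi => ?_) hz.1.2).symm
    exact (Set.ext_iff.1 hyz i).1 hi
  · intro x c hx hc hAx
    -- a feasible point of cost at most that of `x`, of minimal support
    obtain ⟨u, ⟨hu0, huA, huc⟩, humin⟩ :=
      (measure fun u : I → ℝ => (Finset.univ.filter fun i => u i ≠ 0).card).wf.has_min
        {u | (∀ i, 0 ≤ u i) ∧ (∀ k, ∑ i, (A k i : ℝ) * u i = b k) ∧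
          ∑ i, c i * u i ≤ ∑ i, c i * x i} ⟨x, hx, hAx, le_rfl⟩
    -- moving along a direction with a negative entry would shrink the support
    have key : ∀ d : I → ℝ, (∀ i, u i = 0 → d i = 0) → (∀ k, ∑ i, (A k i : ℝ) * d i = 0) →
        ∑ i, c i * d i ≤ 0 → ∀ i, 0 ≤ d i := by
      intro d hd hAd hcd
      by_contra! hneg
      obtain ⟨i₀, hi₀⟩ := hneg
      obtain ⟨j, hj, hjmin⟩ := Finset.exists_min_image (Finset.univ.filter fun i => d i < 0)
        (fun i => u i / (-d i)) ⟨i₀, by simpa using hi₀⟩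
      simp only [Finset.mem_filter, Finset.mem_univ, true_and] at hj hjmin
      set t := u j / (-d j) with ht
      have ht0 : 0 ≤ t := div_nonneg (hu0 j) (by linarith)
      have hjz : u j + t * d j = 0 := by
        rw [ht, div_neg, neg_mul, div_mul_cancel₀ _ hj.ne]; ring
      refine humin (fun i => u i + t * d i) ⟨fun i => ?_, fun k => ?_, ?_⟩ ?_
      · by_cases hdi : d i < 0
        · have := hjmin i hdi
          rw [le_div_iff₀ (by linarith)] at this
          linarith
        · have := mul_nonneg ht0 (not_lt.1 hdi)
          have := hu0 i
          linarith
      · simp only [mul_add, Finset.sum_add_distrib, huA, mul_left_comm _ t, ← Finset.mul_sum, hAd]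
        simp
      · simp only [mul_add, Finset.sum_add_distrib, mul_left_comm _ t, ← Finset.mul_sum]
        nlinarith
      · refine Finset.card_lt_card ⟨fun i hi => ?_, fun hsub => ?_⟩
        · simp only [Finset.mem_filter, Finset.mem_univ, true_and] at hi ⊢
          intro h0
          exact hi (by rw [h0, hd i h0]; simp)
        · have : j ∈ Finset.univ.filter fun i => u i ≠ 0 := by
            simp only [Finset.mem_filter, Finset.mem_univ, true_and]
            intro h0
            rw [hd j h0] at hj
            exact lt_irrefl _ hj
          have := hsub this
          simp only [Finset.mem_filter, Finset.mem_univ, true_and] at this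
          exact this hjz
    have uniq : ∀ z : I → ℝ, (∀ i, u i = 0 → z i = 0) →
        (∀ k, ∑ i, (A k i : ℝ) * z i = b k) → z = u := by
      have nonneg_zero : ∀ d : I → ℝ, (∀ i, u i = 0 → d i = 0) →
          (∀ k, ∑ i, (A k i : ℝ) * d i = 0) → ∑ i, c i * d i ≤ 0 → d = 0 := by
        intro d hd hAd hcd
        have h0 := key d hd hAd hcd
        have h1 : 0 ≤ ∑ i, c i * d i := Finset.sum_nonneg fun i _ => mul_nonneg (hc i) (h0 i)
        have h2 := key (-d) (fun i hi => by simp [hd i hi]) (fun k => by simp [hAd k])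
          (by simp only [Pi.neg_apply, mul_neg, Finset.sum_neg_distrib]; linarith)
        ext i
        have := h2 i
        simp only [Pi.neg_apply] at this
        exact le_antisymm (by simpa using this) (h0 i)
      intro z hz hzA
      rcases le_total (∑ i, c i * (z i - u i)) 0 with h | h
      · have := nonneg_zero (z - u) (fun i hi => by simp [hz i hi, hi])
          (fun k => by simp [mul_sub, hzA, huA]) h
        exact sub_eq_zero.1 this
      · have := nonneg_zero (u - z) (fun i hi => by simp [hz i hi, hi])
          (fun k => by simp [mul_sub, hzA, huA]) (by
            simp only [Pi.sub_apply, mul_sub, Finset.sum_sub_distrib] at h ⊢; linarith)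
        exact (sub_eq_zero.1 this).symm
    -- a `ℚ`-linear retraction of `ℝ` to `ℚ` maps `u` to a solution, hence to itself
    obtain ⟨ρ, hρ⟩ := (Algebra.linearMap ℚ ℝ).exists_leftInverse_of_injective
      (LinearMap.ker_eq_bot.2 (algebraMap ℚ ℝ).injective)
    have hρq : ∀ r : ℚ, ρ (r : ℝ) = r := fun r => by
      have := congrArg (fun g : ℚ →ₗ[ℚ] ℚ => g r) hρ
      simpa using this
    have hρA : ∀ k, ∑ i, A k i * ρ (u i) = b k := fun k => by
      have := congrArg ρ (huA k)
      rw [map_sum, hρq] at this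
      rw [← this]
      refine Finset.sum_congr rfl fun i _ => ?_
      rw [← Rat.smul_def, map_smul, smul_eq_mul]
    have hu : ∀ i, ((ρ (u i) : ℚ) : ℝ) = u i := fun i =>
      congrFun (uniq (fun i => ((ρ (u i) : ℚ) : ℝ)) (fun i hi => by simp [hi])
        (fun k => by exact_mod_cast congrArg (fun r : ℚ => (r : ℝ)) (hρA k))) i
    refine ⟨fun i => ρ (u i), ⟨⟨fun i => ?_, hρA⟩, fun z hz hzA => ?_⟩, ?_⟩
    · have := hu0 i
      rw [← hu i] at this
      exact_mod_cast this
    · ext i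
      have := congrFun (uniq (fun i => (z i : ℝ)) (fun i hi => by
        have := hz i (by simp [hi])
        simp [this]) (fun k => by exact_mod_cast congrArg (fun r : ℚ => (r : ℝ)) (hzA k))) i
      rw [← hu i] at this
      exact_mod_cast this
    · simpa only [hu] using huc

/-- An integral certificate of a Shannon inequality `∑ h(Z) ≤ ∑ h(δ)`: the slack is a sum of
monotonicity and submodularity measures. Multiplicities take the place of coefficients. The
identity is required for all set functions, so that coefficients can be compared; `h ∅` is
subtracted because it need not vanish. -/
structure Cert (V : Type*) [DecidableEq V] where
  /-- The targets `Z` on the left hand side. -/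
  Zs : Multiset (Finset V)
  /-- The terms `δ` on the right hand side. -/
  Ds : Multiset (Mon V)
  /-- The monotonicity measures in the slack. -/
  Ms : Multiset (Mon V)
  /-- The submodularity measures in the slack. -/
  Ss : Multiset (Sub V)
  ident : ∀ h : Finset V → ℝ, (Zs.map fun Z => h Z - h ∅).sum + (Ms.map fun μ => μ.val h).sum +
    (Ss.map fun σ => σ.val h).sum = (Ds.map fun δ => δ.val h).sum

theorem linear_eq_sum {ι : Type*} [Fintype ι] [DecidableEq ι] (f : (ι → ℝ) →ₗ[ℝ] ℝ) (h : ι → ℝ) :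
    f h = ∑ i, f (Pi.single i 1) * h i := by
  conv_lhs => rw [pi_eq_sum_univ h]
  rw [map_sum]
  refine Finset.sum_congr rfl fun i _ => ?_
  rw [map_smul, smul_eq_mul, mul_comm]
  congr 2
  ext j
  simp [Pi.single_apply, eq_comm]

section certificates
variable {V : Type*} [DecidableEq V]

/-- Evaluation of a set function at `S`, as a linear functional. -/
def evalAt (S : Finset V) : (Finset V → ℝ) →ₗ[ℝ] ℝ := LinearMap.proj S

@[simp] theorem evalAt_apply (S : Finset V) (h : Finset V → ℝ) : evalAt S h = h S := rfl

theorem sum_map_sum_nsmul {ι κ : Type*} [Fintype ι] (n : ι → ℕ) (e : ι → κ) (f : κ → ℝ) :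
    ((∑ i, n i • ({e i} : Multiset κ)).map f).sum = ∑ i, (n i : ℝ) * f (e i) := by
  rw [← Multiset.coe_mapAddMonoidHom, map_sum, ← Multiset.coe_sumAddMonoidHom, map_sum]
  simp [Multiset.map_nsmul, Multiset.sum_nsmul]

theorem prod_map_sum_nsmul {ι κ : Type*} [Fintype ι] (n : ι → ℕ) (e : ι → κ) (f : κ → ℝ) :
    ((∑ i, n i • ({e i} : Multiset κ)).map f).prod = ∏ i, f (e i) ^ n i := by
  rw [← Multiset.coe_mapAddMonoidHom, map_sum, Multiset.prod_sum]
  simp [Multiset.map_nsmul, Multiset.prod_nsmul]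

theorem card_sum_nsmul {ι κ : Type*} [Fintype ι] (n : ι → ℕ) (e : ι → κ) :
    Multiset.card (∑ i, n i • ({e i} : Multiset κ)) = ∑ i, n i := by
  simp

/-- `Mon.val` as a linear functional of `h`. -/
def Mon.lin (μ : Mon V) : (Finset V → ℝ) →ₗ[ℝ] ℝ :=
  evalAt (μ.X ∪ μ.Y) - evalAt μ.X

/-- `Sub.val` as a linear functional of `h`. -/
def Sub.lin (σ : Sub V) : (Finset V → ℝ) →ₗ[ℝ] ℝ :=
  evalAt (σ.X ∪ σ.Y) + evalAt (σ.X ∪ σ.Z) - evalAt σ.X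
    - evalAt (σ.X ∪ σ.Y ∪ σ.Z)

@[simp] theorem Mon.lin_apply (μ : Mon V) (h : Finset V → ℝ) : μ.lin h = μ.val h := rfl
@[simp] theorem Sub.lin_apply (σ : Sub V) (h : Finset V → ℝ) : σ.lin h = σ.val h := rfl

theorem Mon.val_rat (μ : Mon V) (S : Finset V) :
    ∃ r : ℚ, μ.val (Pi.single S 1) = r := by
  refine ⟨(Pi.single S 1 : Finset V → ℚ) (μ.X ∪ μ.Y) - (Pi.single S 1 : Finset V → ℚ) μ.X, ?_⟩
  simp only [Mon.val, Pi.single_apply, Rat.cast_sub, apply_ite (Rat.cast : ℚ → ℝ), Rat.cast_one, Rat.cast_zero]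

theorem Sub.val_rat (σ : Sub V) (S : Finset V) :
    ∃ r : ℚ, σ.val (Pi.single S 1) = r := by
  refine ⟨(Pi.single S 1 : Finset V → ℚ) (σ.X ∪ σ.Y) + (Pi.single S 1 : Finset V → ℚ) (σ.X ∪ σ.Z)
    - (Pi.single S 1 : Finset V → ℚ) σ.X - (Pi.single S 1 : Finset V → ℚ) (σ.X ∪ σ.Y ∪ σ.Z), ?_⟩
  simp only [Sub.val, Pi.single_apply, Rat.cast_sub, Rat.cast_add,
    apply_ite (Rat.cast : ℚ → ℝ), Rat.cast_one, Rat.cast_zero]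

instance [Finite V] : Finite (Mon V) :=
  Finite.of_injective (fun μ : Mon V => (μ.Y, μ.X)) fun a b h => by
    cases a; cases b; simp_all

instance [Finite V] : Finite (Sub V) :=
  Finite.of_injective (fun μ : Sub V => (μ.Y, μ.Z, μ.X)) fun a b h => by
    cases a; cases b; simp_all

/-- The slack of a Shannon inequality is a nonnegative combination of the basic Shannon inequalities,
by Farkas' lemma. -/
theorem exists_multipliers [Finite V] {S' : Schema V} {Δ : Finset (Mon V)} {lam : Finset V → ℝ}
    {w : Mon V → ℝ} (h : IsShannon S' Δ lam w) :
    ∃ (a : Mon V → ℝ) (b : Sub V → ℝ), (∀ μ, 0 ≤ a μ) ∧ (∀ σ, 0 ≤ b σ) ∧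
      ∀ g : Finset V → ℝ, ∑ Z ∈ S', lam Z * (g Z - g ∅) + ∑ᶠ μ, a μ * μ.val g +
        ∑ᶠ σ, b σ * σ.val g = ∑ δ ∈ Δ, w δ * δ.val g := by
  classical
  have := Fintype.ofFinite (Mon V)
  have := Fintype.ofFinite (Sub V)
  obtain ⟨c, hc, hφ⟩ := farkas (Finset.univ : Finset (Mon V ⊕ Sub V))
    (Sum.elim Mon.lin Sub.lin)
    (∑ δ ∈ Δ, w δ • δ.lin - ∑ Z ∈ S', lam Z • (evalAt Z - evalAt ∅)) (by
      intro g hg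
      have := h (fun Z => g Z - g ∅) ⟨by simp, fun μ => by
          have := hg (.inl μ) (Finset.mem_univ _)
          simp only [Sum.elim_inl, Mon.lin_apply, Mon.val] at this ⊢; linarith, fun σ => by
          have := hg (.inr σ) (Finset.mem_univ _)
          simp only [Sum.elim_inr, Sub.lin_apply, Sub.val] at this ⊢; linarith⟩
      simp only [LinearMap.sub_apply, LinearMap.sum_apply, LinearMap.smul_apply, smul_eq_mul,
        evalAt_apply, Mon.lin_apply]
      simp only [Mon.val, sub_sub_sub_cancel_right] at this ⊢
      linarith)
  refine ⟨fun μ => c (.inl μ), fun σ => c (.inr σ), fun _ => hc _, fun _ => hc _, fun g => ?_⟩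
  have := congrArg (fun f : (Finset V → ℝ) →ₗ[ℝ] ℝ => f g) hφ
  simp only [LinearMap.sub_apply, LinearMap.sum_apply, LinearMap.smul_apply, smul_eq_mul,
        LinearMap.add_apply, evalAt_apply, Mon.lin_apply, Fintype.sum_sum_type, Sum.elim_inl, Sum.elim_inr,
        Sub.lin_apply] at this
  rw [finsum_eq_sum_of_fintype, finsum_eq_sum_of_fintype]
  linarith

theorem exists_common_denom {I : Type*} [Fintype I] (y : I → ℚ) (hy : ∀ i, 0 ≤ y i) :
    ∃ (q : ℕ) (m : I → ℕ), 0 < q ∧ ∀ i, (m i : ℚ) = q * y i := by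
  refine ⟨∏ i, (y i).den, fun i => ((∏ i, (y i).den) / (y i).den) * (y i).num.toNat,
    Finset.prod_pos fun i _ => (y i).den_pos, fun i => ?_⟩
  have hd : (y i).den ∣ ∏ i, (y i).den := Finset.dvd_prod_of_mem _ (Finset.mem_univ i)
  have h1 : (((y i).num.toNat : ℕ) : ℚ) = (y i).num := by
    have : 0 ≤ (y i).num := Rat.num_nonneg.2 (hy i)
    exact_mod_cast Int.toNat_of_nonneg this
  have h2 : ((y i).den : ℚ) ≠ 0 := by exact_mod_cast (y i).den_pos.ne'
  rw [Nat.cast_mul, Nat.cast_div hd h2, h1, div_mul_eq_mul_div, mul_div_assoc, Rat.num_div_den]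

/-- A Shannon inequality with real weights gives rise to finitely many integral certificates, such
that for each vector `d` of degrees some certificate yields a bound that is at least as good as
`∏ d δ ^ w δ`. They are the basic solutions of the linear program whose variables are the
coefficients of an identity and whose objective is the logarithm of the bound. -/
theorem exists_certs [Finite V] {S' : Schema V} {Δ : Finset (Mon V)} {lam : Finset V → ℝ}
    {w : Mon V → ℝ} (hlam : ∀ Z ∈ S', 0 ≤ lam Z) (hlam1 : ∑ Z ∈ S', lam Z = 1)
    (hw : ∀ δ ∈ Δ, 0 ≤ w δ) (hS : IsShannon S' Δ lam w) :
    ∃ F : Set (Cert V), F.Finite ∧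
      (∀ c ∈ F, 0 < Multiset.card c.Zs ∧ (∀ Z ∈ c.Zs, Z ∈ S') ∧ (∀ δ ∈ c.Ds, δ ∈ Δ)) ∧
      ∀ d : Mon V → ℝ, (∀ δ ∈ Δ, 1 ≤ d δ) →
        ∃ c ∈ F, (c.Ds.map d).prod ≤ (∏ δ ∈ Δ, d δ ^ w δ) ^ (Multiset.card c.Zs) := by
  classical
  have := Fintype.ofFinite (Mon V)
  have := Fintype.ofFinite (Sub V)
  have := Fintype.ofFinite V
  obtain ⟨a, b, ha, hb, hab⟩ := exists_multipliers hS
  choose ρ hρ using Mon.val_rat (V := V)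
  choose ρ' hρ' using Sub.val_rat (V := V)
  let I := {Z // Z ∈ S'} ⊕ {δ // δ ∈ Δ} ⊕ Mon V ⊕ Sub V
  -- a row for each `S`, which says that `h(S)` has coefficient `0` in the identity, and a row which
  -- says that the coefficients of the targets sum to `1`
  let A : Finset V ⊕ Unit → I → ℚ := Sum.elim
    (fun S => Sum.elim (fun Z => (Pi.single S 1 : Finset V → ℚ) Z - (Pi.single S 1 : Finset V → ℚ) ∅)
      (Sum.elim (fun δ => - ρ δ S) (Sum.elim (fun μ => ρ μ S) (fun σ => ρ' σ S))))
    (fun _ => Sum.elim (fun _ => 1) (fun _ => 0))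
  let rhs : Finset V ⊕ Unit → ℚ := Sum.elim (fun _ => 0) (fun _ => 1)
  obtain ⟨F, hF, hFsol, hFopt⟩ := exists_basic A rhs
  have hcert : ∀ y ∈ F, ∃ (c : Cert V) (q : ℕ), 0 < q ∧ Multiset.card c.Zs = q ∧
      (∀ Z ∈ c.Zs, Z ∈ S') ∧ (∀ δ ∈ c.Ds, δ ∈ Δ) ∧
      ∀ d : Mon V → ℝ, (∀ δ ∈ Δ, 1 ≤ d δ) → (c.Ds.map d).prod =
        (∏ δ : {δ // δ ∈ Δ}, d δ ^ ((y (.inr (.inl δ)) : ℚ) : ℝ)) ^ q := by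
    intro y hy
    obtain ⟨hy0, hyA⟩ := hFsol y hy
    obtain ⟨q, m, hq, hm⟩ := exists_common_denom y hy0
    have hm' : ∀ i, (m i : ℝ) = q * y i := fun i => by exact_mod_cast hm i
    have hid : ∀ h : Finset V → ℝ,
        ∑ Z : {Z // Z ∈ S'}, (m (.inl Z) : ℝ) * (h Z - h ∅) +
          ∑ μ, (m (.inr (.inr (.inl μ))) : ℝ) * μ.val h +
          ∑ σ, (m (.inr (.inr (.inr σ))) : ℝ) * σ.val h =
        ∑ δ : {δ // δ ∈ Δ}, (m (.inr (.inl δ)) : ℝ) * δ.1.val h := by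
      let G : (Finset V → ℝ) →ₗ[ℝ] ℝ :=
        ∑ Z : {Z // Z ∈ S'}, (m (.inl Z) : ℝ) • (evalAt Z.1 - evalAt ∅) +
          ∑ μ, (m (.inr (.inr (.inl μ))) : ℝ) • Mon.lin μ +
          ∑ σ, (m (.inr (.inr (.inr σ))) : ℝ) • Sub.lin σ -
        ∑ δ : {δ // δ ∈ Δ}, (m (.inr (.inl δ)) : ℝ) • δ.1.lin
      have hG : ∀ h, G h = 0 := by
        intro h
        rw [linear_eq_sum]
        refine Finset.sum_eq_zero fun S _ => ?_
        have h1 := hyA (.inl S)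
        have h2 : ((∑ i, A (.inl S) i * y i : ℚ) : ℝ) = 0 := by rw [h1]; simp [rhs]
        simp only [G, LinearMap.sub_apply, LinearMap.add_apply, LinearMap.sum_apply,
          LinearMap.smul_apply, smul_eq_mul, evalAt_apply, Mon.lin_apply, Sub.lin_apply,
          hρ, hρ', hm']
        simp only [A, I, Fintype.sum_sum_type, Sum.elim_inl, Sum.elim_inr, neg_mul,
          Finset.sum_neg_distrib, Pi.single_apply] at h2
        push_cast at h2
        simp only [apply_ite (Rat.cast : ℚ → ℝ), Rat.cast_one, Rat.cast_zero] at h2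
        simp only [Pi.single_apply]
        simp only [mul_assoc, ← Finset.mul_sum]
        refine mul_eq_zero_of_left ?_ _
        have h3 : (q : ℝ) * _ = q * 0 := congrArg (fun r => (q : ℝ) * r) h2
        simp only [mul_add, mul_neg, Finset.mul_sum, mul_zero] at h3 ⊢
        simp only [mul_comm] at h3 ⊢
        linarith
      intro h
      have := hG h
      simp only [G, LinearMap.sub_apply, LinearMap.add_apply, LinearMap.sum_apply,
          LinearMap.smul_apply, smul_eq_mul, evalAt_apply, Mon.lin_apply,
          Sub.lin_apply] at this
      linarith
    refine ⟨⟨∑ Z : {Z // Z ∈ S'}, m (.inl Z) • {Z.1}, ∑ δ : {δ // δ ∈ Δ}, m (.inr (.inl δ)) • {δ.1},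
      ∑ μ, m (.inr (.inr (.inl μ))) • {μ}, ∑ σ, m (.inr (.inr (.inr σ))) • {σ}, ?_⟩, q, hq, ?_, ?_,
      ?_, ?_⟩
    · intro h
      rw [sum_map_sum_nsmul _ (fun Z : {Z // Z ∈ S'} => Z.1),
        sum_map_sum_nsmul _ (fun δ : {δ // δ ∈ Δ} => δ.1),
        sum_map_sum_nsmul _ (fun μ => μ), sum_map_sum_nsmul _ (fun σ => σ)]
      exact hid h
    · have h1 := hyA (.inr ())
      simp only [A, I, rhs, Fintype.sum_sum_type, Sum.elim_inl, Sum.elim_inr, one_mul, zero_mul,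
        Finset.sum_const_zero, add_zero] at h1
      rw [card_sum_nsmul _ (fun Z : {Z // Z ∈ S'} => Z.1)]
      have : ((∑ Z : {Z // Z ∈ S'}, m (.inl Z) : ℕ) : ℚ) = q := by
        push_cast
        simp only [hm, ← Finset.mul_sum]
        rw [h1, mul_one]
      exact_mod_cast this
    · intro Z hZ
      obtain ⟨Z', -, hZ'⟩ := Multiset.mem_sum.1 hZ
      have := Multiset.mem_of_mem_nsmul hZ'
      rw [Multiset.mem_singleton] at this
      exact this ▸ Z'.2
    · intro Z hZ
      obtain ⟨Z', -, hZ'⟩ := Multiset.mem_sum.1 hZ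
      have := Multiset.mem_of_mem_nsmul hZ'
      rw [Multiset.mem_singleton] at this
      exact this ▸ Z'.2
    · intro d hd
      rw [prod_map_sum_nsmul _ (fun δ : {δ // δ ∈ Δ} => δ.1), ← Finset.prod_pow]
      refine Finset.prod_congr rfl fun δ _ => ?_
      have := hd δ δ.2
      rw [← Real.rpow_natCast, ← Real.rpow_natCast, ← Real.rpow_mul (by linarith), hm', mul_comm]
  have : Nonempty (Cert V) := ⟨⟨0, 0, 0, 0, fun h => by simp⟩⟩
  choose! c hc using hcert
  refine ⟨c '' F, hF.image c, ?_, ?_⟩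
  · rintro _ ⟨y, hy, rfl⟩
    obtain ⟨q, hq, hcard, hZ, hD, -⟩ := hc y hy
    exact ⟨hcard ▸ hq, hZ, hD⟩
  · intro d hd
    obtain ⟨y, hyF, hy⟩ := hFopt
      (Sum.elim (fun Z => lam Z) (Sum.elim (fun δ => w δ) (Sum.elim a b)))
      (Sum.elim (fun _ => 0) (Sum.elim (fun δ => Real.log (d δ)) (fun _ => 0)))
      (by
        rintro (Z | δ | μ | σ)
        exacts [hlam _ Z.2, hw _ δ.2, ha _, hb _])
      (by
        rintro (Z | δ | μ | σ)
        exacts [le_rfl, Real.log_nonneg (hd _ δ.2), le_rfl, le_rfl])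
      (by
        rintro (S | _)
        · have := hab (Pi.single S 1)
          rw [finsum_eq_sum_of_fintype, finsum_eq_sum_of_fintype, ← Finset.sum_coe_sort S',
            ← Finset.sum_coe_sort Δ] at this
          simp only [A, I, rhs, Fintype.sum_sum_type, Sum.elim_inl, Sum.elim_inr, Pi.single_apply]
          simp only [hρ, hρ', Pi.single_apply] at this
          push_cast
          simp only [neg_mul, Finset.sum_neg_distrib,
            apply_ite (Rat.cast : ℚ → ℝ), Rat.cast_one, Rat.cast_zero]
          simp only [mul_comm] at this ⊢
          linarith
        · simp only [A, I, rhs, Fintype.sum_sum_type, Sum.elim_inl, Sum.elim_inr]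
          rw [← Finset.sum_coe_sort] at hlam1
          simpa using hlam1)
    obtain ⟨q, hq, hcard, -, -, hprod⟩ := hc y hyF
    refine ⟨c y, ⟨y, hyF, rfl⟩, ?_⟩
    rw [hprod d hd, hcard, ← Finset.prod_coe_sort Δ]
    have hpos : ∀ δ : {δ // δ ∈ Δ}, 0 < d δ := fun δ => zero_lt_one.trans_le (hd δ δ.2)
    refine pow_le_pow_left₀ (Finset.prod_nonneg fun δ _ => Real.rpow_nonneg (hpos δ).le _) ?_ _
    simp only [I, Fintype.sum_sum_type, Sum.elim_inl, Sum.elim_inr, zero_mul,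
      Finset.sum_const_zero, add_zero, zero_add] at hy
    have hexp : ∀ u : {δ // δ ∈ Δ} → ℝ,
        ∏ δ : {δ // δ ∈ Δ}, d δ ^ u δ = Real.exp (∑ δ : {δ // δ ∈ Δ}, Real.log (d δ) * u δ) := by
      intro u
      rw [Real.exp_sum]
      exact Finset.prod_congr rfl fun δ _ => Real.rpow_def_of_pos (hpos δ) _
    rw [hexp, hexp]
    exact Real.exp_le_exp.2 hy

end certificates

/-! ### Functions computed by programs -/

/-- Data types with a representation by machine values. No injectivity is required: programs are only
ever run on representations of given data. -/
class Enc (α : Type*) where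
  /-- The machine value that represents `a`. -/
  enc : α → Val

open Enc (enc)

instance : Enc ℕ := ⟨Val.atom⟩
instance : Enc Bool := ⟨fun b => .atom (if b then 1 else 0)⟩
instance {α β : Type*} [Enc α] [Enc β] : Enc (α × β) := ⟨fun x => .cell (enc x.1) (enc x.2)⟩
instance {α : Type*} [Enc α] : Enc (List α) := ⟨fun l => Val.ofList (l.map enc)⟩

section functions
variable {α β γ ε σ τ : Type*} [Enc α] [Enc β] [Enc γ] [Enc ε] [Enc σ] [Enc τ]

/-- `Computes p f T`: some program computes `f` on the representations of all inputs `a` with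
`p a`, in `O(T a + 1)` steps. -/
def Computes (p : α → Prop) (f : α → β) (T : α → ℕ) : Prop :=
  ∃ (P : Prog) (c : ℕ), ∀ a, p a → ∃ t, P.Runs (enc a) (enc (f a)) t ∧ t ≤ c * (T a + 1)

/-- The function `f` is computed in constant time. -/
@[fun_prop]
def Const (f : α → β) : Prop := Computes (fun _ => True) f fun _ => 0

namespace Computes

variable {p q : α → Prop} {f : α → β} {T : α → ℕ}

/-- Transfer along a change of the types of the data that does not change their representation. -/
theorem of_enc {α' β' : Type*} [Enc α'] [Enc β'] {p' : α' → Prop} {f' : α' → β'} {T' : α' → ℕ}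
    (h : Computes p' f' T') (k : ℕ)
    (e : ∀ a, p a → ∃ a', p' a' ∧ enc a' = enc a ∧ enc (f' a') = enc (f a) ∧
      T' a' ≤ k * (T a + 1)) :
    Computes p f T := by
  obtain ⟨P, c, hP⟩ := h
  refine ⟨P, c * (k + 1), fun a ha => ?_⟩
  obtain ⟨a', ha', h1, h2, h3⟩ := e a ha
  obtain ⟨t, ht, htc⟩ := hP a' ha'
  refine ⟨t, h1 ▸ h2 ▸ ht, htc.trans ?_⟩
  rw [mul_assoc]
  exact Nat.mul_le_mul_left _ (by nlinarith)

theorem mono (h : Computes p f T) (g : α → β) (U : α → ℕ) (k : ℕ)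
    (e : ∀ a, q a → p a ∧ g a = f a ∧ T a ≤ k * (U a + 1)) : Computes q g U :=
  h.of_enc k fun a ha => ⟨a, (e a ha).1, rfl, by rw [(e a ha).2.1], (e a ha).2.2⟩

theorem weaken (h : Computes p f T) {U : α → ℕ} (k : ℕ)
    (hU : ∀ a, q a → p a ∧ T a ≤ k * (U a + 1)) : Computes q f U :=
  h.mono f U k fun a ha => ⟨(hU a ha).1, rfl, (hU a ha).2⟩

theorem comp {g : β → γ} {r : β → Prop} {U : β → ℕ} (hg : Computes r g U) (hf : Computes p f T)
    (hr : ∀ a, p a → r (f a)) : Computes p (fun a => g (f a)) (fun a => T a + U (f a)) := by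
  obtain ⟨P, c, hP⟩ := hf
  obtain ⟨Q, d, hQ⟩ := hg
  refine ⟨.comp P Q, c + d + 1, fun a ha => ?_⟩
  obtain ⟨t, ht, htc⟩ := hP a ha
  obtain ⟨u, hu, huc⟩ := hQ _ (hr a ha)
  refine ⟨_, .comp ht hu, ?_⟩
  nlinarith [Nat.zero_le (c * U (f a)), Nat.zero_le (d * T a), Nat.zero_le (T a),
    Nat.zero_le (U (f a))]

theorem pair {g : α → γ} {U : α → ℕ} (hf : Computes p f T) (hg : Computes p g U) :
    Computes p (fun a => (f a, g a)) (fun a => T a + U a) := by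
  obtain ⟨P, c, hP⟩ := hf
  obtain ⟨Q, d, hQ⟩ := hg
  refine ⟨.cell P Q, c + d + 1, fun a ha => ?_⟩
  obtain ⟨t, ht, htc⟩ := hP a ha
  obtain ⟨u, hu, huc⟩ := hQ a ha
  refine ⟨_, .cell ht hu, ?_⟩
  nlinarith [Nat.zero_le (c * U a), Nat.zero_le (d * T a), Nat.zero_le (T a),
    Nat.zero_le (U a)]

theorem cons {f : α → β} {g : α → List β} {U : α → ℕ} (hf : Computes p f T)
    (hg : Computes p g U) : Computes p (fun a => f a :: g a) (fun a => T a + U a) :=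
  hf.pair hg

/-- Branching. -/
theorem branch {c₀ : α → Bool} {g : α → β} {pf pg : α → Prop} {Tc Tg U : α → ℕ}
    (hc : Computes p c₀ Tc) (hf : Computes pf f T) (hg : Computes pg g Tg)
    (h1 : ∀ a, p a → c₀ a = true → pf a ∧ Tc a + T a ≤ U a)
    (h0 : ∀ a, p a → c₀ a = false → pg a ∧ Tc a + Tg a ≤ U a) :
    Computes p (fun a => bif c₀ a then f a else g a) U := by
  obtain ⟨R, r, hR⟩ := hc
  obtain ⟨P, c, hP⟩ := hf
  obtain ⟨Q, d, hQ⟩ := hg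
  refine ⟨.cond R P Q, c + d + r + 1, fun a ha => ?_⟩
  obtain ⟨s, hs, hsc⟩ := hR a ha
  cases hca : c₀ a
  · obtain ⟨hpg, hU⟩ := h0 a ha hca
    obtain ⟨t, ht, htc⟩ := hQ a hpg
    rw [hca] at hs
    simp only [hca, cond_false]
    refine ⟨_, .cond_false hs ht, ?_⟩
    nlinarith [Nat.zero_le (c * U a), Nat.zero_le (d * Tc a), Nat.zero_le (r * Tg a),
      Nat.mul_le_mul_left d hU, Nat.mul_le_mul_left r hU]
  · obtain ⟨hpg, hU⟩ := h1 a ha hca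
    obtain ⟨t, ht, htc⟩ := hP a hpg
    rw [hca] at hs
    simp only [hca, cond_true]
    refine ⟨_, .cond_true hs (by simp [enc]) ht, ?_⟩
    nlinarith [Nat.zero_le (d * U a), Nat.zero_le (c * Tc a), Nat.zero_le (r * T a),
      Nat.mul_le_mul_left c hU, Nat.mul_le_mul_left r hU]

/-- Loops: `val` is a quantity that the body `step` preserves, and that `fin` computes once the
test `c` fails. The potential `U` bounds the time of the remaining iterations. -/
theorem loop {ps pf p : σ → Prop} {val fin : σ → γ} {c : σ → Bool} {step : σ → σ}
    {Tc Ts Tf U : σ → ℕ} (hc : Computes p c Tc) (hs : Computes ps step Ts)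
    (hf : Computes pf fin Tf)
    (h1 : ∀ s, p s → c s = true → ps s ∧ p (step s) ∧ val (step s) = val s ∧
      Tc s + Ts s + U (step s) + 1 ≤ U s)
    (h0 : ∀ s, p s → c s = false → pf s ∧ val s = fin s ∧ Tc s + Tf s ≤ U s) :
    Computes p val U := by
  obtain ⟨R, r, hR⟩ := hc
  obtain ⟨P, d, hP⟩ := hs
  obtain ⟨Q, e, hQ⟩ := hf
  refine ⟨.comp (.loop R P) Q, r + d + e + 2, fun s => ?_⟩
  have key : ∀ (n : ℕ) (s : σ), U s ≤ n → p s → ∃ (s' : σ) (t u : ℕ), (Prog.loop R P).Runs (enc s) (enc s') t ∧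
      Q.Runs (enc s') (enc (val s)) u ∧ t + u + 1 ≤ (r + d + e + 2) * (U s + 1) := by
    intro n
    induction n with
    | zero =>
      intro s hn hs
      obtain ⟨t, ht, htc⟩ := hR s hs
      cases hcs : c s
      · obtain ⟨hpf, hval, hU⟩ := h0 s hs hcs
        obtain ⟨u, hu, huc⟩ := hQ s hpf
        rw [hcs] at ht
        refine ⟨s, _, u, Prog.Runs.loop_stop ht, hval ▸ hu, ?_⟩
        nlinarith [Nat.zero_le (d * U s), Nat.mul_le_mul_left e hU, Nat.mul_le_mul_left r hU,
          Nat.zero_le (r * Tf s), Nat.zero_le (e * Tc s)]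
      · have := (h1 s hs hcs).2.2.2
        omega
    | succ n ih =>
      intro s hn hs
      obtain ⟨t, ht, htc⟩ := hR s hs
      cases hcs : c s
      · obtain ⟨hpf, hval, hU⟩ := h0 s hs hcs
        obtain ⟨u, hu, huc⟩ := hQ s hpf
        rw [hcs] at ht
        refine ⟨s, _, u, Prog.Runs.loop_stop ht, hval ▸ hu, ?_⟩
        nlinarith [Nat.zero_le (d * U s), Nat.mul_le_mul_left e hU, Nat.mul_le_mul_left r hU,
          Nat.zero_le (r * Tf s), Nat.zero_le (e * Tc s)]
      · obtain ⟨hps, hp', hval, hU⟩ := h1 s hs hcs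
        obtain ⟨u, hu, huc⟩ := hP s hps
        obtain ⟨s', v, w, hv, hw, hvw⟩ := ih (step s) (by omega) hp'
        rw [hcs] at ht
        refine ⟨s', _, w, .loop_step ht (by simp [enc]) hu hv, hval ▸ hw, ?_⟩
        have := Nat.mul_le_mul_left (r + d + e + 2) hU
        nlinarith [Nat.zero_le (r * Ts s), Nat.zero_le (d * Tc s), Nat.zero_le (e * Tc s),
          Nat.zero_le (e * Ts s), Nat.zero_le (Ts s), Nat.zero_le (Tc s)]
  intro hs
  obtain ⟨s', t, u, ht, hu, htu⟩ := key (U s) s le_rfl hs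
  exact ⟨_, .comp ht hu, htu⟩

end Computes

theorem exists_prog_const (y : Val) : ∃ (P : Prog) (t : ℕ), ∀ x, P.Runs x y t := by
  induction y with
  | atom n => exact ⟨.const n, 1, fun x => .const n x⟩
  | cell a b iha ihb =>
    obtain ⟨P, s, hP⟩ := iha
    obtain ⟨Q, t, hQ⟩ := ihb
    exact ⟨.cell P Q, s + t + 1, fun x => .cell (hP x) (hQ x)⟩

namespace Const

@[fun_prop] theorem id : Const fun a : α => a :=
  ⟨.id, 1, fun _ _ => ⟨1, .id _, le_rfl⟩⟩

@[fun_prop] theorem const (b : β) : Const fun _ : α => b := by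
  obtain ⟨P, t, hP⟩ := exists_prog_const (enc b)
  exact ⟨P, t, fun a _ => ⟨t, hP _, by simp⟩⟩

@[fun_prop] theorem comp {g : β → γ} {f : α → β} (hg : Const g) (hf : Const f) :
    Const fun a => g (f a) := Computes.comp hg hf fun _ _ => trivial

theorem fst_prim : Const (Prod.fst : α × β → α) :=
  ⟨.fst, 1, fun _ _ => ⟨1, .fst _, le_rfl⟩⟩

theorem snd_prim : Const (Prod.snd : α × β → β) :=
  ⟨.snd, 1, fun _ _ => ⟨1, .snd _, le_rfl⟩⟩

@[fun_prop] theorem fst {f : α → β × γ} (hf : Const f) : Const fun a => (f a).1 := fst_prim.comp hf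
@[fun_prop] theorem snd {f : α → β × γ} (hf : Const f) : Const fun a => (f a).2 := snd_prim.comp hf

@[fun_prop] theorem mk {f : α → β} {g : α → γ} (hf : Const f) (hg : Const g) :
    Const fun a => (f a, g a) := Computes.pair hf hg

@[fun_prop] theorem cons {f : α → β} {g : α → List β} (hf : Const f) (hg : Const g) :
    Const fun a => f a :: g a := Computes.cons hf hg

@[fun_prop] theorem branch {c : α → Bool} {f g : α → β} (hc : Const c) (hf : Const f) (hg : Const g) :
    Const fun a => bif c a then f a else g a :=
  Computes.branch hc hf hg (fun _ _ _ => ⟨trivial, le_rfl⟩) (fun _ _ _ => ⟨trivial, le_rfl⟩)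

@[fun_prop] theorem not {c : α → Bool} (hc : Const c) : Const fun a => !(c a) := by
  have e : (fun a => !(c a)) = fun a => bif c a then false else true := by
    ext a; cases c a <;> rfl
  rw [e]; exact Const.branch hc (const false) (const true)

@[fun_prop] theorem and {c d : α → Bool} (hc : Const c) (hd : Const d) :
    Const fun a => c a && d a := by
  have e : (fun a => c a && d a) = fun a => bif c a then d a else false := by
    ext a; cases c a <;> rfl
  rw [e]; exact Const.branch hc hd (const false)

theorem lt_prim : Const fun x : ℕ × ℕ => decide (x.1 < x.2) :=
  ⟨.lt, 1, fun a _ => ⟨1, by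
    have := Prog.Runs.lt (enc a)
    by_cases h : a.1 < a.2 <;> simpa [enc, Val.fst, Val.snd, Val.num, h] using this, le_rfl⟩⟩

@[fun_prop] theorem lt {f g : α → ℕ} (hf : Const f) (hg : Const g) :
    Const fun a => decide (f a < g a) := Const.comp lt_prim (hf.mk hg)

@[fun_prop] theorem isEmpty {f : α → List β} (hf : Const f) : Const fun a => (f a).isEmpty := by
  have : Const (List.isEmpty : List β → Bool) :=
    ⟨.cond .id (.const 0) (.const 1), 3, fun l _ => by
      cases l with
      | nil => exact ⟨3, .cond_false (.id _) (.const _ _), le_rfl⟩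
      | cons a l => exact ⟨3, .cond_true (.id _) (by simp [enc, Val.ofList]) (.const _ _), le_rfl⟩⟩
  exact this.comp hf

theorem computes {f : α → β} (hf : Const f) (p : α → Prop) (T : α → ℕ) : Computes p f T :=
  Computes.weaken hf 0 fun _ _ => ⟨trivial, by simp⟩

end Const

end functions

/-! ### Programs for lists -/

section lists
variable {α β γ ε σ τ : Type*} [Enc α] [Enc β] [Enc γ] [Enc ε] [Enc σ] [Enc τ]

namespace Computes

/-- Folds with a parameter `e` that stays fixed; `q` is an invariant of the state, and the potential
`U` pays for the remaining steps. -/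
theorem foldl {f : ε → β → α → β} {p : (ε × β) × α → Prop} {T : (ε × β) × α → ℕ}
    (hf : Computes p (fun x => f x.1.1 x.1.2 x.2) T)
    {q : (ε × β) × List α → Prop} {U : (ε × β) × List α → ℕ}
    (h : ∀ e b a l, q ((e, b), a :: l) → p ((e, b), a) ∧ q ((e, f e b a), l) ∧
      T ((e, b), a) + 1 + U ((e, f e b a), l) ≤ U ((e, b), a :: l)) :
    Computes q (fun x => x.2.foldl (f x.1.1) x.1.2) U := by
  have hstep : Computes (fun x : (ε × β) × (α × List α) => p (x.1, x.2.1))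
      (fun x => ((x.1.1, f x.1.1 x.1.2 x.2.1), x.2.2)) (fun x => T (x.1, x.2.1)) := by
    have h1 : Const fun x : (ε × β) × (α × List α) => (x.1, x.2.1) := by fun_prop
    have h2 := hf.comp (h1.computes (fun x => p (x.1, x.2.1)) 0) (fun _ h => h)
    have h3 : Const fun x : (ε × β) × (α × List α) => x.1.1 := by fun_prop
    have h4 : Const fun x : (ε × β) × (α × List α) => x.2.2 := by fun_prop
    exact (((h3.computes _ 0).pair h2).pair (h4.computes _ 0)).weaken 1
      fun a ha => ⟨ha, by simp⟩
  have hstep' : Computes (fun s : (ε × β) × List α => ∃ a l, s.2 = a :: l ∧ p (s.1, a))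
      (fun s => match s.2 with
        | [] => s
        | a :: l => ((s.1.1, f s.1.1 s.1.2 a), l))
      (fun s => match s.2 with
        | [] => 0
        | a :: _ => T (s.1, a)) := by
    refine hstep.of_enc 1 ?_
    rintro ⟨e, l⟩ ⟨a, l, rfl, hp⟩
    exact ⟨(e, a, l), hp, rfl, rfl, by simp⟩
  have hc : Const fun s : (ε × β) × List α => !s.2.isEmpty := by fun_prop
  have hfin : Const fun s : (ε × β) × List α => s.1.2 := by fun_prop
  refine loop (hc.computes q 0) hstep' (hfin.computes (fun _ => True) 0) ?_ ?_
  · rintro ⟨⟨e, b⟩, l⟩ hq hl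
    cases l with
    | nil => simp at hl
    | cons a l =>
      obtain ⟨h1, h2, h3⟩ := h e b a l hq
      exact ⟨⟨a, l, rfl, h1⟩, h2, rfl, by simp only [Pi.zero_apply]; omega⟩
  · rintro ⟨⟨e, b⟩, l⟩ hq hl
    cases l with
    | nil => exact ⟨trivial, rfl, by simp⟩
    | cons a l => simp at hl

/-- `foldl` with a step function of constant cost. -/
theorem foldl_const {f : ε → β → α → β} (hf : Const fun x : (ε × β) × α => f x.1.1 x.1.2 x.2) :
    Computes (fun _ => True) (fun x : (ε × β) × List α => x.2.foldl (f x.1.1) x.1.2)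
      (fun x => x.2.length) :=
  foldl hf (fun e b a l _ => ⟨trivial, trivial, by simp; omega⟩)

theorem foldl_cons_eq {α : Type*} (l acc : List α) :
    l.foldl (fun acc a => a :: acc) acc = l.reverse ++ acc := by
  induction l generalizing acc with
  | nil => rfl
  | cons a l ih => simp [ih]

/-- Reversal onto an accumulator is the primitive from which reversal, concatenation and `flatMap`
are derived. -/
theorem reverseAppend : Computes (fun _ => True)
    (fun x : List α × List α => x.1.reverse ++ x.2) (fun x => x.1.length) := by
  have h1 : Const fun x : List α × List α => ((false, x.2), x.1) := by fun_prop
  have h2 : Const fun x : (Bool × List α) × α => x.2 :: x.1.2 := by fun_prop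
  refine ((foldl_const (f := fun (_ : Bool) (acc : List α) a => a :: acc) h2).comp h1
    (fun _ _ => trivial)).mono _ _ 1 fun x _ => ⟨trivial, (foldl_cons_eq _ _).symm, ?_⟩
  simp

theorem reverse : Computes (fun _ => True) (fun x : List α => x.reverse) List.length := by
  have h1 : Const fun x : List α => (x, ([] : List α)) := by fun_prop
  exact (reverseAppend.comp h1 (fun _ _ => trivial)).mono _ _ 1 fun x _ => ⟨trivial, by simp, by simp⟩

theorem append : Computes (fun _ => True)
    (fun x : List α × List α => x.1 ++ x.2) (fun x => x.1.length) := by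
  have h1 : Const fun x : List α × List α => x.1 := by fun_prop
  have h2 : Const fun x : List α × List α => x.2 := by fun_prop
  have h3 := (reverse.comp h1 (fun _ _ => trivial)).pair h2
  refine (reverseAppend.comp h3 (fun _ _ => trivial)).mono _ _ 3 fun x _ => ⟨trivial, by simp, ?_⟩
  simp only [List.length_reverse]
  omega

/-- The results are accumulated in reverse order, at a cost that is linear in their lengths, and
reversed at the end. -/
theorem flatMap {f : ε → α → List β} {p : ε × α → Prop} {T : ε × α → ℕ}
    (hf : Computes p (fun x => f x.1 x.2) T) :
    Computes (fun x : ε × List α => ∀ a ∈ x.2, p (x.1, a)) (fun x => x.2.flatMap (f x.1))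
      (fun x => (x.2.map fun a => T (x.1, a) + (f x.1 a).length + 1).sum) := by
  have h1 : Const fun x : (ε × List β) × α => (x.1.1, x.2) := by fun_prop
  have h2 : Const fun x : (ε × List β) × α => x.1.2 := by fun_prop
  have h3 := reverseAppend.comp (((hf.comp (h1.computes (fun x => p (x.1.1, x.2)) 0)
    (fun _ h => h))).pair (h2.computes _ 0)) (fun _ _ => trivial)
  have h4 := foldl (f := fun e (acc : List β) a => (f e a).reverse ++ acc) h3
    (q := fun x => ∀ a ∈ x.2, p (x.1.1, a))
    (U := fun x => (x.2.map fun a => T (x.1.1, a) + (f x.1.1 a).length + 1).sum) (by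
      intro e b a l h
      refine ⟨h a (by simp), fun a' ha' => h a' (by simp [ha']), ?_⟩
      simp only [Pi.zero_apply, List.map_cons, List.sum_cons]
      omega)
  have h5 : Const fun x : ε × List α => ((x.1, ([] : List β)), x.2) := by fun_prop
  have key : ∀ (e : ε) (l : List α) (acc : List β),
      l.foldl (fun acc a => (f e a).reverse ++ acc) acc = (l.flatMap (f e)).reverse ++ acc := by
    intro e l
    induction l with
    | nil => simp
    | cons a l ih => intro acc; simp [ih]
  refine (reverse.comp (h4.comp (h5.computes (fun x => ∀ a ∈ x.2, p (x.1, a)) 0) (fun _ h => h))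
    (fun _ _ => trivial)).mono _ _ 2 fun x hx => ⟨hx, by simp [key], ?_⟩
  simp only [key, Pi.zero_apply, List.append_nil, List.length_reverse, List.length_flatMap]
  have : (x.2.map fun a => (f x.1 a).length).sum ≤
      (x.2.map fun a => T (x.1, a) + (f x.1 a).length + 1).sum :=
    List.sum_le_sum fun a _ => by omega
  omega

theorem map {f : ε → α → β} {p : ε × α → Prop} {T : ε × α → ℕ}
    (hf : Computes p (fun x => f x.1 x.2) T) :
    Computes (fun x : ε × List α => ∀ a ∈ x.2, p (x.1, a)) (fun x => x.2.map (f x.1))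
      (fun x => (x.2.map fun a => T (x.1, a) + 1).sum) := by
  have h1 : Computes p (fun x => [f x.1 x.2]) T :=
    (hf.cons ((Const.const ([] : List β)).computes p 0)).weaken 1 fun a ha => ⟨ha, by simp⟩
  refine (flatMap (f := fun e a => [f e a]) h1).mono _ _ 2 fun x hx => ⟨hx, ?_, ?_⟩
  · induction x.2 with
    | nil => rfl
    | cons a l ih => simpa using ih
  · have : (x.2.map fun a => T (x.1, a) + [f x.1 a].length + 1).sum ≤
        (x.2.map fun a => 2 * (T (x.1, a) + 1)).sum :=
      List.sum_le_sum fun a _ => by simp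
    rw [List.sum_map_mul_left] at this
    omega

theorem map_const {f : ε → α → β} (hf : Const fun x : ε × α => f x.1 x.2) :
    Computes (fun _ => True) (fun x : ε × List α => x.2.map (f x.1)) (fun x => x.2.length) :=
  (map hf).weaken 1 fun x _ => ⟨fun _ _ => trivial, by simp⟩

theorem filter {c : ε → α → Bool} (hc : Const fun x : ε × α => c x.1 x.2) :
    Computes (fun _ => True) (fun x : ε × List α => x.2.filter (c x.1)) (fun x => x.2.length) := by
  have h1 : Const fun x : ε × α => bif c x.1 x.2 then [x.2] else [] := by fun_prop
  refine (flatMap (f := fun e a => bif c e a then [a] else []) h1).mono _ _ 2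
    fun x hx => ⟨fun _ _ => trivial, ?_, ?_⟩
  · induction x.2 with
    | nil => rfl
    | cons a l ih => cases h : c x.1 a <;> simp [h, ih]
  · have : (x.2.map fun a => 0 + (bif c x.1 a then [a] else []).length + 1).sum ≤
        (x.2.map fun a => 2).sum :=
      List.sum_le_sum fun a _ => by cases c x.1 a <;> simp
    simp only [List.map_const', List.sum_replicate, smul_eq_mul] at this
    omega

theorem add_prim : Computes (fun _ => True) (fun x : ℕ × ℕ => x.1 + x.2)
    (fun x => x.1.size + x.2.size) :=
  ⟨.add, 1, fun _ _ => ⟨_, .add _, by simp [enc, Val.fst, Val.snd, Val.num]⟩⟩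

theorem mul_prim : Computes (fun _ => True) (fun x : ℕ × ℕ => x.1 * x.2)
    (fun x => (x.1.size + 1) * (x.2.size + 1)) :=
  ⟨.mul, 1, fun _ _ => ⟨_, .mul _, by simp [enc, Val.fst, Val.snd, Val.num]⟩⟩

/-- Lengths are not available in constant time: each increment is charged by the bit length of the
counter. -/
theorem length : Computes (fun _ => True) (fun x : List α => x.length)
    (fun x => x.length * x.length.size) := by
  have h1 : Const fun x : (Bool × ℕ) × α => (x.1.2, 1) := by fun_prop
  have h2 := foldl (f := fun (_ : Bool) n (_ : α) => n + 1)
    (add_prim.comp h1 (fun _ _ => trivial)) (q := fun _ => True)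
    (U := fun x => x.2.length * ((x.1.2 + x.2.length).size + 2)) (by
      intro e b a l _
      refine ⟨trivial, trivial, ?_⟩
      have h1 : b.size ≤ (b + (l.length + 1)).size := Nat.size_le_size (by omega)
      have h2 : (1 : ℕ).size = 1 := rfl
      have h3 : b + 1 + l.length = b + (l.length + 1) := by ring
      simp only [List.length_cons, h2, h3]
      nlinarith)
  have h3 : Const fun x : List α => ((false, 0), x) := by fun_prop
  have key : ∀ (l : List α) (n : ℕ), l.foldl (fun n _ => n + 1) n = n + l.length := by
    intro l
    induction l with
    | nil => simp
    | cons a l ih => intro n; simp [ih]; ring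
  refine (h2.comp h3 (fun _ _ => trivial)).mono _ _ 3 fun x _ => ⟨trivial, by simp [key], ?_⟩
  simp only [zero_add]
  rcases Nat.eq_zero_or_pos x.length with h | h
  · simp [h]
  · have : 1 ≤ x.length.size := Nat.size_pos.2 h
    nlinarith

end Computes

end lists

/-! ### Programs for records, vectors and tuples -/

/-- Machine values represent themselves. -/
instance : Enc Val := ⟨_root_.id⟩

section records
variable {α β ι : Type*} [Enc α] [Enc β]

/-- The position of `i` in `l` is fixed, so a component is reached by a fixed sequence of steps. -/
theorem exists_prog_get {l : List ι} {i : ι} (hi : i ∈ l) :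
    ∃ (P : Prog) (c : ℕ), ∀ G : ι → Val, ∃ t, P.Runs (Val.ofList (l.map G)) (G i) t ∧ t ≤ c := by
  induction l with
  | nil => simp at hi
  | cons j l ih =>
    by_cases hij : i = j
    · subst hij
      exact ⟨.fst, 1, fun G => ⟨1, .fst _, le_rfl⟩⟩
    · obtain ⟨P, c, hP⟩ := ih (by simpa [hij] using hi)
      refine ⟨.comp .snd P, c + 2, fun G => ?_⟩
      obtain ⟨t, ht, htc⟩ := hP G
      exact ⟨_, .comp (.snd _) ht, by omega⟩

/-- A component of a record that is stored as a list. -/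
theorem Const.get {l : List ι} {i : ι} (hi : i ∈ l) {G : α → ι → Val} {f : α → β}
    (hα : ∀ a, enc a = Val.ofList (l.map (G a))) (hf : ∀ a, enc (f a) = G a i) : Const f := by
  obtain ⟨P, c, hP⟩ := exists_prog_get hi
  refine ⟨P, c, fun a _ => ?_⟩
  obtain ⟨t, ht, htc⟩ := hP (G a)
  rw [hα, hf]
  exact ⟨t, ht, by simpa using htc⟩

theorem Computes.ofList {l : List ι} {p : α → Prop} {G : α → ι → Val} {T : α → ℕ}
    (h : ∀ i ∈ l, Computes p (fun a => G a i) T) :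
    Computes p (fun a => Val.ofList (l.map (G a))) T := by
  induction l with
  | nil => exact (Const.const (Val.ofList [])).computes p T
  | cons i l ih =>
    have h1 := h i (by simp)
    have h2 := ih fun j hj => h j (by simp [hj])
    exact (h1.pair h2).of_enc 2 fun a ha => ⟨a, ha, rfl, rfl, by ring_nf; omega⟩

/-- A record that is stored as a list is computed componentwise. -/
theorem Computes.record {l : List ι} {p : α → Prop} {G : α → ι → Val} {T : α → ℕ} {f : α → β}
    (hf : ∀ a, enc (f a) = Val.ofList (l.map (G a)))
    (h : ∀ i ∈ l, Computes p (fun a => G a i) T) : Computes p f T :=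
  (Computes.ofList h).of_enc 1 fun a ha => ⟨a, ha, rfl, (hf a).symm, by omega⟩

end records

section vectors
variable {V : Type*} {α : Type*} [Enc α]

/-- Vectors of values, one for each variable. Tuples over fewer attributes are handled as vectors
that vanish at the other variables. -/
def Vec (V : Type*) : Type _ := V → ℕ

/-- The list of the variables in which vectors are stored. -/
noncomputable abbrev vars (V : Type*) [Fintype V] : List V := (Finset.univ : Finset V).toList

noncomputable instance [Fintype V] : Enc (Vec V) := ⟨fun t => Val.ofList ((vars V).map fun v => .atom (t v))⟩

variable [Fintype V]

theorem mem_vars (v : V) : v ∈ vars V := by simp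

theorem Const.coord (v : V) {f : α → Vec V} (hf : Const f) : Const fun a => f a v :=
  Const.comp (g := fun t : Vec V => t v)
    (Const.get (mem_vars v) (G := fun t v => .atom (t v)) (fun _ => rfl) fun _ => rfl) hf

theorem Const.vec {f : α → Vec V} (hf : ∀ v, Const fun a => f a v) : Const f :=
  Computes.record (l := vars V) (G := fun a v => .atom (f a v)) (fun _ => rfl) fun v _ =>
    Computes.of_enc (hf v) 1 fun a _ => ⟨a, trivial, rfl, rfl, by simp⟩

/-- The list of the values of a vector; vectors are compared in the lexicographic order. -/
noncomputable def code (t : Vec V) : List ℕ := (vars V).map t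

theorem code_injective : Function.Injective (code (V := V)) := by
  intro t u h
  funext v
  exact List.map_inj_left.1 h v (mem_vars v)

@[fun_prop] theorem Const.code_lt {f g : α → Vec V} (hf : Const f) (hg : Const g) :
    Const fun a => decide (code (f a) < code (g a)) := by
  unfold code
  induction vars V with
  | nil =>
    have e : (fun a => decide (([] : List V).map (f a) < ([] : List V).map (g a))) =
        fun _ => false := by
      funext a
      exact decide_eq_false (lt_irrefl ([] : List ℕ))
    rw [e]
    exact Const.const false
  | cons v l ih =>
    have hf' := hf.coord v
    have hg' := hg.coord v
    have h : Const fun a => bif decide (f a v < g a v) then true else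
      bif decide (g a v < f a v) then false else decide (l.map (f a) < l.map (g a)) := by
      fun_prop
    have e : (fun a => decide ((v :: l).map (f a) < (v :: l).map (g a))) =
        fun a => bif decide (f a v < g a v) then true else
      bif decide (g a v < f a v) then false else decide (l.map (f a) < l.map (g a)) := by
      funext a
      change decide (f a v :: l.map (f a) < g a v :: l.map (g a)) = _
      simp only [List.cons_lt_cons_iff]
      rcases lt_trichotomy (f a v) (g a v) with h | h | h
      · simp [h]
      · simp [h]
      · simp [h, h.not_gt, h.ne']
    rw [e]
    exact h

variable [DecidableEq V]

/-- The restriction of a vector to the variables in `X`. -/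
def mask (X : Finset V) (t : Vec V) : Vec V := fun v => if v ∈ X then t v else 0

/-- The vector that equals `t` on `X` and `u` elsewhere. -/
def glue (X : Finset V) (t u : Vec V) : Vec V := fun v => if v ∈ X then t v else u v

@[fun_prop] theorem Const.mask (X : Finset V) {f : α → Vec V} (hf : Const f) :
    Const fun a => mask X (f a) := by
  refine Const.vec fun v => ?_
  by_cases hv : v ∈ X
  · simpa only [Panda.mask, hv, if_true] using hf.coord v
  · simpa only [Panda.mask, hv, if_false] using Const.const 0

@[fun_prop] theorem Const.glue (X : Finset V) {f g : α → Vec V} (hf : Const f) (hg : Const g) :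
    Const fun a => glue X (f a) (g a) := by
  refine Const.vec fun v => ?_
  by_cases hv : v ∈ X
  · simpa only [Panda.glue, hv, if_true] using hf.coord v
  · simpa only [Panda.glue, hv, if_false] using hg.coord v

/-- A tuple, extended by zero to a vector. -/
def extend {X : Finset V} (t : Tuple X) : Vec V := fun v => if h : v ∈ X then t ⟨v, h⟩ else 0

noncomputable instance (X : Finset V) : Enc (Tuple X) := ⟨encodeTuple⟩

theorem enc_tuple {X : Finset V} (t : Tuple X) : enc t =
    Val.ofList (((vars V).filter (· ∈ X)).map fun v => .atom (extend t v)) := by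
  show Val.ofList _ = Val.ofList _
  congr 1
  unfold vars
  induction (Finset.univ : Finset V).toList with
  | nil => rfl
  | cons v l ih =>
    by_cases hv : v ∈ X
    · simp [hv, ih, extend]
    · simp [hv, ih]

@[fun_prop] theorem Const.extend {X : Finset V} {f : α → Tuple X} (hf : Const f) :
    Const fun a => extend (f a) := by
  refine Const.comp (g := fun t : Tuple X => Panda.extend t) (Const.vec fun v => ?_) hf
  by_cases hv : v ∈ X
  · exact Const.get (l := (vars V).filter (· ∈ X)) (i := v) (by simp [hv])
      (G := fun t v => .atom (Panda.extend t v)) enc_tuple fun _ => rfl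
  · simpa only [Panda.extend, hv, dif_neg, not_false_eq_true] using Const.const 0

@[fun_prop] theorem Const.proj (X : Finset V) {f : α → Vec V} (hf : Const f) :
    Const fun a => (proj X (f a) : Tuple X) := by
  refine Const.comp (g := fun t : Vec V => (Panda.proj X t : Tuple X)) ?_ hf
  refine Computes.record (l := (vars V).filter (· ∈ X)) (G := fun t v => .atom (t v))
    (fun t => ?_) fun v _ =>
    Computes.of_enc (Const.coord v Const.id) 1 fun a _ => ⟨a, trivial, rfl, rfl, by simp⟩
  rw [enc_tuple]
  congr 1
  refine List.map_congr_left fun v hv => ?_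
  have : v ∈ X := by simpa using hv
  simp [Panda.extend, Panda.proj, this]

end vectors

/-! ### Merging sorted groups -/

section grouping
variable {V τ α : Type*} [Fintype V] [Enc τ] [Enc α]

@[fun_prop] theorem Const.tail {f : τ → List α} (hf : Const f) : Const fun a => (f a).tail := by
  have : Const (List.tail : List α → List α) := ⟨.snd, 1, fun l _ => ⟨1, by
    cases l <;> exact .snd _, le_rfl⟩⟩
  exact this.comp hf

@[fun_prop] theorem Const.headD_nil {f : τ → List (List α)} (hf : Const f) :
    Const fun a => (f a).headD [] := by
  have : Const (fun l : List (List α) => l.headD []) := ⟨.fst, 1, fun l _ => ⟨1, by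
    cases l <;> exact .fst _, le_rfl⟩⟩
  exact this.comp hf

/-- Finite collections of groups, each of them with a key. -/
abbrev Groups (V τ : Type*) : Type _ := List (Vec V × List τ)

/-- All elements of the groups. -/
def items (m : Groups V τ) : List τ := m.flatMap Prod.snd

/-- The number of elements and groups. -/
def weight (m : Groups V τ) : ℕ := (m.map fun e => e.2.length + 1).sum

/-- The groups are sorted by their keys, nonempty, and the elements of each have its key. -/
def IsGrouping (key : τ → Vec V) (m : Groups V τ) : Prop :=
  m.Pairwise (fun a b => code a.1 < code b.1) ∧ ∀ e ∈ m, e.2 ≠ [] ∧ ∀ x ∈ e.2, key x = e.1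

/-- Merge two sorted collections, uniting groups with the same key. -/
noncomputable def mergeGroups : Groups V τ → Groups V τ → Groups V τ
  | [], r => r
  | l, [] => l
  | a :: l, b :: r =>
    bif decide (code a.1 < code b.1) then a :: mergeGroups l (b :: r)
    else bif decide (code b.1 < code a.1) then b :: mergeGroups (a :: l) r
    else (a.1, a.2 ++ b.2) :: mergeGroups l r
  termination_by l r => l.length + r.length

omit [Enc τ] in
theorem mergeGroups_nil_left (r : Groups V τ) : mergeGroups [] r = r := by rw [mergeGroups]

omit [Enc τ] in
theorem mergeGroups_nil_right (l : Groups V τ) : mergeGroups l [] = l := by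
  cases l <;> rw [mergeGroups]; simp

omit [Enc τ] in
theorem mergeGroups_cons (a b : Vec V × List τ) (l r : Groups V τ) :
    mergeGroups (a :: l) (b :: r) =
    bif decide (code a.1 < code b.1) then a :: mergeGroups l (b :: r)
    else bif decide (code b.1 < code a.1) then b :: mergeGroups (a :: l) r
    else (a.1, a.2 ++ b.2) :: mergeGroups l r := by
  rw [mergeGroups]

omit [Enc τ] in
/-- Merging preserves the elements and produces no new keys, and does not increase the weight, which
serves as the potential in the time bounds. -/
theorem mergeGroups_spec (key : τ → Vec V) (l r : Groups V τ) :
    (items (mergeGroups l r)).Perm (items l ++ items r) ∧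
    weight (mergeGroups l r) ≤ weight l + weight r ∧
    (∀ e ∈ mergeGroups l r, (∃ e' ∈ l, e'.1 = e.1) ∨ ∃ e' ∈ r, e'.1 = e.1) ∧
    (IsGrouping key l → IsGrouping key r → IsGrouping key (mergeGroups l r)) := by
  generalize hn : l.length + r.length = n
  induction n using Nat.strong_induction_on generalizing l r with
  | _ n ih =>
    subst hn
    match l, r with
    | [], r =>
      rw [mergeGroups_nil_left]
      exact ⟨by simp [items], by simp, fun e he => .inr ⟨e, he, rfl⟩, fun _ h => h⟩
    | a :: l, [] =>
      rw [mergeGroups_nil_right]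
      exact ⟨by simp [items], by simp, fun e he => .inl ⟨e, he, rfl⟩, fun h _ => h⟩
    | a :: l, b :: r =>
      rw [mergeGroups_cons]
      rcases lt_trichotomy (code a.1) (code b.1) with h | h | h
      · obtain ⟨h1, h2, h3, h4⟩ := ih _ (by simp) l (b :: r) rfl
        simp only [h, decide_true, cond_true]
        refine ⟨?_, ?_, ?_, fun hl hr => ?_⟩
        · simp only [items, List.flatMap_cons, List.append_assoc] at h1 ⊢
          exact h1.append_left _
        · simp only [weight, List.map_cons, List.sum_cons] at h2 ⊢; omega
        · intro e he
          rcases List.mem_cons.1 he with rfl | he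
          · exact .inl ⟨e, by simp, rfl⟩
          · rcases h3 e he with ⟨e', he', h⟩ | h
            · exact .inl ⟨e', by simp [he'], h⟩
            · exact .inr h
        · obtain ⟨hp, hq⟩ := h4 ⟨(List.pairwise_cons.1 hl.1).2, fun e he => hl.2 e (by simp [he])⟩ hr
          refine ⟨List.pairwise_cons.2 ⟨fun e he => ?_, hp⟩, ?_⟩
          · rcases h3 e he with ⟨e', he', h'⟩ | ⟨e', he', h'⟩
            · exact h' ▸ (List.pairwise_cons.1 hl.1).1 e' he'
            · rcases List.mem_cons.1 he' with rfl | he'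
              · exact h' ▸ h
              · exact h' ▸ h.trans ((List.pairwise_cons.1 hr.1).1 e' he')
          · intro e he
            rcases List.mem_cons.1 he with rfl | he
            · exact hl.2 e (by simp)
            · exact hq e he
      · obtain ⟨h1, h2, h3, h4⟩ := ih _ (by simp; omega) l r rfl
        simp only [h, lt_irrefl, decide_false, cond_false]
        refine ⟨?_, ?_, ?_, fun hl hr => ?_⟩
        · simp only [items, List.flatMap_cons, List.append_assoc] at h1 ⊢
          refine List.Perm.append_left _ ?_
          refine (h1.append_left _).trans ?_
          rw [← List.append_assoc, ← List.append_assoc]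
          exact List.perm_append_comm.append_right _
        · simp only [weight, List.map_cons, List.sum_cons, List.length_append] at h2 ⊢; omega
        · intro e he
          rcases List.mem_cons.1 he with rfl | he
          · exact .inl ⟨a, by simp, rfl⟩
          · rcases h3 e he with ⟨e', he', h⟩ | ⟨e', he', h⟩
            · exact .inl ⟨e', by simp [he'], h⟩
            · exact .inr ⟨e', by simp [he'], h⟩
        · have hab : a.1 = b.1 := code_injective h
          obtain ⟨hp, hq⟩ := h4 ⟨(List.pairwise_cons.1 hl.1).2, fun e he => hl.2 e (by simp [he])⟩
            ⟨(List.pairwise_cons.1 hr.1).2, fun e he => hr.2 e (by simp [he])⟩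
          refine ⟨List.pairwise_cons.2 ⟨fun e he => ?_, hp⟩, ?_⟩
          · rcases h3 e he with ⟨e', he', h'⟩ | ⟨e', he', h'⟩
            · exact h' ▸ (List.pairwise_cons.1 hl.1).1 e' he'
            · exact h' ▸ hab ▸ (List.pairwise_cons.1 hr.1).1 e' he'
          · intro e he
            rcases List.mem_cons.1 he with rfl | he
            · refine ⟨by simp [(hl.2 a (by simp)).1], fun x hx => ?_⟩
              rcases List.mem_append.1 hx with hx | hx
              · exact (hl.2 a (by simp)).2 x hx
              · exact ((hr.2 b (by simp)).2 x hx).trans hab.symm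
            · exact hq e he
      · obtain ⟨h1, h2, h3, h4⟩ := ih _ (by simp) (a :: l) r rfl
        simp only [h, h.not_gt, decide_true, decide_false, cond_true, cond_false]
        refine ⟨?_, ?_, ?_, fun hl hr => ?_⟩
        · simp only [items, List.flatMap_cons, List.append_assoc] at h1 ⊢
          refine (h1.append_left _).trans ?_
          simp only [← List.append_assoc]
          refine List.Perm.append_right _ ?_
          rw [List.append_assoc]
          exact List.perm_append_comm
        · simp only [weight, List.map_cons, List.sum_cons] at h2 ⊢; omega
        · intro e he
          rcases List.mem_cons.1 he with rfl | he
          · exact .inr ⟨e, by simp, rfl⟩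
          · rcases h3 e he with h | ⟨e', he', h⟩
            · exact .inl h
            · exact .inr ⟨e', by simp [he'], h⟩
        · obtain ⟨hp, hq⟩ := h4 hl
            ⟨(List.pairwise_cons.1 hr.1).2, fun e he => hr.2 e (by simp [he])⟩
          refine ⟨List.pairwise_cons.2 ⟨fun e he => ?_, hp⟩, ?_⟩
          · rcases h3 e he with ⟨e', he', h'⟩ | ⟨e', he', h'⟩
            · rcases List.mem_cons.1 he' with rfl | he'
              · exact h' ▸ h
              · exact h' ▸ h.trans ((List.pairwise_cons.1 hl.1).1 e' he')
            · exact h' ▸ (List.pairwise_cons.1 hr.1).1 e' he'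
          · intro e he
            rcases List.mem_cons.1 he with rfl | he
            · exact hr.2 e (by simp)
            · exact hq e he

omit [Enc τ] [Fintype V] in
theorem length_le_weight (m : Groups V τ) : m.length ≤ weight m := by
  induction m with
  | nil => simp
  | cons e m ih => simp only [weight, List.map_cons, List.sum_cons, List.length_cons] at ih ⊢; omega

/-- The groups already merged, in reverse order, and two nonempty lists of groups, each given by its
head and tail; this has the same representation as a triple of lists. -/
abbrev MergeState (V τ : Type*) : Type _ :=
  Groups V τ × ((Vec V × List τ) × Groups V τ) × ((Vec V × List τ) × Groups V τ)

theorem Computes.mergeGroups : Computes (fun _ => True)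
    (fun x : Groups V τ × Groups V τ => mergeGroups x.1 x.2)
    (fun x => weight x.1 + weight x.2) := by
  -- one step of the loop, on the list of groups already produced and the two remaining lists
  let g : MergeState V τ → Groups V τ × Groups V τ × Groups V τ := fun x =>
    bif decide (code x.2.1.1.1 < code x.2.2.1.1) then
      (x.2.1.1 :: x.1, x.2.1.2, x.2.2.1 :: x.2.2.2)
    else bif decide (code x.2.2.1.1 < code x.2.1.1.1) then
      (x.2.2.1 :: x.1, x.2.1.1 :: x.2.1.2, x.2.2.2)
    else ((x.2.1.1.1, x.2.1.1.2 ++ x.2.2.1.2) :: x.1, x.2.1.2, x.2.2.2)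
  let Tg : MergeState V τ → ℕ := fun x =>
    bif decide (code x.2.1.1.1 < code x.2.2.1.1) then 0
    else bif decide (code x.2.2.1.1 < code x.2.1.1.1) then 0 else x.2.1.1.2.length
  have hg : Computes (fun _ => True) g Tg := by
    have e1 : Const fun x : MergeState V τ => (x.2.1.1.2, x.2.2.1.2) := by fun_prop
    have e2 : Const fun x : MergeState V τ => x.2.1.1.1 := by fun_prop
    have e3 : Const fun x : MergeState V τ => x.1 := by fun_prop
    have e4 : Const fun x : MergeState V τ => (x.2.1.2, x.2.2.2) := by fun_prop
    have h3 := ((e2.pair (append.comp e1 (fun _ _ => trivial))).cons e3).pair e4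
    have e5 : Const fun x : MergeState V τ => (x.2.2.1 :: x.1, x.2.1.1 :: x.2.1.2, x.2.2.2) := by fun_prop
    have e6 : Const fun x : MergeState V τ => decide (code x.2.2.1.1 < code x.2.1.1.1) := by fun_prop
    have h2 := Computes.branch (U := fun x : MergeState V τ =>
        bif decide (code x.2.2.1.1 < code x.2.1.1.1) then 0 else x.2.1.1.2.length) e6 e5 h3
      (fun a _ h => ⟨trivial, by simp⟩) (fun a _ h => ⟨trivial, by simp [h]⟩)
    have e7 : Const fun x : MergeState V τ => (x.2.1.1 :: x.1, x.2.1.2, x.2.2.1 :: x.2.2.2) := by fun_prop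
    have e8 : Const fun x : MergeState V τ => decide (code x.2.1.1.1 < code x.2.2.1.1) := by fun_prop
    exact Computes.branch e8 e7 h2 (fun a _ h => ⟨trivial, by simp⟩)
      (fun a _ h => ⟨trivial, by simp [Tg, h]⟩)
  let step : Groups V τ × Groups V τ × Groups V τ → Groups V τ × Groups V τ × Groups V τ := fun s =>
    match s with
    | (acc, a :: l, b :: r) => g (acc, (a, l), (b, r))
    | s => s
  let Ts : Groups V τ × Groups V τ × Groups V τ → ℕ := fun s =>
    match s with
    | (acc, a :: l, b :: r) => Tg (acc, (a, l), (b, r))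
    | _ => 0
  have hs : Computes (fun s : Groups V τ × Groups V τ × Groups V τ => ∃ acc a l b r,
      s = (acc, a :: l, b :: r)) step Ts := by
    refine hg.of_enc 1 ?_
    rintro _ ⟨acc, a, l, b, r, rfl⟩
    exact ⟨(acc, (a, l), (b, r)), trivial, rfl, rfl, by simp [Ts]⟩
  have hc : Const fun s : Groups V τ × Groups V τ × Groups V τ =>
      !s.2.1.isEmpty && !s.2.2.isEmpty := by fun_prop
  have hf : Computes (fun _ => True) (fun s : Groups V τ × Groups V τ × Groups V τ =>
      s.1.reverse ++ (s.2.1 ++ s.2.2)) (fun s => s.1.length + s.2.1.length) := by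
    have e1 : Const fun s : Groups V τ × Groups V τ × Groups V τ => s.1 := by fun_prop
    have e2 : Const fun s : Groups V τ × Groups V τ × Groups V τ => s.2 := by fun_prop
    exact (reverseAppend.comp (e1.pair (append.comp e2 (fun _ _ => trivial)))
      (fun _ _ => trivial)).weaken 1 fun s _ => ⟨trivial, by simp; omega⟩
  have hloop := loop (p := fun _ => True)
    (val := fun s : Groups V τ × Groups V τ × Groups V τ => s.1.reverse ++ Panda.mergeGroups s.2.1 s.2.2)
    (U := fun s => 3 * weight s.2.1 + 3 * weight s.2.2 + s.1.length) hc hs hf (by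
      rintro ⟨acc, l, r⟩ - h
      match l, r with
      | [], r => simp at h
      | a :: l, [] => simp at h
      | a :: l, b :: r =>
        refine ⟨⟨acc, a, l, b, r, rfl⟩, trivial, ?_⟩
        simp only [step, Ts, g, Tg, mergeGroups_cons]
        rcases lt_trichotomy (code a.1) (code b.1) with h | h | h
        · simp only [h, decide_true, cond_true, weight, List.map_cons, List.sum_cons,
            List.length_cons, List.reverse_cons, List.append_assoc, List.singleton_append, true_and]
          omega
        · simp only [h, lt_irrefl, decide_false, cond_false, weight, List.map_cons, List.sum_cons,
            List.length_cons, List.reverse_cons, List.append_assoc, List.singleton_append, true_and]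
          omega
        · simp only [h, h.not_gt, decide_true, decide_false, cond_true, cond_false, weight,
            List.map_cons, List.sum_cons, List.length_cons, List.reverse_cons, List.append_assoc,
            List.singleton_append, true_and]
          omega) (by
      rintro ⟨acc, l, r⟩ - h
      refine ⟨trivial, ?_, ?_⟩
      · match l, r with
        | [], r => simp [mergeGroups_nil_left]
        | a :: l, [] => simp [mergeGroups_nil_right]
        | a :: l, b :: r => simp at h
      · have := length_le_weight l
        simp only; omega)
  have e : Const fun x : Groups V τ × Groups V τ => (([] : Groups V τ), x) := by fun_prop
  exact (hloop.comp e (fun _ _ => trivial)).mono _ _ 3 fun x _ => ⟨trivial, by simp, by simp; omega⟩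

end grouping

/-! ### Sorting by a key -/

/-- Equality of vectors is only decided in specifications; programs compare vectors by `code`. -/
noncomputable instance {V : Type*} : DecidableEq (Vec V) := Classical.decEq _

section grouping
variable {V τ α : Type*} [Fintype V] [Enc τ] [Enc α]

/-- One pass of merge sort: merge the collections in pairs, on top of `acc`. -/
noncomputable def mergePass (acc : List (Groups V τ)) : List (Groups V τ) → List (Groups V τ)
  | a :: b :: l => mergePass (mergeGroups a b :: acc) l
  | l => l ++ acc

/-- The total weight of several collections. -/
def totalWeight (ls : List (Groups V τ)) : ℕ := (ls.map fun m => weight m + 1).sum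

omit [Enc τ] in
/-- A pass halves the number of collections, rounding up, and preserves all elements. -/
theorem mergePass_spec (key : τ → Vec V) : ∀ ls acc : List (Groups V τ),
    (mergePass acc ls).length = acc.length + (ls.length + 1) / 2 ∧
    totalWeight (mergePass acc ls) ≤ totalWeight acc + totalWeight ls ∧
    ((mergePass acc ls).flatMap items).Perm ((ls ++ acc).flatMap items) ∧
    ((∀ m ∈ ls ++ acc, IsGrouping key m) → ∀ m ∈ mergePass acc ls, IsGrouping key m)
  | [], acc => by simp [mergePass, totalWeight]
  | [a], acc => by
    refine ⟨by simp [mergePass, add_comm], by simp [mergePass, totalWeight]; omega,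
      by simp [mergePass], by simp [mergePass]⟩
  | a :: b :: l, acc => by
    obtain ⟨h1, h2, h3, h4⟩ := mergePass_spec key l (mergeGroups a b :: acc)
    obtain ⟨g1, g2, -, g4⟩ := mergeGroups_spec key a b
    refine ⟨?_, ?_, ?_, fun h => ?_⟩
    · rw [mergePass, h1]; simp only [List.length_cons]; omega
    · rw [mergePass]
      simp only [totalWeight, List.map_cons, List.sum_cons] at h2 ⊢; omega
    · rw [mergePass]
      refine h3.trans ?_
      simp only [List.flatMap_append, List.flatMap_cons, List.cons_append]
      refine ((g1.append_right _).append_left _).trans ?_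
      rw [← List.append_assoc]
      refine (List.perm_append_comm.append_right _).trans ?_
      simp
    · rw [mergePass]
      refine h4 fun m hm => ?_
      rcases List.mem_append.1 hm with hm | hm
      · exact h m (by simp [hm])
      · rcases List.mem_cons.1 hm with rfl | hm
        · exact g4 (h a (by simp)) (h b (by simp))
        · exact h m (by simp [hm])

theorem Computes.mergePass : Computes (fun _ => True)
    (fun x : List (Groups V τ) => mergePass [] x) totalWeight := by
  have hg : Computes (fun _ => True)
      (fun x : List (Groups V τ) × Groups V τ × Groups V τ × List (Groups V τ) =>
        (Panda.mergeGroups x.2.1 x.2.2.1 :: x.1, x.2.2.2))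
      (fun x => weight x.2.1 + weight x.2.2.1) := by
    have e1 : Const fun x : List (Groups V τ) × Groups V τ × Groups V τ × List (Groups V τ) =>
      (x.2.1, x.2.2.1) := by fun_prop
    have e2 : Const fun x : List (Groups V τ) × Groups V τ × Groups V τ × List (Groups V τ) =>
      x.1 := by fun_prop
    have e3 : Const fun x : List (Groups V τ) × Groups V τ × Groups V τ × List (Groups V τ) =>
      x.2.2.2 := by fun_prop
    exact (((mergeGroups.comp e1 (fun _ _ => trivial)).cons e2).pair e3).weaken 1
      fun x _ => ⟨trivial, by simp⟩
  let step : List (Groups V τ) × List (Groups V τ) → List (Groups V τ) × List (Groups V τ) :=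
    fun s => match s with
    | (acc, a :: b :: l) => (Panda.mergeGroups a b :: acc, l)
    | s => s
  let Ts : List (Groups V τ) × List (Groups V τ) → ℕ := fun s =>
    match s with
    | (_, a :: b :: _) => weight a + weight b
    | _ => 0
  have hs : Computes (fun s : List (Groups V τ) × List (Groups V τ) => ∃ acc a b l,
      s = (acc, a :: b :: l)) step Ts := by
    refine hg.of_enc 1 ?_
    rintro _ ⟨acc, a, b, l, rfl⟩
    exact ⟨(acc, a, b, l), trivial, rfl, rfl, by simp [Ts]⟩
  have hc : Const fun s : List (Groups V τ) × List (Groups V τ) => !s.2.tail.isEmpty := by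
    fun_prop
  have e2 : Const fun s : List (Groups V τ) × List (Groups V τ) => (s.2, s.1) := by fun_prop
  have hf := append.comp e2 (fun _ _ => trivial)
  have hloop := loop (p := fun _ => True)
    (val := fun s : List (Groups V τ) × List (Groups V τ) => Panda.mergePass s.1 s.2)
    (U := fun s => totalWeight s.2) hc hs hf (by
      rintro ⟨acc, l⟩ - h
      match l with
      | [] => simp at h
      | [a] => simp at h
      | a :: b :: l =>
        refine ⟨⟨acc, a, b, l, rfl⟩, trivial, ?_, ?_⟩
        · simp only [step]; rw [Panda.mergePass]
        · simp only [step, Ts, totalWeight, List.map_cons, List.sum_cons]; omega) (by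
      rintro ⟨acc, l⟩ - h
      match l with
      | [] => exact ⟨trivial, rfl, by simp⟩
      | [a] => exact ⟨trivial, rfl, by simp [totalWeight]⟩
      | a :: b :: l => simp at h)
  have e : Const fun x : List (Groups V τ) => (([] : List (Groups V τ)), x) := by fun_prop
  exact (hloop.comp e (fun _ _ => trivial)).weaken 1 fun x _ => ⟨trivial, by simp⟩

/-- Merge all collections into one. -/
noncomputable def mergeAll (ls : List (Groups V τ)) : Groups V τ :=
  if _h : ls.length ≤ 1 then ls.headD [] else mergeAll (mergePass [] ls)
  termination_by ls.length
  decreasing_by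
    rw [(mergePass_spec (fun _ _ => 0) ls []).1]
    simp only [List.length_nil]; omega

omit [Enc τ] in
theorem mergeAll_spec (key : τ → Vec V) (ls : List (Groups V τ)) :
    (items (mergeAll ls)).Perm (ls.flatMap items) ∧
    ((∀ m ∈ ls, IsGrouping key m) → IsGrouping key (mergeAll ls)) := by
  generalize hn : ls.length = n
  induction n using Nat.strong_induction_on generalizing ls with
  | _ n ih =>
    subst hn
    rw [mergeAll]
    split_ifs with h
    · match ls with
      | [] => exact ⟨by simp [items], fun _ => ⟨by simp, by simp⟩⟩
      | [a] => exact ⟨by simp, fun h => h a (by simp)⟩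
      | a :: b :: l => simp at h
    · obtain ⟨h1, -, h3, h4⟩ := mergePass_spec key ls []
      obtain ⟨g1, g2⟩ := ih _ (by rw [h1]; simp only [List.length_nil]; omega) (mergePass [] ls) rfl
      refine ⟨g1.trans (by simpa using h3), fun h => g2 (h4 (by simpa using h))⟩

/-- There are `clog n` passes, each of them linear in the total weight. -/
theorem Computes.mergeAll : Computes (fun _ => True) (fun x : List (Groups V τ) => mergeAll x)
    (fun x => (totalWeight x + 1) * Nat.clog 2 x.length) := by
  have hc : Const fun s : List (Groups V τ) => !s.tail.isEmpty := by fun_prop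
  have hf : Const fun s : List (Groups V τ) => s.headD [] := by fun_prop
  refine loop (p := fun _ => True) hc mergePass hf (fun s _ h => ?_) (fun s _ h => ?_)
  · have hlen : ¬ s.length ≤ 1 := by
      match s with
      | [] => simp at h
      | [a] => simp at h
      | a :: b :: l => simp
    obtain ⟨h1, h2, -, -⟩ := mergePass_spec (fun _ _ => 0) s []
    refine ⟨trivial, trivial, ?_, ?_⟩
    · conv_rhs => rw [Panda.mergeAll]
      rw [dif_neg hlen]
    · rw [h1, Nat.clog_of_two_le (by norm_num) (show 2 ≤ s.length by omega)]
      have h3 : totalWeight ([] : List (Groups V τ)) = 0 := rfl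
      simp only [List.length_nil, zero_add, h3] at h2 ⊢
      have h4 : (s.length + 2 - 1) / 2 = (s.length + 1) / 2 := by congr 1
      rw [h4]
      nlinarith [Nat.zero_le (Nat.clog 2 ((s.length + 1) / 2))]
  · refine ⟨trivial, ?_, by simp⟩
    rw [Panda.mergeAll, dif_pos]
    match s with
    | [] => simp
    | [a] => simp
    | a :: b :: l => simp at h

/-- Group the elements of a list by their keys. -/
noncomputable def groupBy (key : τ → Vec V) (R : List τ) : Groups V τ :=
  mergeAll (R.map fun x => [(key x, [x])])

omit [Enc τ] in
theorem groupBy_perm (key : τ → Vec V) (R : List τ) : (items (groupBy key R)).Perm R := by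
  refine (mergeAll_spec key _).1.trans ?_
  rw [List.flatMap_map]
  simp [items]

omit [Enc τ] in
theorem groupBy_isGrouping (key : τ → Vec V) (R : List τ) : IsGrouping key (groupBy key R) := by
  refine (mergeAll_spec key _).2 fun m hm => ?_
  obtain ⟨x, -, rfl⟩ := List.mem_map.1 hm
  exact ⟨by simp, by simp⟩

/-- The time to sort `n` elements. -/
def sortTime (n : ℕ) : ℕ := (n + 1) * (Nat.clog 2 n + 1)

theorem sortTime_mono {m n : ℕ} (h : m ≤ n) : sortTime m ≤ sortTime n :=
  Nat.mul_le_mul (by omega) (Nat.succ_le_succ (Nat.clog_mono_right 2 h))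

theorem le_sortTime (n : ℕ) : n + 1 ≤ sortTime n := Nat.le_mul_of_pos_right _ (by omega)

theorem Computes.groupBy {key : τ → Vec V} (hk : Const key) : Computes (fun _ => True)
    (fun R : List τ => groupBy key R) (fun R => sortTime R.length) := by
  have e1 : Const fun x : Bool × τ => [(key x.2, [x.2])] := by fun_prop
  have e2 : Const fun R : List τ => (false, R) := by fun_prop
  have h1 := (map_const (f := fun (_ : Bool) x => [(key x, [x])]) e1).comp e2 (fun _ _ => trivial)
  refine (mergeAll.comp h1 (fun _ _ => trivial)).mono _ _ 3 fun R _ => ⟨trivial, rfl, ?_⟩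
  have h2 : totalWeight (R.map fun x => [(key x, [x])]) = 3 * R.length := by
    simp [totalWeight, weight, Function.comp_def, mul_comm]
  simp only [zero_add, h2, List.length_map, sortTime]
  nlinarith [Nat.zero_le (Nat.clog 2 R.length)]

section spec
omit [Enc τ]
variable {key : τ → Vec V}

theorem mem_groupBy {R : List τ} {x : τ} (hx : x ∈ R) :
    ∃ e ∈ groupBy key R, x ∈ e.2 ∧ e.1 = key x := by
  have := (groupBy_perm key R).mem_iff.2 hx
  obtain ⟨e, he, hxe⟩ := List.mem_flatMap.1 this
  exact ⟨e, he, hxe, (((groupBy_isGrouping key R).2 e he).2 x hxe).symm⟩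

theorem mem_of_mem_groupBy {R : List τ} {x : τ} {e : Vec V × List τ} (he : e ∈ groupBy key R)
    (hx : x ∈ e.2) : x ∈ R ∧ key x = e.1 :=
  ⟨(groupBy_perm key R).mem_iff.1 (List.mem_flatMap.2 ⟨e, he, hx⟩),
    ((groupBy_isGrouping key R).2 e he).2 x hx⟩

theorem IsGrouping.keys_nodup {m : Groups V τ} (hm : IsGrouping key m) :
    (m.map Prod.fst).Nodup :=
  List.pairwise_map.2 (hm.1.imp fun h h' => h.ne (by rw [h']))

theorem IsGrouping.eq_of_key {m : Groups V τ} (hm : IsGrouping key m) {e e' : Vec V × List τ}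
    (he : e ∈ m) (he' : e' ∈ m) (h : e.1 = e'.1) : e = e' :=
  List.inj_on_of_nodup_map hm.keys_nodup he he' h

theorem IsGrouping.filter {m : Groups V τ} (hm : IsGrouping key m) (c : Vec V × List τ → Bool) :
    IsGrouping key (m.filter c) :=
  ⟨hm.1.filter _, fun e he => hm.2 e (List.mem_filter.1 he).1⟩

/-- If all groups have size at most `n`, then each key has degree at most `n`. -/
theorem IsGrouping.count_le {m : Groups V τ} (hm : IsGrouping key m) {n : ℕ}
    (hn : ∀ e ∈ m, e.2.length ≤ n) (k : Vec V) :
    ((items m).filter fun x => key x = k).length ≤ n := by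
  induction m with
  | nil => simp [items]
  | cons e m ih =>
    have hm' : IsGrouping key m := ⟨(List.pairwise_cons.1 hm.1).2, fun e he => hm.2 e (by simp [he])⟩
    simp only [items, List.flatMap_cons, List.filter_append, List.length_append]
    by_cases hk : e.1 = k
    · have h0 : (m.flatMap Prod.snd).filter (fun x => key x = k) = [] := by
        rw [List.filter_eq_nil_iff]
        intro x hx
        obtain ⟨e', he', hx'⟩ := List.mem_flatMap.1 hx
        have h1 := (List.pairwise_cons.1 hm.1).1 e' he'
        have h2 := (hm.2 e' (by simp [he'])).2 x hx'
        simp only [decide_eq_true_eq]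
        intro h3
        rw [hk, ← h3, h2] at h1
        exact lt_irrefl _ h1
      rw [h0]
      exact (Nat.add_le_add_right (List.length_filter_le _ _) _).trans (by simpa using hn e (by simp))
    · have h0 : e.2.filter (fun x => key x = k) = [] := by
        rw [List.filter_eq_nil_iff]
        intro x hx
        simp only [decide_eq_true_eq]
        rw [(hm.2 e (by simp)).2 x hx]
        exact hk
      rw [h0]
      simpa [items] using ih hm' fun e he => hn e (by simp [he])

end spec

end grouping

/-! ### Removal of duplicates, degrees and joins -/

section operations
variable {V τ : Type*} [Fintype V] [Enc τ]

omit [Enc τ] in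
theorem groupBy_length_le (key : τ → Vec V) (R : List τ) : (groupBy key R).length ≤ R.length := by
  rw [← (groupBy_perm key R).length_eq, items, List.length_flatMap]
  calc _ = ((Panda.groupBy key R).map fun _ => 1).sum := by simp
    _ ≤ _ := List.sum_le_sum fun e he =>
      List.length_pos_iff.2 ((groupBy_isGrouping key R).2 e he).1

/-- The distinct elements of a list of vectors. -/
noncomputable def distinct (R : List (Vec V)) : List (Vec V) := (groupBy (fun x => x) R).map Prod.fst

theorem Computes.distinct : Computes (fun _ => True) (fun R : List (Vec V) => distinct R)
    (fun R => sortTime R.length) := by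
  have h1 := groupBy (V := V) (τ := Vec V) (key := fun x => x) Const.id
  have e1 : Const fun x : Bool × (Vec V × List (Vec V)) => x.2.1 := by fun_prop
  have e2 : Const fun x : List (Vec V × List (Vec V)) => (false, x) := by fun_prop
  have h2 := ((map_const (f := fun (_ : Bool) (x : Vec V × List (Vec V)) => x.1) e1).comp e2
    (fun _ _ => trivial)).comp h1 (fun _ _ => trivial)
  refine h2.mono _ _ 2 fun R _ => ⟨trivial, rfl, ?_⟩
  have h3 := groupBy_length_le (fun x => x) R
  have h4 := le_sortTime R.length
  simp only [zero_add]
  omega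

theorem distinct_nodup (R : List (Vec V)) : (distinct R).Nodup :=
  (groupBy_isGrouping (fun x => x) R).keys_nodup

theorem mem_distinct {R : List (Vec V)} {x : Vec V} : x ∈ distinct R ↔ x ∈ R := by
  constructor
  · intro hx
    obtain ⟨e, he, rfl⟩ := List.mem_map.1 hx
    obtain ⟨y, hy⟩ := List.exists_mem_of_ne_nil _ ((groupBy_isGrouping (fun x => x) R).2 e he).1
    obtain ⟨h1, h2⟩ := mem_of_mem_groupBy he hy
    exact h2 ▸ h1
  · intro hx
    obtain ⟨e, he, -, h⟩ := mem_groupBy (key := fun x => x) hx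
    exact List.mem_map.2 ⟨e, he, h⟩

theorem distinct_length_le (R : List (Vec V)) : (distinct R).length ≤ R.length :=
  ((distinct_nodup R).subperm fun _ hx => mem_distinct.1 hx).length_le

/-- The groups of a list, each of them with its size. -/
noncomputable def sizedGroups (key : τ → Vec V) (R : List τ) : List (ℕ × (Vec V × List τ)) :=
  (groupBy key R).map fun e => (e.2.length, e)

omit [Enc τ] in
theorem groupBy_sum_length (key : τ → Vec V) (R : List τ) :
    ((groupBy key R).map fun e => e.2.length).sum = R.length := by
  rw [← (groupBy_perm key R).length_eq, items, List.length_flatMap]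

omit [Enc τ] in
theorem length_le_of_mem_groupBy {key : τ → Vec V} {R : List τ} {e : Vec V × List τ}
    (he : e ∈ groupBy key R) : e.2.length ≤ R.length := by
  rw [← groupBy_sum_length key R]
  exact List.single_le_sum (by simp) _ (List.mem_map.2 ⟨e, he, rfl⟩)

theorem size_le_clog (n : ℕ) : n.size ≤ Nat.clog 2 n + 1 := by
  rw [Nat.size_le]
  calc n ≤ 2 ^ Nat.clog 2 n := Nat.le_pow_clog (by norm_num) n
    _ < 2 ^ (Nat.clog 2 n + 1) := Nat.pow_lt_pow_right (by norm_num) (by omega)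

theorem Computes.sizedGroups {key : τ → Vec V} (hk : Const key) : Computes (fun _ => True)
    (fun R : List τ => sizedGroups key R) (fun R => sortTime R.length) := by
  have e1 : Const fun x : Bool × (Vec V × List τ) => x.2.2 := by fun_prop
  have e2 : Const fun x : Bool × (Vec V × List τ) => x.2 := by fun_prop
  have h1 := map (f := fun (_ : Bool) (e : Vec V × List τ) => (e.2.length, e))
    ((length.comp e1 (fun _ _ => trivial)).pair e2)
  have e3 : Const fun x : List (Vec V × List τ) => (false, x) := by fun_prop
  have h2 := (h1.comp (e3.computes (fun _ => True) 0) (fun _ _ _ _ => trivial)).comp (groupBy hk)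
    (fun _ _ => trivial)
  refine h2.mono _ _ 4 fun R _ => ⟨trivial, rfl, ?_⟩
  have h3 : ((Panda.groupBy key R).map fun e => e.2.length * e.2.length.size + 1).sum ≤
      R.length * R.length.size + R.length := by
    calc _ ≤ ((Panda.groupBy key R).map fun e => e.2.length * (R.length.size + 1)).sum :=
        List.sum_le_sum fun e he => by
          have h1 := List.length_pos_iff.2 ((groupBy_isGrouping key R).2 e he).1
          have h2 := Nat.size_le_size (length_le_of_mem_groupBy he)
          nlinarith
      _ = _ := by rw [List.sum_map_mul_right, groupBy_sum_length]; ring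
  have h4 : R.length * R.length.size ≤ R.length * (Nat.clog 2 R.length + 1) :=
    Nat.mul_le_mul_left _ (size_le_clog _)
  simp only [sortTime, Pi.zero_apply, zero_add, add_zero] at h3 ⊢
  nlinarith [Nat.zero_le (Nat.clog 2 R.length)]

/-- The maximum of a list of numbers. -/
def maxOf (l : List ℕ) : ℕ := l.foldl (fun b a => bif decide (b < a) then a else b) 0

theorem maxOf_spec (l : List ℕ) : (∀ a ∈ l, a ≤ maxOf l) ∧ (maxOf l = 0 ∨ maxOf l ∈ l) := by
  have key : ∀ (l : List ℕ) (b : ℕ),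
      b ≤ l.foldl (fun b a => bif decide (b < a) then a else b) b ∧
      (∀ a ∈ l, a ≤ l.foldl (fun b a => bif decide (b < a) then a else b) b) ∧
      (l.foldl (fun b a => bif decide (b < a) then a else b) b = b ∨
        l.foldl (fun b a => bif decide (b < a) then a else b) b ∈ l) := by
    intro l
    induction l with
    | nil => simp
    | cons a l ih =>
      intro b
      by_cases h : b < a
      · obtain ⟨h1, h2, h3⟩ := ih a
        simp only [List.foldl_cons, h, decide_true, cond_true, List.mem_cons]
        refine ⟨h.le.trans h1, ?_, ?_⟩
        · rintro x (rfl | hx)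
          exacts [h1, h2 x hx]
        · rcases h3 with h3 | h3
          exacts [.inr (.inl h3), .inr (.inr h3)]
      · obtain ⟨h1, h2, h3⟩ := ih b
        simp only [List.foldl_cons, h, decide_false, cond_false, List.mem_cons]
        refine ⟨h1, ?_, ?_⟩
        · rintro x (rfl | hx)
          exacts [(not_lt.1 h).trans h1, h2 x hx]
        · rcases h3 with h3 | h3
          exacts [.inl h3, .inr (.inr h3)]
  exact (key l 0).2

theorem Computes.maxOf : Computes (fun _ => True) (fun l : List ℕ => maxOf l) List.length := by
  have e1 : Const fun x : (Bool × ℕ) × ℕ => bif decide (x.1.2 < x.2) then x.2 else x.1.2 := by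
    fun_prop
  have e2 : Const fun l : List ℕ => ((false, 0), l) := by fun_prop
  exact ((foldl_const (f := fun (_ : Bool) b a => bif decide (b < a) then a else b) e1).comp e2
    (fun _ _ => trivial)).mono _ _ 1 fun l _ => ⟨trivial, rfl, by simp⟩

/-- The maximal size of a group. -/
noncomputable def maxDegree (key : τ → Vec V) (R : List τ) : ℕ :=
  maxOf ((sizedGroups key R).map Prod.fst)

theorem Computes.maxDegree {key : τ → Vec V} (hk : Const key) : Computes (fun _ => True)
    (fun R : List τ => maxDegree key R) (fun R => sortTime R.length) := by
  have e1 : Const fun x : Bool × (ℕ × (Vec V × List τ)) => x.2.1 := by fun_prop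
  have e2 : Const fun x : List (ℕ × (Vec V × List τ)) => (false, x) := by fun_prop
  have h2 := maxOf.comp (((map_const (f := fun (_ : Bool) (x : ℕ × (Vec V × List τ)) => x.1) e1).comp
    e2 (fun _ _ => trivial)).comp (sizedGroups hk) (fun _ _ => trivial)) (fun _ _ => trivial)
  refine h2.mono _ _ 3 fun R _ => ⟨trivial, rfl, ?_⟩
  have h1 := groupBy_length_le key R
  have := le_sortTime R.length
  simp only [zero_add, List.length_map, Panda.sizedGroups]
  omega

omit [Enc τ] in
theorem count_le_maxDegree (key : τ → Vec V) (R : List τ) (k : Vec V) :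
    (R.filter fun x => key x = k).length ≤ maxDegree key R := by
  rw [← ((groupBy_perm key R).filter _).length_eq]
  refine (groupBy_isGrouping key R).count_le (fun e he => (maxOf_spec _).1 _ ?_) k
  simp only [sizedGroups, List.map_map]
  exact List.mem_map.2 ⟨e, he, rfl⟩

omit [Enc τ] in
/-- The maximal degree is attained, by a list of distinct elements with a common key. -/
theorem maxDegree_eq (key : τ → Vec V) {R : List τ} (hR : R.Nodup) : maxDegree key R = 0 ∨
    ∃ (k : Vec V) (g : List τ), g.Nodup ∧ g.length = maxDegree key R ∧ ∀ x ∈ g, x ∈ R ∧ key x = k := by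
  refine (maxOf_spec ((sizedGroups key R).map Prod.fst)).2.imp_right fun h => ?_
  simp only [sizedGroups, List.map_map] at h
  obtain ⟨e, he, h⟩ := List.mem_map.1 h
  refine ⟨e.1, e.2, ?_, by simp only [maxDegree, sizedGroups, List.map_map]; exact h, fun x hx => mem_of_mem_groupBy he hx⟩
  have h1 := (groupBy_perm key R).nodup_iff.2 hR
  exact (List.nodup_flatMap.1 h1).1 e he

variable [DecidableEq V]

/-- The join of `R` and `G` on the attributes `K`; its elements agree with those of `R` on `Y`, and
with those of `G` elsewhere. The elements of both are tagged and grouped together by their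
restrictions to `K`. -/
noncomputable def joinOn (K Y : Finset V) (R G : List (Vec V)) : List (Vec V) :=
  (groupBy (fun x : Bool × Vec V => mask K x.2)
    (R.map (Prod.mk true) ++ G.map (Prod.mk false))).flatMap fun e =>
      (e.2.filter fun x => x.1).flatMap fun r =>
        (e.2.filter fun x => !x.1).map fun g => glue Y r.2 g.2

theorem mem_joinOn {K Y : Finset V} {R G : List (Vec V)} {r g : Vec V} (hr : r ∈ R) (hg : g ∈ G)
    (h : mask K r = mask K g) : glue Y r g ∈ joinOn K Y R G := by
  obtain ⟨e, he, hre, hk⟩ := mem_groupBy (key := fun x : Bool × Vec V => mask K x.2)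
    (R := R.map (Prod.mk true) ++ G.map (Prod.mk false)) (x := (true, r)) (by simp [hr])
  obtain ⟨e', he', hge, hk'⟩ := mem_groupBy (key := fun x : Bool × Vec V => mask K x.2)
    (R := R.map (Prod.mk true) ++ G.map (Prod.mk false)) (x := (false, g)) (by simp [hg])
  obtain rfl := (groupBy_isGrouping _ _).eq_of_key he he' (by rw [hk, hk', h])
  refine List.mem_flatMap.2 ⟨e, he, List.mem_flatMap.2 ⟨(true, r), by simp [hre], ?_⟩⟩
  exact List.mem_map.2 ⟨(false, g), by simp [hge], rfl⟩

/-- If the degrees of `G` with respect to `K` are at most `n`, then each element of `R` has at most `n`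
partners. -/
theorem joinOn_length_le {K Y : Finset V} {R G : List (Vec V)} {n : ℕ}
    (hn : ∀ k, (G.filter fun g => mask K g = k).length ≤ n) :
    (joinOn K Y R G).length ≤ R.length * n := by
  set L := R.map (Prod.mk true) ++ G.map (Prod.mk false) with hL
  set key := fun x : Bool × Vec V => mask K x.2 with hkey
  have hR : ((groupBy key L).map fun e => (e.2.filter fun x => x.1).length).sum = R.length := by
    have h1 := ((groupBy_perm key L).filter fun x => x.1).length_eq
    rw [items, List.filter_flatMap, List.length_flatMap] at h1
    rw [h1, hL]
    simp [List.filter_append, List.filter_map, Function.comp_def]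
  have hG : ∀ e ∈ groupBy key L, (e.2.filter fun x => !x.1).length ≤ n := by
    intro e he
    have h1 : (e.2.filter fun x => !x.1).Sublist
        ((items (groupBy key L)).filter fun x => !x.1 && decide (key x = e.1)) := by
      have h2 : (e.2.filter fun x => !x.1) = e.2.filter fun x => !x.1 && decide (key x = e.1) :=
        List.filter_congr fun x hx => by
          rw [((groupBy_isGrouping key L).2 e he).2 x hx]; simp
      rw [h2]
      refine List.Sublist.filter _ ?_
      rw [items, List.flatMap_def]
      exact List.sublist_flatten_of_mem (List.mem_map.2 ⟨e, he, rfl⟩)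
    refine h1.length_le.trans ?_
    rw [((groupBy_perm key L).filter _).length_eq, hL]
    simp only [List.filter_append, List.filter_map, List.length_append, List.length_map,
      Function.comp_def, Bool.not_true, Bool.false_and, List.filter_false, List.length_nil,
      Bool.not_false, Bool.true_and, zero_add]
    exact hn e.1
  rw [joinOn, List.length_flatMap, ← hR, ← List.sum_map_mul_right]
  refine List.sum_le_sum fun e he => ?_
  rw [List.length_flatMap]
  simp only [List.length_map, List.map_const', List.sum_replicate, smul_eq_mul]
  exact Nat.mul_le_mul_left _ (hG e he)

theorem Computes.joinOn (K Y : Finset V) : Computes (fun _ => True)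
    (fun x : List (Vec V) × List (Vec V) => joinOn K Y x.1 x.2)
    (fun x => sortTime (x.1.length + x.2.length) + (joinOn K Y x.1 x.2).length) := by
  -- the products of the two parts of each group
  have hprod : Computes (fun _ => True) (fun e : Vec V × List (Bool × Vec V) =>
      (e.2.filter fun x => x.1).flatMap fun r =>
        (e.2.filter fun x => !x.1).map fun g => glue Y r.2 g.2)
      (fun e => e.2.length + ((e.2.filter fun x => x.1).flatMap fun r =>
        (e.2.filter fun x => !x.1).map fun g => glue Y r.2 g.2).length) := by
    have e1 : Const fun x : (Bool × Vec V) × (Bool × Vec V) => glue Y x.1.2 x.2.2 := by fun_prop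
    have e2 : Const fun x : List (Bool × Vec V) × (Bool × Vec V) => (x.2, x.1) := by fun_prop
    have h1 := (map_const (f := fun r g : Bool × Vec V => glue Y r.2 g.2) e1).comp e2
      (fun _ _ => trivial)
    have h2 := flatMap (f := fun (G : List (Bool × Vec V)) (r : Bool × Vec V) =>
      G.map fun g => glue Y r.2 g.2) h1
    have e3 : Const fun x : Bool × (Bool × Vec V) => x.2.1 := by fun_prop
    have e4 : Const fun x : Bool × (Bool × Vec V) => !x.2.1 := by fun_prop
    have e5 : Const fun e : Vec V × List (Bool × Vec V) => (false, e.2) := by fun_prop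
    have h3 := (filter (c := fun (_ : Bool) (x : Bool × Vec V) => x.1) e3).comp e5
      (fun _ _ => trivial)
    have h4 := (filter (c := fun (_ : Bool) (x : Bool × Vec V) => !x.1) e4).comp e5
      (fun _ _ => trivial)
    refine (h2.comp (h4.pair h3) (fun _ _ _ _ => trivial)).mono _ _ 3 fun e _ =>
      ⟨trivial, rfl, ?_⟩
    have h5 := List.length_filter_le (fun x => x.1) e.2
    simp only [zero_add, List.length_map, List.map_const', List.sum_replicate, smul_eq_mul,
      List.length_flatMap]
    nlinarith
  have e1 : Const fun x : Bool × Vec V => (true, x.2) := by fun_prop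
  have e2 : Const fun x : Bool × Vec V => (false, x.2) := by fun_prop
  have e3 : Const fun x : List (Vec V) × List (Vec V) => (false, x.1) := by fun_prop
  have e4 : Const fun x : List (Vec V) × List (Vec V) => (false, x.2) := by fun_prop
  have h1 := append.comp (((map_const (f := fun (_ : Bool) (x : Vec V) => (true, x)) e1).comp e3
    (fun _ _ => trivial)).pair ((map_const (f := fun (_ : Bool) (x : Vec V) => (false, x)) e2).comp e4
    (fun _ _ => trivial))) (fun _ _ => trivial)
  have e5 : Const fun x : Bool × Vec V => mask K x.2 := by fun_prop
  have h2 := (groupBy e5).comp h1 (fun _ _ => trivial)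
  have e6 : Const fun x : Bool × (Vec V × List (Bool × Vec V)) => x.2 := by fun_prop
  have e7 : Const fun x : List (Vec V × List (Bool × Vec V)) => (false, x) := by fun_prop
  have h3 := (flatMap (f := fun (_ : Bool) (e : Vec V × List (Bool × Vec V)) =>
      (e.2.filter fun x => x.1).flatMap fun r =>
        (e.2.filter fun x => !x.1).map fun g => glue Y r.2 g.2)
      (hprod.comp e6 (fun _ _ => trivial))).comp (e7.computes (fun _ => True) 0)
        (fun _ _ _ _ => trivial)
  refine (h3.comp h2 (fun _ _ => trivial)).mono _ _ 8 fun x _ => ⟨trivial, rfl, ?_⟩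
  simp only [Pi.zero_apply, zero_add, List.length_map, List.length_append]
  set L := x.1.map (fun x => (true, x)) ++ x.2.map (fun x => (false, x)) with hL
  have hlen : L.length = x.1.length + x.2.length := by simp [hL]
  have h4 := groupBy_length_le (fun x : Bool × Vec V => mask K x.2) L
  have h5 := groupBy_sum_length (fun x : Bool × Vec V => mask K x.2) L
  have h6 := le_sortTime (x.1.length + x.2.length)
  have h7 : (Panda.joinOn K Y x.1 x.2).length =
    ((Panda.groupBy (fun x : Bool × Vec V => mask K x.2) L).map fun e =>
      ((e.2.filter fun x => x.1).flatMap fun r =>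
        (e.2.filter fun x => !x.1).map fun g => glue Y r.2 g.2).length).sum := by
    rw [Panda.joinOn, List.length_flatMap]
  have h8 : ((Panda.groupBy (fun x : Bool × Vec V => mask K x.2) L).map fun _ => 1).sum ≤
      L.length := by simpa using h4
  simp only [List.sum_map_add]
  omega

end operations

/-! ### Powers of two, integer roots and decompositions by degree -/

section numbers

theorem size_add_le (a b : ℕ) : (a + b).size ≤ max a.size b.size + 1 := by
  rw [Nat.size_le, pow_succ]
  have h1 := (Nat.lt_size_self a).trans_le (Nat.pow_le_pow_right two_pos (le_max_left a.size b.size))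
  have h2 := (Nat.lt_size_self b).trans_le (Nat.pow_le_pow_right two_pos (le_max_right a.size b.size))
  omega

theorem size_mul_le (a b : ℕ) : (a * b).size ≤ a.size + b.size := by
  rw [Nat.size_le, pow_add]
  exact Nat.mul_lt_mul'' (Nat.lt_size_self a) (Nat.lt_size_self b)

theorem size_pow_le (a q : ℕ) : (a ^ q).size ≤ q * a.size + 1 := by
  induction q with
  | zero => simp
  | succ q ih =>
    rw [pow_succ]
    have := size_mul_le (a ^ q) a
    linarith [add_mul q 1 a.size]

theorem Computes.pow (q : ℕ) : Computes (fun _ => True) (fun b : ℕ => b ^ q)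
    (fun b => (b.size + 1) ^ 2) := by
  induction q with
  | zero => simpa using (Const.const (α := ℕ) 1).computes _ _
  | succ q ih =>
    refine (mul_prim.comp (ih.pair (Const.id.computes _ 0)) (fun _ _ => trivial)).mono _ _ (q + 3)
      fun b _ => ⟨trivial, pow_succ b q, ?_⟩
    have := size_pow_le b q
    simp only [Pi.zero_apply, add_zero]
    nlinarith [Nat.mul_le_mul_right (b.size + 1) this]

/-- The numbers `p`, `2 * p`, `4 * p`, … up to `n`. The condition `0 < p` is there for termination. -/
def powersFrom (n p : ℕ) : List ℕ :=
  if _h : 0 < p ∧ p ≤ n then p :: powersFrom n (p + p) else []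
  termination_by n + 1 - p

theorem powersFrom_of_le {n p : ℕ} (h0 : 0 < p) (h : p ≤ n) :
    powersFrom n p = p :: powersFrom n (p + p) := by
  rw [powersFrom, dif_pos ⟨h0, h⟩]

theorem powersFrom_of_lt {n p : ℕ} (h : n < p) : powersFrom n p = [] := by
  rw [powersFrom, dif_neg (by omega)]

theorem powersFrom_induction {n : ℕ} {motive : ∀ p : ℕ, 0 < p → Prop}
    (h0 : ∀ p hp, n < p → motive p hp)
    (h1 : ∀ p hp, p ≤ n → motive (p + p) (Nat.add_pos_left hp p) → motive p hp)
    (p : ℕ) (hp : 0 < p) : motive p hp := by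
  generalize hk : n + 1 - p = k
  induction k using Nat.strong_induction_on generalizing p with
  | _ k ih =>
    rcases lt_or_ge n p with h | h
    · exact h0 p hp h
    · exact h1 p hp h (ih _ (by omega) (p + p) (by omega) rfl)

theorem mem_powersFrom {n p x : ℕ} (hp : 0 < p) (hx : x ∈ powersFrom n p) : 0 < x ∧ x ≤ n := by
  induction p, hp using powersFrom_induction (n := n) with
  | h0 p hp h => simp [powersFrom_of_lt h] at hx
  | h1 p hp h ih =>
    rw [powersFrom_of_le hp h] at hx
    rcases List.mem_cons.1 hx with rfl | hx
    exacts [⟨hp, h⟩, ih hx]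

/-- Each number is within a factor `2` of a power of two. -/
theorem exists_mem_powersFrom {n p a : ℕ} (hp : 0 < p) (hpa : p ≤ a) (han : a ≤ n) :
    ∃ x ∈ powersFrom n p, x ≤ a ∧ a < x + x := by
  induction p, hp using powersFrom_induction (n := n) with
  | h0 p hp h => omega
  | h1 p hp h ih =>
    rw [powersFrom_of_le hp h]
    rcases lt_or_ge a (p + p) with h1 | h1
    · exact ⟨p, by simp, hpa, h1⟩
    · obtain ⟨x, hx, h2⟩ := ih h1
      exact ⟨x, by simp [hx], h2⟩

theorem powersFrom_length_le (n : ℕ) : (powersFrom n 1).length ≤ n.size := by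
  have key : ∀ p, 0 < p → p * 2 ^ (powersFrom n p).length ≤ max p (2 * n) := by
    intro p hp
    induction p, hp using powersFrom_induction (n := n) with
    | h0 p hp h => simp [powersFrom_of_lt h]
    | h1 p hp h ih =>
      rw [powersFrom_of_le hp h, List.length_cons, pow_succ]
      have : max (p + p) (2 * n) ≤ max p (2 * n) := max_le (le_max_of_le_right (by omega)) (le_max_right _ _)
      calc p * (2 ^ (powersFrom n (p + p)).length * 2) = (p + p) * 2 ^ (powersFrom n (p + p)).length := by ring
        _ ≤ _ := ih.trans this
  rcases Nat.eq_zero_or_pos n with rfl | hn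
  · rw [powersFrom_of_lt (by norm_num)]; simp
  · have h1 := key 1 one_pos
    rw [one_mul, max_eq_right (by omega)] at h1
    have h2 := Nat.lt_size_self n
    have h3 : 2 ^ (powersFrom n 1).length < 2 ^ (n.size + 1) := by rw [pow_succ]; omega
    have := (Nat.pow_lt_pow_iff_right (by norm_num)).1 h3
    omega

theorem Computes.powersFrom : Computes (fun _ => True) (fun n : ℕ => powersFrom n 1)
    (fun n => n.size ^ 2) := by
  have hc : Const fun s : ℕ × ℕ × List ℕ => !decide (s.1 < s.2.1) := by fun_prop
  have e1 : Const fun s : ℕ × ℕ × List ℕ => (s.2.1, s.2.1) := by fun_prop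
  have e2 : Const fun s : ℕ × ℕ × List ℕ => s.2.1 :: s.2.2 := by fun_prop
  have e3 : Const fun s : ℕ × ℕ × List ℕ => s.1 := by fun_prop
  have hs := (e3.computes (fun _ => True) 0).pair ((add_prim.comp e1 (fun _ _ => trivial)).pair e2)
  have e4 : Const fun s : ℕ × ℕ × List ℕ => s.2.2 := by fun_prop
  have hf := reverse.comp e4 (fun _ _ => trivial)
  have hloop := loop (p := fun s => 0 < s.2.1)
    (val := fun s : ℕ × ℕ × List ℕ => s.2.2.reverse ++ Panda.powersFrom s.1 s.2.1)
    (U := fun s => s.2.2.length + (Panda.powersFrom s.1 s.2.1).length * (2 * s.1.size + 2))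
    (hc.computes _ 0) hs hf (by
      rintro ⟨n, p, acc⟩ hp h
      simp only [Bool.not_eq_true', decide_eq_false_iff_not, not_lt] at h
      simp only at hp
      refine ⟨trivial, by simp only; omega, ?_, ?_⟩
      · simp only [powersFrom_of_le hp h, List.reverse_cons, List.append_assoc,
          List.singleton_append]
      · simp only [powersFrom_of_le hp h, List.length_cons, Pi.zero_apply]
        have := Nat.size_le_size h
        nlinarith) (by
      rintro ⟨n, p, acc⟩ hp h
      simp only [Bool.not_eq_false', decide_eq_true_eq] at h
      exact ⟨trivial, by simp [powersFrom_of_lt h], by simp⟩)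
  have e5 : Const fun n : ℕ => (n, 1, ([] : List ℕ)) := by fun_prop
  refine (hloop.comp (e5.computes (fun _ => True) 0) (fun _ _ => one_pos)).mono _ _ 4
    fun n _ => ⟨trivial, by simp, ?_⟩
  have := powersFrom_length_le n
  simp only [Pi.zero_apply, List.length_nil]
  nlinarith

/-- The least power of two whose `q`-th power is at least `P`, for `q` and `P` positive. It is at most
`2 * P`, whence the range of the search. -/
def budget (q P : ℕ) : ℕ :=
  ((powersFrom (2 * P) 1).flatMap fun b => bif decide (b ^ q < P) then [] else [b]).headD 0

/-- The `q`-th power of the budget is at least `P`, and half of the budget fails this, unless the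
budget is `1`. -/
theorem budget_spec {q P : ℕ} (hq : 0 < q) (hP : 0 < P) :
    P ≤ budget q P ^ q ∧ (budget q P = 1 ∨ ∃ s, budget q P = s + s ∧ s ^ q < P) := by
  have key : ∀ p, 0 < p → p ≤ 2 * P →
      let r := ((powersFrom (2 * P) p).flatMap fun b =>
        bif decide (b ^ q < P) then [] else [b]).headD 0
      P ≤ r ^ q ∧ (r = p ∨ ∃ s, r = s + s ∧ s ^ q < P) := by
    intro p hp hpP
    induction p, hp using powersFrom_induction (n := 2 * P) with
    | h0 p hp h => omega
    | h1 p hp h ih =>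
      rw [powersFrom_of_le hp h, List.flatMap_cons]
      by_cases hlt : p ^ q < P
      · have hp2 : p + p ≤ 2 * P := by
          have := Nat.le_self_pow hq.ne' p
          omega
        simp only [hlt, decide_true, cond_true, List.nil_append]
        obtain ⟨h1, h2⟩ := ih hp2
        refine ⟨h1, .inr ?_⟩
        rcases h2 with h2 | h2
        · exact ⟨p, h2, hlt⟩
        · exact h2
      · simp [hlt, not_lt.1 hlt]
  exact key 1 one_pos (by omega)

@[fun_prop] theorem Const.headD_zero {α : Type*} [Enc α] {f : α → List ℕ} (hf : Const f) :
    Const fun a => (f a).headD 0 := by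
  have : Const (fun l : List ℕ => l.headD 0) := ⟨.fst, 1, fun l _ => ⟨1, by
    cases l <;> exact .fst _, le_rfl⟩⟩
  exact this.comp hf

theorem Computes.budget (q : ℕ) : Computes (fun _ => True) (fun P : ℕ => budget q P)
    (fun P => (P.size + 1) ^ 3) := by
  have e1 : Const fun x : ℕ × ℕ => x.2 := by fun_prop
  have e2 : Const fun x : ℕ × ℕ => x.1 := by fun_prop
  have e3 : Const fun x : (ℕ × ℕ) × ℕ => decide (x.1.1 < x.1.2) := by fun_prop
  have e4 : Const fun x : (ℕ × ℕ) × ℕ => bif decide (x.1.1 < x.1.2) then ([] : List ℕ) else [x.2] := by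
    fun_prop
  have h1 := Computes.comp e4 ((((pow q).comp e1 (fun _ _ => trivial)).pair e2).pair e1)
    (fun _ _ => trivial)
  have h2 := flatMap (f := fun P b : ℕ => bif decide (b ^ q < P) then ([] : List ℕ) else [b]) h1
  have e5 : Const fun P : ℕ => (P, P) := by fun_prop
  have h3 := powersFrom.comp (add_prim.comp e5 (fun _ _ => trivial)) (fun _ _ => trivial)
  have e6 : Const fun l : List ℕ => l.headD 0 := by fun_prop
  have h4 := Computes.comp e6 (h2.comp (Const.id.pair h3) (fun _ _ _ _ => trivial))
    (fun _ _ => trivial)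
  refine h4.mono _ _ 60 fun P _ => ⟨trivial, by rw [Panda.budget, two_mul], ?_⟩
  have hs : (P + P).size ≤ P.size + 1 := by simpa using size_add_le P P
  have h5 := powersFrom_length_le (P + P)
  have h6 : ((Panda.powersFrom (P + P) 1).map fun b => 0 + (b.size + 1) ^ 2 + 0 + 0 + 0 +
      (bif decide (b ^ q < P) then ([] : List ℕ) else [b]).length + 1).sum ≤
      ((Panda.powersFrom (P + P) 1).map fun _ => (P.size + 2) ^ 2 + 2).sum := by
    refine List.sum_le_sum fun b hb => ?_
    have h7 := Nat.size_le_size (mem_powersFrom one_pos hb).2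
    have h8 : (bif decide (b ^ q < P) then ([] : List ℕ) else [b]).length ≤ 1 := by
      cases decide (b ^ q < P) <;> simp
    have h9 : (b.size + 1) ^ 2 ≤ (P.size + 2) ^ 2 := Nat.pow_le_pow_left (by omega) 2
    omega
  simp only [List.map_const', List.sum_replicate, smul_eq_mul] at h6
  have h10 : (Panda.powersFrom (P + P) 1).length * ((P.size + 2) ^ 2 + 2) ≤
      (P.size + 1) * ((P.size + 2) ^ 2 + 2) := Nat.mul_le_mul_right _ (by omega)
  have h11 : (P + P).size ^ 2 ≤ (P.size + 1) ^ 2 := Nat.pow_le_pow_left hs 2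
  simp only [zero_add, add_zero] at h6 ⊢
  nlinarith [Nat.zero_le P.size]

end numbers

section buckets
variable {V : Type*} [Fintype V]

/-- The sized groups whose size is at least `p` and less than `2 * p`. -/
def bucket (s : List (ℕ × (Vec V × List (Vec V)))) (p : ℕ) : List (ℕ × (Vec V × List (Vec V))) :=
  s.filter fun e => !decide (e.1 < p) && decide (e.1 < p + p)

/-- The two relations into which a bucket is decomposed, with bounds on their degrees: the keys of
the groups, and the elements of the groups. The first bound is at least `1` even if the bucket is
empty, as is required of guards. -/
def split (s : List (ℕ × (Vec V × List (Vec V)))) (p : ℕ) :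
    (ℕ × List (Vec V)) × (ℕ × List (Vec V)) :=
  ((bif (bucket s p).isEmpty then 1 else (bucket s p).length, (bucket s p).map fun e => e.2.1),
    (p + p, (bucket s p).flatMap fun e => e.2.2))

theorem Computes.split : Computes (fun _ => True)
    (fun x : List (ℕ × (Vec V × List (Vec V))) × ℕ => split x.1 x.2)
    (fun x => x.1.length * (x.1.length.size + 1) + (x.1.map fun e => e.2.2.length).sum + x.2.size) := by
  have e1 : Const fun x : (ℕ × ℕ) × (ℕ × (Vec V × List (Vec V))) =>
    !decide (x.2.1 < x.1.1) && decide (x.2.1 < x.1.2) := by fun_prop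
  have e2 : Const fun x : List (ℕ × (Vec V × List (Vec V))) × ℕ => (x.2, x.2) := by fun_prop
  have e3 : Const fun x : List (ℕ × (Vec V × List (Vec V))) × ℕ => x.2 := by fun_prop
  have e4 : Const fun x : List (ℕ × (Vec V × List (Vec V))) × ℕ => x.1 := by fun_prop
  have h1 := (filter (c := fun (y : ℕ × ℕ) (e : ℕ × (Vec V × List (Vec V))) =>
    !decide (e.1 < y.1) && decide (e.1 < y.2)) e1).comp
    (((e3.computes (fun _ => True) 0).pair (add_prim.comp e2 (fun _ _ => trivial))).pair
      (e4.computes _ 0)) (fun _ _ => trivial)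
  have e5 : Const fun x : Bool × (ℕ × (Vec V × List (Vec V))) => x.2.2.1 := by fun_prop
  have e6 : Const fun x : Bool × (ℕ × (Vec V × List (Vec V))) => x.2.2.2 := by fun_prop
  have e7 : Const fun x : List (ℕ × (Vec V × List (Vec V))) => (false, x) := by fun_prop
  have h2 := (map_const (f := fun (_ : Bool) (e : ℕ × (Vec V × List (Vec V))) => e.2.1) e5).comp e7
    (fun _ _ => trivial)
  have h3 := (flatMap (f := fun (_ : Bool) (e : ℕ × (Vec V × List (Vec V))) => e.2.2) e6).comp
    (e7.computes (fun _ => True) 0) (fun _ _ _ _ => trivial)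
  have e8 : Const fun x : List (ℕ × (Vec V × List (Vec V))) => x.isEmpty := by fun_prop
  have h4 := branch (U := fun x : List (ℕ × (Vec V × List (Vec V))) => x.length * x.length.size)
    e8 (Const.const 1) length (fun _ _ _ => ⟨trivial, by simp⟩) (fun _ _ _ => ⟨trivial, by simp⟩)
  have h5 := (h4.pair h2).comp h1 (fun _ _ => trivial)
  have h6 := (add_prim.comp e2 (fun _ _ => trivial)).pair (h3.comp h1 (fun _ _ => trivial))
  refine (h5.pair h6).mono _ _ 8 fun x _ => ⟨trivial, rfl, ?_⟩
  set b := x.1.filter fun e => !decide (e.1 < x.2) && decide (e.1 < x.2 + x.2) with hb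
  have h7 : b.length ≤ x.1.length := List.length_filter_le _ _
  have h8 := Nat.size_le_size h7
  have h9 : (b.map fun e => e.2.2.length).sum ≤ (x.1.map fun e => e.2.2.length).sum :=
    List.Sublist.sum_le_sum (List.filter_sublist.map _) (fun _ _ => Nat.zero_le _)
  have h10 : b.length * b.length.size ≤ x.1.length * x.1.length.size := Nat.mul_le_mul h7 h8
  simp only [Pi.zero_apply, zero_add, add_zero, List.sum_map_add, List.map_const',
    List.sum_replicate, smul_eq_mul, mul_one, mul_add]
  omega

variable {key : Vec V → Vec V} {R : List (Vec V)} {p : ℕ}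

theorem bucket_eq : bucket (sizedGroups key R) p =
    ((groupBy key R).filter fun e => !decide (e.2.length < p) && decide (e.2.length < p + p)).map
      fun e => (e.2.length, e) := by
  rw [bucket, sizedGroups, List.filter_map]
  rfl

/-- Each key of the bucket accounts for at least `p` elements. -/
theorem split_keys_length : (split (sizedGroups key R) p).1.2.length * p ≤ R.length := by
  simp only [split, List.length_map, bucket_eq]
  rw [← groupBy_sum_length key R]
  refine le_trans ?_ (List.Sublist.sum_le_sum (List.filter_sublist (p := fun e =>
    !decide (e.2.length < p) && decide (e.2.length < p + p)).map _) (fun _ _ => Nat.zero_le _))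
  rw [← smul_eq_mul, ← List.sum_replicate, ← List.map_const']
  refine List.sum_le_sum fun e he => ?_
  have := (List.mem_filter.1 he).2
  simp only [Bool.and_eq_true, Bool.not_eq_true', decide_eq_false_iff_not, not_lt] at this
  exact this.1

theorem split_bound : (split (sizedGroups key R) p).1.1 = max 1 (split (sizedGroups key R) p).1.2.length := by
  simp only [split, List.length_map]
  generalize bucket (sizedGroups key R) p = b
  cases b with
  | nil => rfl
  | cons a l => simp

theorem split_elements_length : (split (sizedGroups key R) p).2.2.length ≤ R.length := by
  simp only [split, bucket_eq, List.flatMap_map, List.length_flatMap]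
  rw [← groupBy_sum_length key R]
  exact List.Sublist.sum_le_sum (List.filter_sublist.map _) (fun _ _ => Nat.zero_le _)

theorem split_elements_count (k : Vec V) :
    ((split (sizedGroups key R) p).2.2.filter fun x => key x = k).length ≤ p + p := by
  simp only [split, bucket_eq, List.flatMap_map]
  refine ((groupBy_isGrouping key R).filter _).count_le (fun e he => ?_) k
  have := (List.mem_filter.1 he).2
  simp only [Bool.and_eq_true, Bool.not_eq_true', decide_eq_false_iff_not, not_lt,
    decide_eq_true_eq] at this
  exact this.2.le

/-- Each element belongs to the bucket whose power of two is just below the size of its group. -/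
theorem exists_split {n : ℕ} (hn : R.length ≤ n) {x : Vec V} (hx : x ∈ R) :
    ∃ p ∈ powersFrom n 1, key x ∈ (split (sizedGroups key R) p).1.2 ∧
      x ∈ (split (sizedGroups key R) p).2.2 := by
  obtain ⟨e, he, hxe, hk⟩ := mem_groupBy (key := key) hx
  obtain ⟨p, hp, h1, h2⟩ := exists_mem_powersFrom (n := n) one_pos
    (List.length_pos_of_mem hxe) ((length_le_of_mem_groupBy he).trans hn)
  have : (e.2.length, e) ∈ bucket (sizedGroups key R) p := by
    rw [bucket_eq]
    exact List.mem_map.2 ⟨e, List.mem_filter.2 ⟨he, by simp [h1.not_gt, h2]⟩, rfl⟩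
  exact ⟨p, hp, List.mem_map.2 ⟨_, this, hk⟩, List.mem_flatMap.2 ⟨_, this, hxe⟩⟩

end buckets

/-! ### Identities of terms and the reset lemma -/

section identities
variable {V : Type*} [DecidableEq V]

/-- A conditional term `h(Y | X)`, together with the attributes `K ⊆ X` on which the relation that
guards it is keyed: that relation has the attributes `K ∪ Y`. -/
structure Slot (V : Type*) where
  X : Finset V
  Y : Finset V
  K : Finset V
  sub : K ⊆ X

namespace Slot

/-- `h(Y | X)` -/
def val (s : Slot V) (h : Finset V → ℝ) : ℝ := h (s.X ∪ s.Y) - h s.X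

/-- The unconditional term `h(Y)`. -/
def uncond (Y : Finset V) : Slot V := ⟨∅, Y, ∅, subset_rfl⟩

theorem val_uncond (Y : Finset V) (h : Finset V → ℝ) : (uncond Y).val h = h Y - h ∅ := by
  simp [val, uncond]

omit [DecidableEq V] in
theorem eq_uncond {s : Slot V} (h : s.X = ∅) : s = uncond s.Y := by
  obtain ⟨X, Y, K, sub⟩ := s
  subst h
  obtain rfl := Finset.subset_empty.1 sub
  rfl

end Slot

/-- Exchange of the two sides of a submodularity measure. -/
def Sub.swap (σ : Sub V) : Sub V := ⟨σ.Z, σ.Y, σ.X, σ.disjYZ.symm, σ.disjZX, σ.disjYX⟩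

theorem Sub.val_swap (σ : Sub V) (h : Finset V → ℝ) : σ.swap.val h = σ.val h := by
  simp only [Sub.val, Sub.swap, Finset.union_right_comm σ.X σ.Z σ.Y]
  ring

/-- The identity `∑ h(Z) + ∑ h(μ) + ∑ h(σ) = ∑ h(δ)` that certifies the Shannon inequality
`∑ h(Z) ≤ ∑ h(δ)`. -/
def Ident (Zs : Multiset (Finset V)) (Ds : Multiset (Slot V)) (Ms : Multiset (Mon V))
    (Ss : Multiset (Sub V)) : Prop :=
  ∀ h : Finset V → ℝ, (Zs.map fun Z => h Z - h ∅).sum + (Ms.map fun μ => μ.val h).sum +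
    (Ss.map fun σ => σ.val h).sum = (Ds.map fun δ => δ.val h).sum

variable {Zs : Multiset (Finset V)} {Ds : Multiset (Slot V)} {Ms : Multiset (Mon V)}
  {Ss : Multiset (Sub V)}

theorem multiset_sum_map_nonneg {ι : Type*} {s : Multiset ι} {f : ι → ℝ} (h : ∀ i ∈ s, 0 ≤ f i) :
    0 ≤ (s.map f).sum :=
  Multiset.sum_nonneg fun x hx => by
    obtain ⟨i, hi, rfl⟩ := Multiset.mem_map.1 hx
    exact h i hi

theorem multiset_sum_map_nonpos {ι : Type*} {s : Multiset ι} {f : ι → ℝ} (h : ∀ i ∈ s, f i ≤ 0) :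
    (s.map f).sum ≤ 0 := by
  have := multiset_sum_map_nonneg (s := s) (f := fun i => -f i) fun i hi => by
    have := h i hi; linarith
  rw [Multiset.sum_map_neg] at this
  linarith

/-- A nonzero unconditional term has to cancel against another term of the identity. -/
theorem Ident.partner {Y : Finset V} (hI : Ident Zs (Slot.uncond Y ::ₘ Ds) Ms Ss) (hY : Y ≠ ∅) :
    Y ∈ Zs ∨ (∃ δ ∈ Ds, δ.X = Y) ∨ (∃ μ ∈ Ms, μ.X ∪ μ.Y = Y) ∨
      ∃ σ ∈ Ss, σ.X ∪ σ.Y = Y ∨ σ.swap.X ∪ σ.swap.Y = Y := by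
  by_contra! hcon
  obtain ⟨h1, h2, h3, h4⟩ := hcon
  -- compare the coefficients of `h(Y)` on both sides
  have h := hI (Pi.single Y 1)
  rw [Multiset.map_cons, Multiset.sum_cons, Slot.val_uncond] at h
  have e1 : (Zs.map fun Z => (Pi.single Y 1 : Finset V → ℝ) Z - (Pi.single Y 1 : Finset V → ℝ) ∅).sum
      ≤ 0 := multiset_sum_map_nonpos fun Z hZ => by
    simp [hY.symm, ne_of_mem_of_not_mem hZ h1]
  have e2 : 0 ≤ (Ds.map fun δ => δ.val (Pi.single Y 1)).sum := multiset_sum_map_nonneg fun δ hδ => by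
    simp only [Slot.val, Pi.single_apply, h2 δ hδ, if_false, sub_zero]
    split_ifs <;> norm_num
  have e3 : (Ms.map fun μ => μ.val (Pi.single Y 1)).sum ≤ 0 := multiset_sum_map_nonpos fun μ hμ => by
    simp only [Mon.val, Pi.single_apply, h3 μ hμ, if_false]
    split_ifs <;> norm_num
  have e4 : (Ss.map fun σ => σ.val (Pi.single Y 1)).sum ≤ 0 := multiset_sum_map_nonpos fun σ hσ => by
    obtain ⟨h5, h6⟩ := h4 σ hσ
    simp only [Sub.swap] at h6
    simp only [Sub.val, Pi.single_apply, h5, h6, if_false]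
    split_ifs <;> norm_num
  simp only [Pi.single_eq_same, Pi.single_apply, hY.symm, if_false] at h e1
  linarith

/-- An identity with at least one target, and without an empty target, has a nonzero unconditional
term. -/
theorem Ident.exists_uncond (hI : Ident Zs Ds Ms Ss) (h0 : Zs ≠ 0) (hZ : ∅ ∉ Zs) :
    ∃ δ ∈ Ds, δ.X = ∅ ∧ δ.Y ≠ ∅ := by
  classical
  by_contra! hcon
  -- evaluate the identity at the polymatroid that is `1` on all nonempty sets
  have h := hI fun S => if S = ∅ then 0 else 1
  have e1 : (Zs.map fun Z => (if Z = ∅ then (0 : ℝ) else 1) - (if (∅ : Finset V) = ∅ then 0 else 1)) =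
      Zs.map fun _ => (1 : ℝ) := Multiset.map_congr rfl fun Z hZs => by
    simp [ne_of_mem_of_not_mem hZs hZ]
  have e2 : (Ds.map fun δ => δ.val fun S => if S = ∅ then (0 : ℝ) else 1).sum ≤ 0 :=
    multiset_sum_map_nonpos fun δ hδ => by
      simp only [Slot.val]
      by_cases hX : δ.X = ∅
      · simp [hX, hcon δ hδ hX]
      · simp [hX, Finset.union_eq_empty]
  have e3 : 0 ≤ (Ms.map fun μ => μ.val fun S => if S = ∅ then (0 : ℝ) else 1).sum :=
    multiset_sum_map_nonneg fun μ hμ => by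
      simp only [Mon.val, Finset.union_eq_empty]
      by_cases hX : μ.X = ∅ <;> by_cases hY : μ.Y = ∅ <;> simp [hX, hY]
  have e4 : 0 ≤ (Ss.map fun σ => σ.val fun S => if S = ∅ then (0 : ℝ) else 1).sum :=
    multiset_sum_map_nonneg fun σ hσ => by
      simp only [Sub.val, Finset.union_eq_empty]
      by_cases hX : σ.X = ∅ <;> by_cases hY : σ.Y = ∅ <;> by_cases hZ : σ.Z = ∅ <;>
        simp [hX, hY, hZ]
  rw [e1] at h
  have e5 : (0 : ℝ) < (Zs.map fun _ => (1 : ℝ)).sum := by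
    rw [Multiset.map_const', Multiset.sum_replicate, nsmul_eq_mul, mul_one]
    exact_mod_cast Multiset.card_pos.2 h0
  linarith

theorem Ident.empty (hI : Ident Zs (Slot.uncond ∅ ::ₘ Ds) Ms Ss) : Ident Zs Ds Ms Ss := fun h => by
  have := hI h
  rw [Multiset.map_cons, Multiset.sum_cons, Slot.val_uncond, sub_self, zero_add] at this
  exact this

theorem Ident.target {Y : Finset V} (hI : Ident (Y ::ₘ Zs) (Slot.uncond Y ::ₘ Ds) Ms Ss) :
    Ident Zs Ds Ms Ss := fun h => by
  have := hI h
  simp only [Multiset.map_cons, Multiset.sum_cons, Slot.val_uncond] at this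
  linarith

/-- `h(Y) + h(W | Y) = h(Y ∪ W)` -/
theorem Ident.compose {δ : Slot V} (hI : Ident Zs (Slot.uncond δ.X ::ₘ δ ::ₘ Ds) Ms Ss) :
    Ident Zs (Slot.uncond (δ.X ∪ δ.Y) ::ₘ Ds) Ms Ss := fun h => by
  have := hI h
  have e : δ.val h = h (δ.X ∪ δ.Y) - h δ.X := rfl
  simp only [Multiset.map_cons, Multiset.sum_cons, Slot.val_uncond] at this ⊢
  linarith

/-- `h(X ∪ W) - h(W | X) = h(X)` -/
theorem Ident.project {μ : Mon V} (hI : Ident Zs (Slot.uncond (μ.X ∪ μ.Y) ::ₘ Ds) (μ ::ₘ Ms) Ss) :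
    Ident Zs (Slot.uncond μ.X ::ₘ Ds) Ms Ss := fun h => by
  have := hI h
  simp only [Multiset.map_cons, Multiset.sum_cons, Slot.val_uncond, Mon.val] at this ⊢
  linarith

/-- The term `h(Y | X ∪ Z)`, guarded by a relation with the attributes `X ∪ Y`. -/
def Sub.slot (σ : Sub V) : Slot V := ⟨σ.X ∪ σ.Z, σ.Y, σ.X, Finset.subset_union_left⟩

/-- `h(X ∪ Y) - h(Y ; Z | X) = h(X) + h(Y | X ∪ Z)` -/
theorem Ident.decompose {σ : Sub V}
    (hI : Ident Zs (Slot.uncond (σ.X ∪ σ.Y) ::ₘ Ds) Ms (σ ::ₘ Ss)) :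
    Ident Zs (Slot.uncond σ.X ::ₘ σ.slot ::ₘ Ds) Ms Ss := fun h => by
  have := hI h
  have e : σ.slot.val h = h (σ.X ∪ σ.Y ∪ σ.Z) - h (σ.X ∪ σ.Z) := by
    rw [Finset.union_right_comm]; rfl
  have e' : σ.val h = h (σ.X ∪ σ.Y) + h (σ.X ∪ σ.Z) - h σ.X - h (σ.X ∪ σ.Y ∪ σ.Z) := rfl
  simp only [Multiset.map_cons, Multiset.sum_cons, Slot.val_uncond] at this ⊢
  linarith

/-- `h(X ∪ Y) - h(Y ; Z | X) = h(X ∪ Y ∪ Z) - h(Z | X)` -/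
theorem Ident.expand {σ : Sub V}
    (hI : Ident Zs (Slot.uncond (σ.X ∪ σ.Y) ::ₘ Ds) Ms (σ ::ₘ Ss)) :
    Ident Zs (Slot.uncond (σ.X ∪ σ.Y ∪ σ.Z) ::ₘ Ds) (⟨σ.Z, σ.X, σ.disjZX⟩ ::ₘ Ms) Ss := fun h => by
  have := hI h
  simp only [Multiset.map_cons, Multiset.sum_cons, Slot.val_uncond, Sub.val, Mon.val] at this ⊢
  linarith

theorem Ident.swap {σ : Sub V} (hI : Ident Zs Ds Ms (σ ::ₘ Ss)) : Ident Zs Ds Ms (σ.swap ::ₘ Ss) :=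
  fun h => by
    have := hI h
    simp only [Multiset.map_cons, Multiset.sum_cons, Sub.val_swap] at this ⊢
    linarith

/-- The reset lemma: an unconditional term can be dropped at the price of one target. The term is
followed through its partners until it cancels against a target or becomes `h(∅)`. Since a
submodularity measure is turned into a monotonicity measure on the way, it counts twice. -/
theorem Ident.reset : ∀ (n : ℕ) {Y : Finset V} {Zs : Multiset (Finset V)} {Ds : Multiset (Slot V)}
    {Ms : Multiset (Mon V)} {Ss : Multiset (Sub V)},
    Ident Zs (Slot.uncond Y ::ₘ Ds) Ms Ss →
    Multiset.card Ds + Multiset.card Ms + 2 * Multiset.card Ss ≤ n →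
    ∃ Zs' Ds' Ms' Ss', Ident Zs' Ds' Ms' Ss' ∧ Zs' ≤ Zs ∧
      Multiset.card Zs ≤ Multiset.card Zs' + 1 ∧ Ds' ≤ Ds ∧
      Multiset.card Ds' + Multiset.card Ms' + 2 * Multiset.card Ss' ≤ n ∧
      Multiset.card Ss' ≤ Multiset.card Ss := by
  intro n
  induction n with
  | zero =>
    intro Y Zs Ds Ms Ss hI hn
    obtain rfl : Ds = 0 := Multiset.card_eq_zero.1 (by omega)
    obtain rfl : Ms = 0 := Multiset.card_eq_zero.1 (by omega)
    obtain rfl : Ss = 0 := Multiset.card_eq_zero.1 (by omega)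
    by_cases hY : Y = ∅
    · subst hY
      exact ⟨Zs, 0, 0, 0, hI.empty, le_rfl, by omega, le_rfl, by simp, le_rfl⟩
    · rcases hI.partner hY with h | ⟨_, h, -⟩ | ⟨_, h, -⟩ | ⟨_, h, -⟩
      · obtain ⟨Zs, rfl⟩ := Multiset.exists_cons_of_mem h
        exact ⟨Zs, 0, 0, 0, hI.target, Multiset.le_cons_self _ _, by simp, le_rfl, by simp, le_rfl⟩
      all_goals simp at h
  | succ n ih =>
    intro Y Zs Ds Ms Ss hI hn
    by_cases hY : Y = ∅
    · subst hY
      exact ⟨Zs, Ds, Ms, Ss, hI.empty, le_rfl, by omega, le_rfl, hn, le_rfl⟩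
    rcases hI.partner hY with h | ⟨δ, h, rfl⟩ | ⟨μ, h, rfl⟩ | ⟨σ, h, hσ⟩
    · obtain ⟨Zs, rfl⟩ := Multiset.exists_cons_of_mem h
      exact ⟨Zs, Ds, Ms, Ss, hI.target, Multiset.le_cons_self _ _, by simp, le_rfl, hn, le_rfl⟩
    · obtain ⟨Ds, rfl⟩ := Multiset.exists_cons_of_mem h
      rw [Multiset.card_cons] at hn
      obtain ⟨Zs', Ds', Ms', Ss', h1, h2, h3, h4, h5, h6⟩ := ih hI.compose (by omega)
      exact ⟨Zs', Ds', Ms', Ss', h1, h2, h3, h4.trans (Multiset.le_cons_self _ _), by omega, h6⟩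
    · obtain ⟨Ms, rfl⟩ := Multiset.exists_cons_of_mem h
      rw [Multiset.card_cons] at hn
      obtain ⟨Zs', Ds', Ms', Ss', h1, h2, h3, h4, h5, h6⟩ := ih hI.project (by omega)
      exact ⟨Zs', Ds', Ms', Ss', h1, h2, h3, h4, by omega, h6⟩
    · obtain ⟨Ss, rfl⟩ := Multiset.exists_cons_of_mem h
      obtain ⟨τ, hτ, hI⟩ : ∃ τ : Sub V, τ.X ∪ τ.Y = Y ∧ Ident Zs (Slot.uncond Y ::ₘ Ds) Ms (τ ::ₘ Ss) := by
        rcases hσ with h | h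
        exacts [⟨σ, h, hI⟩, ⟨σ.swap, h, hI.swap⟩]
      subst hτ
      rw [Multiset.card_cons] at hn ⊢
      obtain ⟨Zs', Ds', Ms', Ss', h1, h2, h3, h4, h5, h6⟩ := ih hI.expand (by
        rw [Multiset.card_cons]; omega)
      exact ⟨Zs', Ds', Ms', Ss', h1, h2, h3, h4, by omega, by omega⟩

end identities

/-! ### Solvable rules -/

section solvable
variable {V : Type*} [Fintype V] [DecidableEq V]

/-- The guards of the terms of an identity: a degree bound and a relation for each of them. -/
abbrev Env (V : Type*) : Type _ := List (ℕ × List (Vec V))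

/-- The relation of `g` guards the slot `s`: its degrees are at most the bound of `g`. -/
def Guards (s : Slot V) (g : ℕ × List (Vec V)) : Prop :=
  1 ≤ g.1 ∧ ∀ k, (g.2.filter fun x => mask s.K x = k).length ≤ g.1

/-- The vector `t` is consistent with the guards: its restrictions belong to their relations. -/
def Fits (Ds : List (Slot V)) (env : Env V) (t : Vec V) : Prop :=
  List.Forall₂ (fun s g => mask (s.K ∪ s.Y) t ∈ g.2) Ds env

/-- The guards are valid, and the product of their bounds is within the budget `x.1 ^ z`, with
a reserve of a factor `2` for each of `s` decompositions. -/
def Valid (Ds : List (Slot V)) (z s : ℕ) (x : ℕ × Env V) : Prop :=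
  List.Forall₂ Guards Ds x.2 ∧ 1 ≤ x.1 ∧ (x.2.map Prod.fst).prod * 2 ^ s ≤ x.1 ^ z

/-- The budget plus the size of the relations. -/
def volume (x : ℕ × Env V) : ℕ := x.1 + (x.2.map fun g => g.2.length).sum

/-- The volume plus the bounds of the guards. -/
def total (x : ℕ × Env V) : ℕ := volume x + (x.2.map Prod.fst).sum

/-- A logarithmic bound for the bit length of all numbers. -/
def lg (x : ℕ × Env V) : ℕ := (total x).size + 1

/-- The inputs with the property `p` are solved by a program: in quasi-linear time it finds a list
of tagged tuples, of length at most the budget up to logarithmic factors, which contains one of the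
projections to the sets in `So` of each vector that is consistent with the guards. The tag `idx Z`
says to which output relation a tuple belongs. -/
def SolvableOn (idx : Finset V → ℕ) (So : Schema V) (Ds : List (Slot V)) (p : ℕ × Env V → Prop) :
    Prop :=
  ∃ (f : ℕ × Env V → List (ℕ × Vec V)) (k c : ℕ), Computes p f (fun x => volume x * lg x ^ k) ∧
    ∀ x, p x → (f x).length ≤ c * (x.1 * lg x ^ k) ∧
      ∀ t, Fits Ds x.2 t → ∃ Z ∈ So, (idx Z, mask Z t) ∈ f x

variable {idx : Finset V → ℕ} {So : Schema V} {Ds Ds' : List (Slot V)} {p p' : ℕ × Env V → Prop}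

omit [Fintype V] [DecidableEq V] in
theorem lg_pos (x : ℕ × Env V) : 1 ≤ lg x := Nat.succ_le_succ (Nat.zero_le _)

omit [Fintype V] [DecidableEq V] in
theorem lg_le {x y : ℕ × Env V} (h : total y ≤ 4 * total x) : lg y ≤ 3 * lg x := by
  have h1 := Nat.size_le_size h
  have h2 := size_mul_le 4 (total x)
  have h3 : (4 : ℕ).size = 3 := rfl
  rw [h3] at h2
  have h4 : (4 * total x).size ≤ (total x).size + 2 := by
    rw [Nat.size_le, pow_add]
    have := Nat.lt_size_self (total x)
    omega
  simp only [lg]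
  omega

omit [Fintype V] [DecidableEq V] in
theorem lg_pow_le {x y : ℕ × Env V} (h : total y ≤ 4 * total x) (k : ℕ) :
    lg y ^ k ≤ 3 ^ k * lg x ^ k := by
  rw [← mul_pow]
  exact Nat.pow_le_pow_left (lg_le h) k

omit [Fintype V] [DecidableEq V] in
theorem lg_pow_mono (x : ℕ × Env V) {j k : ℕ} (h : j ≤ k) : lg x ^ j ≤ lg x ^ k :=
  Nat.pow_le_pow_right (lg_pos x) h

/-- A reduction `g` that preserves the budget and enlarges the volume by a constant factor only. -/
theorem SolvableOn.pullback (h : SolvableOn idx So Ds' p') (g : ℕ × Env V → ℕ × Env V) (j : ℕ)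
    (hg : Computes p g fun x => volume x * lg x ^ j)
    (hgp : ∀ x, p x → p' (g x) ∧ (g x).1 = x.1 ∧ volume (g x) ≤ 4 * volume x ∧
      total (g x) ≤ 4 * total x ∧ ∀ t, Fits Ds x.2 t → Fits Ds' (g x).2 t) :
    SolvableOn idx So Ds p := by
  obtain ⟨f, k, c, hf, hfc⟩ := h
  refine ⟨fun x => f (g x), j + k, c * 3 ^ k, ?_, fun x hx => ?_⟩
  · refine (hf.comp hg fun x hx => (hgp x hx).1).weaken (1 + 4 * 3 ^ k) fun x hx => ⟨hx, ?_⟩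
    obtain ⟨-, -, h1, h2, -⟩ := hgp x hx
    have h3 : volume (g x) * lg (g x) ^ k ≤ 4 * volume x * (3 ^ k * lg x ^ (j + k)) :=
      Nat.mul_le_mul h1 ((lg_pow_le h2 k).trans (Nat.mul_le_mul_left _ (lg_pow_mono x (by omega))))
    have h4 : volume x * lg x ^ j ≤ volume x * lg x ^ (j + k) :=
      Nat.mul_le_mul_left _ (lg_pow_mono x (by omega))
    calc _ ≤ volume x * lg x ^ (j + k) + 4 * volume x * (3 ^ k * lg x ^ (j + k)) := by omega
      _ = (1 + 4 * 3 ^ k) * (volume x * lg x ^ (j + k)) := by ring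
      _ ≤ _ := Nat.mul_le_mul_left _ (by omega)
  · obtain ⟨h0, h1, -, h2, h3⟩ := hgp x hx
    obtain ⟨h4, h5⟩ := hfc _ h0
    refine ⟨h4.trans ?_, fun t ht => h5 t (h3 t ht)⟩
    rw [h1, mul_assoc]
    refine Nat.mul_le_mul_left _ ?_
    calc x.1 * lg (g x) ^ k ≤ x.1 * (3 ^ k * lg x ^ (j + k)) := Nat.mul_le_mul_left _
          ((lg_pow_le h2 k).trans (Nat.mul_le_mul_left _ (lg_pow_mono x (by omega))))
      _ = _ := by ring

/-- A case distinction by a test that runs in quasi-linear time. -/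
theorem SolvableOn.branch {p₁ p₂ : ℕ × Env V → Prop} (h1 : SolvableOn idx So Ds p₁)
    (h2 : SolvableOn idx So Ds p₂) (b : ℕ × Env V → Bool) (j : ℕ)
    (hb : Computes p b fun x => volume x * lg x ^ j)
    (hp1 : ∀ x, p x → b x = true → p₁ x) (hp2 : ∀ x, p x → b x = false → p₂ x) :
    SolvableOn idx So Ds p := by
  obtain ⟨f₁, k₁, c₁, hf₁, h1⟩ := h1
  obtain ⟨f₂, k₂, c₂, hf₂, h2⟩ := h2
  refine ⟨fun x => bif b x then f₁ x else f₂ x, j + k₁ + k₂, c₁ + c₂, ?_, fun x hx => ?_⟩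
  · refine (Computes.branch (U := fun x => volume x * lg x ^ (j + k₁ + k₂) +
      volume x * lg x ^ (j + k₁ + k₂)) hb hf₁ hf₂ (fun x hx hbx => ⟨hp1 x hx hbx, ?_⟩)
      (fun x hx hbx => ⟨hp2 x hx hbx, ?_⟩)).weaken 2 fun x hx => ⟨hx, by omega⟩
    · exact Nat.add_le_add (Nat.mul_le_mul_left _ (lg_pow_mono x (by omega)))
        (Nat.mul_le_mul_left _ (lg_pow_mono x (by omega)))
    · exact Nat.add_le_add (Nat.mul_le_mul_left _ (lg_pow_mono x (by omega)))
        (Nat.mul_le_mul_left _ (lg_pow_mono x (by omega)))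
  · cases hbx : b x
    · obtain ⟨h3, h4⟩ := h2 x (hp2 x hx hbx)
      simp only [hbx, cond_false]
      exact ⟨h3.trans (Nat.mul_le_mul (Nat.le_add_left c₂ c₁)
        (Nat.mul_le_mul_left _ (lg_pow_mono x (Nat.le_add_left _ _)))), h4⟩
    · obtain ⟨h3, h4⟩ := h1 x (hp1 x hx hbx)
      simp only [hbx, cond_true]
      exact ⟨h3.trans (Nat.mul_le_mul (Nat.le_add_right c₁ c₂)
        (Nat.mul_le_mul_left _ (lg_pow_mono x (by omega)))), h4⟩

theorem SolvableOn.of_false (h : ∀ x, ¬ p x) : SolvableOn idx So Ds p :=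
  ⟨fun _ => [], 0, 0, (Const.const []).computes _ _, fun x hx => (h x hx).elim⟩

/-- A fixed permutation of the guards can be carried out in constant time. -/
theorem exists_perm_select {Ds Ds' : List (Slot V)} (h : Ds.Perm Ds') :
    ∃ g : Env V → Env V, Computes (fun env => env.length = Ds.length) g (fun _ => 0) ∧
      ∀ env, env.length = Ds.length → (g env).Perm env ∧
        ∀ R : Slot V → ℕ × List (Vec V) → Prop, List.Forall₂ R Ds env → List.Forall₂ R Ds' (g env) := by
  induction h with
  | nil => exact ⟨fun env => env, Const.id.computes _ _, fun env h => ⟨.refl _, fun R h => h⟩⟩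
  | @cons s Ds Ds' h ih =>
    obtain ⟨g, hg, hg'⟩ := ih
    refine ⟨fun env => match env with
      | [] => []
      | a :: env => a :: g env, ?_, fun env h => ?_⟩
    · have e1 : Const fun x : (ℕ × List (Vec V)) × Env V => x.1 := by fun_prop
      have e2 : Const fun x : (ℕ × List (Vec V)) × Env V => x.2 := by fun_prop
      refine ((e1.computes _ 0).cons (hg.comp (e2.computes (fun x => x.2.length = Ds.length) 0)
        fun _ h => h)).of_enc 1 fun env h => ?_
      match env with
      | [] => simp at h
      | a :: env => exact ⟨(a, env), by simpa using h, rfl, rfl, by simp⟩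
    · match env with
      | [] => simp at h
      | a :: env =>
        obtain ⟨h1, h2⟩ := hg' env (by simpa using h)
        refine ⟨h1.cons a, fun R hR => ?_⟩
        obtain ⟨h3, h4⟩ := List.forall₂_cons.1 hR
        exact .cons h3 (h2 R h4)
  | @swap s s' Ds =>
    refine ⟨fun env => match env with
      | a :: b :: env => b :: a :: env
      | env => env, ?_, fun env h => ?_⟩
    · have e1 : Const fun x : (ℕ × List (Vec V)) × (ℕ × List (Vec V)) × Env V =>
        x.2.1 :: x.1 :: x.2.2 := by fun_prop
      refine Computes.of_enc e1 1 fun env h => ?_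
      match env with
      | [] => simp at h
      | [a] => simp at h
      | a :: b :: env => exact ⟨(a, b, env), trivial, rfl, rfl, by simp⟩
    · match env with
      | [] => simp at h
      | [a] => simp at h
      | a :: b :: env =>
        refine ⟨.swap _ _ _, fun R hR => ?_⟩
        obtain ⟨h3, h4⟩ := List.forall₂_cons.1 hR
        obtain ⟨h5, h6⟩ := List.forall₂_cons.1 h4
        exact .cons h5 (.cons h3 h6)
  | @trans Ds₁ Ds₂ Ds₃ h1 h2 ih1 ih2 =>
    obtain ⟨g, hg, hg'⟩ := ih1
    obtain ⟨g', hg₂, hg₂'⟩ := ih2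
    have key : ∀ env : Env V, env.length = Ds₁.length → (g env).length = Ds₂.length :=
      fun env h => by rw [(hg' env h).1.length_eq, h, h1.length_eq]
    refine ⟨fun env => g' (g env), (hg₂.comp hg key).weaken 1 fun env h => ⟨h, by simp⟩,
      fun env h => ⟨(hg₂' _ (key env h)).1.trans (hg' env h).1, fun R hR => ?_⟩⟩
    exact (hg₂' _ (key env h)).2 R ((hg' env h).2 R hR)

@[fun_prop] theorem Const.drop {α β : Type*} [Enc α] [Enc β] (n : ℕ) {f : α → List β}
    (hf : Const f) : Const fun a => (f a).drop n := by
  induction n with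
  | zero => simpa using hf
  | succ n ih => simpa only [List.tail_drop] using Const.tail ih

theorem Computes.onEnv {q : Env V → Prop} {g : Env V → Env V} (hg : Computes q g fun _ => 0) (j : ℕ)
    (hp : ∀ x, p x → q x.2) :
    Computes p (fun x => (x.1, g x.2)) fun x => volume x * lg x ^ j := by
  have e1 : Const fun x : ℕ × Env V => x.1 := by fun_prop
  have e2 : Const fun x : ℕ × Env V => x.2 := by fun_prop
  exact ((e1.computes p 0).pair (hg.comp (e2.computes p 0) hp)).weaken 1 fun x hx => ⟨hx, by simp⟩

omit [Fintype V] in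
theorem prod_le_of_perm_append {l l' r : Env V} (h : l.Perm (r ++ l')) (h1 : ∀ g ∈ l, 1 ≤ g.1) :
    (l'.map Prod.fst).prod ≤ (l.map Prod.fst).prod := by
  rw [(h.map Prod.fst).prod_eq, List.map_append, List.prod_append]
  refine Nat.le_mul_of_pos_left _ (List.prod_pos fun a ha => ?_)
  obtain ⟨g, hg, rfl⟩ := List.mem_map.1 ha
  exact h1 g (h.mem_iff.2 (List.mem_append.2 (.inl hg)))

omit [Fintype V] [DecidableEq V] in
theorem volume_total_le_of_perm_append {l l' r : Env V} (B : ℕ) (h : l.Perm (r ++ l')) :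
    volume (B, l') ≤ 4 * volume (B, l) ∧ total (B, l') ≤ 4 * total (B, l) := by
  simp only [volume, total, (h.map Prod.fst).sum_eq, (h.map fun g => g.2.length).sum_eq,
    List.map_append, List.sum_append]
  omega

theorem Valid.one_le {z s : ℕ} {x : ℕ × Env V} (h : Valid Ds z s x) : ∀ g ∈ x.2, 1 ≤ g.1 := by
  obtain ⟨h1, -⟩ := h
  generalize x.2 = env at h1
  induction h1 with
  | nil => simp
  | cons h2 _ ih => exact List.forall_mem_cons.2 ⟨h2.1, ih⟩

/-- Guards can be permuted and discarded. -/
theorem SolvableOn.select {z s : ℕ} (h : SolvableOn idx So Ds' (Valid Ds' z s))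
    (hD : (Ds' : Multiset (Slot V)) ≤ (Ds : Multiset (Slot V))) :
    SolvableOn idx So Ds (Valid Ds z s) := by
  classical
  obtain ⟨r, hr⟩ := Multiset.le_iff_exists_add.1 hD
  rw [add_comm, ← Multiset.coe_toList r, Multiset.coe_add, Multiset.coe_eq_coe] at hr
  set r := r.toList
  obtain ⟨g, hg, hg'⟩ := exists_perm_select hr
  have hlen : ∀ x, Valid Ds z s x → x.2.length = Ds.length := fun x hx => hx.1.length_eq.symm
  have hd : Const fun env : Env V => env.drop r.length := by fun_prop
  have hgd := (Computes.comp hd hg fun _ _ => trivial).weaken (q := fun env => env.length = Ds.length)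
    (U := fun _ => 0) 1 fun env h => ⟨h, by simp⟩
  refine h.pullback (fun x => (x.1, (g x.2).drop r.length)) 0 (hgd.onEnv 0 hlen) fun x hx => ?_
  obtain ⟨h1, h2⟩ := hg' x.2 (hlen x hx)
  have h3 : x.2.Perm ((g x.2).take r.length ++ (g x.2).drop r.length) := by
    rw [List.take_append_drop]; exact h1.symm
  have h4 : ∀ R : Slot V → ℕ × List (Vec V) → Prop, List.Forall₂ R Ds x.2 →
      List.Forall₂ R Ds' ((g x.2).drop r.length) := fun R hR => by
    have := List.forall₂_drop r.length (h2 R hR)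
    rwa [List.drop_left] at this
  obtain ⟨h5, h6⟩ := volume_total_le_of_perm_append x.1 h3
  refine ⟨⟨h4 _ hx.1, hx.2.1, ?_⟩, rfl, h5, h6, fun t ht => h4 _ ht⟩
  exact (Nat.mul_le_mul_right _ (prod_le_of_perm_append h3 hx.one_le)).trans hx.2.2

/-- If the first guards exceed the budget, dropping them leaves a product that is within a power of
the budget with exponent one less. -/
theorem Valid.drop {pre : List (Slot V)} {z z' s s' : ℕ} {x : ℕ × Env V}
    (h : Valid (pre ++ Ds) z s x) (hx : x.1 < ((x.2.take pre.length).map Prod.fst).prod)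
    (hz : z ≤ z' + 1) (hs : s' ≤ s) : Valid Ds z' s' (x.1, x.2.drop pre.length) ∧ 0 < z' := by
  have h1 := List.forall₂_drop pre.length h.1
  rw [List.drop_left] at h1
  obtain ⟨-, hB, h3⟩ := id h
  have hpos : 0 < ((x.2.drop pre.length).map Prod.fst).prod := List.prod_pos fun a ha => by
    obtain ⟨g, hg, rfl⟩ := List.mem_map.1 ha
    exact h.one_le g (List.mem_of_mem_drop hg)
  rw [← List.take_append_drop pre.length x.2, List.map_append, List.prod_append] at h3
  set R := ((x.2.drop pre.length).map Prod.fst).prod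
  set Q := ((x.2.take pre.length).map Prod.fst).prod
  have h4 : Q * (R * 2 ^ s') ≤ x.1 * x.1 ^ z' := by
    calc Q * (R * 2 ^ s') ≤ Q * (R * 2 ^ s) :=
          Nat.mul_le_mul_left _ (Nat.mul_le_mul_left _ (Nat.pow_le_pow_right (by omega) hs))
      _ = Q * R * 2 ^ s := by ring
      _ ≤ x.1 ^ z := h3
      _ ≤ x.1 ^ (z' + 1) := Nat.pow_le_pow_right hB hz
      _ = _ := by ring
  refine ⟨⟨h1, hB, ?_⟩, ?_⟩
  · exact Nat.le_of_mul_le_mul_left ((Nat.mul_le_mul_right _ hx.le).trans h4) hB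
  · refine Nat.pos_of_ne_zero fun h0 => ?_
    subst h0
    have h5 : Q * 1 ≤ Q * (R * 2 ^ s') :=
      Nat.mul_le_mul_left _ (Nat.mul_pos hpos (Nat.pow_pos (by omega)))
    simp only [pow_zero, mul_one] at h4 h5
    omega

/-- The rules that are certified by an identity with at most `n` terms can be solved. -/
def SolvableUpTo (idx : Finset V → ℕ) (So : Schema V) (n : ℕ) : Prop :=
  ∀ (Zs : Multiset (Finset V)) (Ds : List (Slot V)) (Ms : Multiset (Mon V)) (Ss : Multiset (Sub V)),
    Ident Zs Ds Ms Ss → (∀ Z ∈ Zs, Z ∈ So) →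
    Ds.length + Multiset.card Ms + 2 * Multiset.card Ss ≤ n → 0 < Multiset.card Zs →
    SolvableOn idx So Ds (Valid Ds (Multiset.card Zs) (Multiset.card Ss))

/-- If an unconditional term is guarded by more than the budget allows, the reset lemma removes it
from the identity together with one target, and the product of the remaining bounds stays within
the smaller power of the budget. -/
theorem SolvableOn.reset {n : ℕ} (ih : SolvableUpTo idx So n) {Y : Finset V} {pre : List (Slot V)}
    {Zs : Multiset (Finset V)} {Ms : Multiset (Mon V)} {Ss : Multiset (Sub V)} {s : ℕ}
    (hI : Ident Zs (Slot.uncond Y ::ₘ Ds) Ms Ss) (hZ : ∀ Z ∈ Zs, Z ∈ So)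
    (hn : Ds.length + Multiset.card Ms + 2 * Multiset.card Ss ≤ n) (hs : Multiset.card Ss ≤ s) :
    SolvableOn idx So (pre ++ Ds) (fun x => Valid (pre ++ Ds) (Multiset.card Zs) s x ∧
      x.1 < ((x.2.take pre.length).map Prod.fst).prod) := by
  obtain ⟨Zs', Ds', Ms', Ss', h1, h2, h3, h4, h5, h6⟩ := hI.reset n hn
  by_cases h0 : 0 < Multiset.card Zs'
  · obtain ⟨Ds', rfl⟩ := Quot.exists_rep Ds'
    have h7 := (ih Zs' Ds' Ms' Ss' h1 (fun Z h => hZ Z (Multiset.mem_of_le h2 h)) h5 h0).select h4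
    have hd : Const fun env : Env V => env.drop pre.length := by fun_prop
    refine h7.pullback (fun x => (x.1, x.2.drop pre.length)) 0
      ((hd.computes (fun _ => True) _).onEnv 0 fun _ _ => trivial) fun x hx => ?_
    obtain ⟨h8, h9⟩ := volume_total_le_of_perm_append x.1
      (.of_eq (List.take_append_drop pre.length x.2).symm)
    refine ⟨(hx.1.drop hx.2 h3 (h6.trans hs)).1, rfl, h8, h9, fun t ht => ?_⟩
    have := List.forall₂_drop pre.length ht
    rwa [List.drop_left] at this
  · exact .of_false fun x hx => h0 (hx.1.drop hx.2 h3 (h6.trans hs)).2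

end solvable

/-! ### The steps of an identity as steps of a program -/

section steps
variable {V : Type*} [Fintype V] [DecidableEq V]

/-- The bound of the first guard. -/
def bnd (e : Env V) : ℕ := (e.headD (0, [])).1

/-- The relation of the first guard. -/
def rel (e : Env V) : List (Vec V) := (e.headD (0, [])).2

@[fun_prop] theorem Const.bnd {α : Type*} [Enc α] {f : α → Env V} (hf : Const f) :
    Const fun a => bnd (f a) := by
  have : Const fun e : Env V => Panda.bnd e := ⟨.comp .fst .fst, 3, fun e _ => ⟨3, by
    cases e <;> exact .comp (.fst _) (.fst _), by simp⟩⟩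
  exact this.comp hf

@[fun_prop] theorem Const.rel {α : Type*} [Enc α] {f : α → Env V} (hf : Const f) :
    Const fun a => rel (f a) := by
  have : Const fun e : Env V => Panda.rel e := ⟨.comp .fst .snd, 3, fun e _ => ⟨3, by
    cases e <;> exact .comp (.fst _) (.snd _), by simp⟩⟩
  exact this.comp hf

theorem size_bnd_le (x : ℕ × Env V) : (bnd x.2).size + 1 ≤ lg x := by
  refine Nat.succ_le_succ (Nat.size_le_size ?_)
  obtain ⟨B, _ | ⟨g, e⟩⟩ := x <;> simp [bnd, total, volume]
  omega

theorem size_bnd_tail_le (x : ℕ × Env V) : (bnd x.2.tail).size + 1 ≤ lg x := by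
  refine Nat.succ_le_succ (Nat.size_le_size ?_)
  obtain ⟨B, _ | ⟨g, _ | ⟨g', e⟩⟩⟩ := x <;> simp [bnd, total, volume]
  omega

theorem sortTime_le {x : ℕ × Env V} {m : ℕ} (hx : 1 ≤ volume x) (hm : m ≤ volume x) :
    sortTime m ≤ 2 * (volume x * lg x) := by
  have h1 : Nat.clog 2 m ≤ (total x).size := by
    rw [Nat.clog_le_iff_le_pow (by norm_num)]
    have := Nat.lt_size_self (total x)
    have : volume x ≤ total x := Nat.le_add_right _ _
    omega
  rw [sortTime, ← mul_assoc]
  exact Nat.mul_le_mul (by omega) (Nat.succ_le_succ h1)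

theorem mask_empty (t : Vec V) : mask ∅ t = fun _ => 0 := by
  funext v; simp [mask]

theorem Guards.length_le {Y : Finset V} {g : ℕ × List (Vec V)} (h : Guards (Slot.uncond Y) g) :
    g.2.length ≤ g.1 := by
  have := h.2 (mask ∅ fun _ => 0)
  rwa [List.filter_eq_self.2] at this
  intro t _
  exact decide_eq_true ((mask_empty t).trans (mask_empty _).symm)

theorem guards_uncond {Y : Finset V} {n : ℕ} {l : List (Vec V)} (h1 : 1 ≤ n) (h2 : l.length ≤ n) :
    Guards (Slot.uncond Y) (n, l) :=
  ⟨h1, fun _ => (List.length_filter_le _ _).trans h2⟩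

theorem Valid.one_le_volume {Ds : List (Slot V)} {z s : ℕ} {x : ℕ × Env V} (h : Valid Ds z s x) :
    1 ≤ volume x := h.2.1.trans (Nat.le_add_right _ _)

variable {idx : Finset V → ℕ} {So : Schema V} {Ds : List (Slot V)} {z s : ℕ}

/-- A target that is guarded within the budget is an answer. -/
theorem SolvableOn.target {Y : Finset V} (hY : Y ∈ So) :
    SolvableOn idx So (Slot.uncond Y :: Ds)
      (fun x => Valid (Slot.uncond Y :: Ds) z s x ∧ bnd x.2 ≤ x.1) := by
  have e1 : Const fun x : Bool × Vec V => (idx Y, x.2) := by fun_prop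
  have e2 : Const fun x : ℕ × Env V => (false, rel x.2) := by fun_prop
  refine ⟨fun x => (rel x.2).map fun t => (idx Y, t), 0, 1,
    ((Computes.map_const (f := fun (_ : Bool) t => (idx Y, t)) e1).comp
      (e2.computes (fun _ => True) 0) fun _ _ => trivial).weaken 1 fun x _ => ⟨trivial, ?_⟩, ?_⟩
  · obtain ⟨B, _ | ⟨g, e⟩⟩ := x <;> simp [rel, volume]
    omega
  · rintro ⟨B, e⟩ ⟨⟨h1, h2, h3⟩, h4⟩
    obtain ⟨g, e, h5, h6, rfl⟩ := List.forall₂_cons_left_iff.1 h1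
    refine ⟨?_, fun t ht => ⟨Y, hY, List.mem_map.2 ⟨_, ?_, rfl⟩⟩⟩
    · simpa [rel] using h5.length_le.trans h4
    · have := (List.forall₂_cons.1 ht).1
      rwa [Slot.uncond, Finset.empty_union] at this

theorem Computes.mul_bnd : Computes (fun _ => True)
    (fun x : ℕ × Env V => bnd x.2 * bnd x.2.tail) (fun x => lg x ^ 2) := by
  have e1 : Const fun x : ℕ × Env V => (bnd x.2, bnd x.2.tail) := by
    have : Const fun x : ℕ × Env V => x.2.tail := Const.tail (by fun_prop)
    fun_prop
  refine (mul_prim.comp (e1.computes (fun _ => True) 0) fun _ _ => trivial).weaken 1 fun x _ =>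
    ⟨trivial, ?_⟩
  have := Nat.mul_le_mul (size_bnd_le x) (size_bnd_tail_le x)
  rw [← sq] at this
  simp only [Pi.zero_apply]
  omega

/-- A join of two guards whose product is within the budget guards a composition. -/
theorem SolvableOn.compose {δ : Slot V}
    (h : SolvableOn idx So (Slot.uncond (δ.X ∪ δ.Y) :: Ds)
      (Valid (Slot.uncond (δ.X ∪ δ.Y) :: Ds) z s)) :
    SolvableOn idx So (Slot.uncond δ.X :: δ :: Ds)
      (fun x => Valid (Slot.uncond δ.X :: δ :: Ds) z s x ∧ bnd x.2 * bnd x.2.tail ≤ x.1) := by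
  have key : ∀ x : ℕ × Env V, Valid (Slot.uncond δ.X :: δ :: Ds) z s x →
      bnd x.2 * bnd x.2.tail ≤ x.1 →
      (joinOn δ.K δ.X (rel x.2) (rel x.2.tail)).length ≤ bnd x.2 * bnd x.2.tail := by
    rintro ⟨B, e⟩ ⟨h1, h2, h3⟩ h4
    obtain ⟨g, e, h5, h6, rfl⟩ := List.forall₂_cons_left_iff.1 h1
    obtain ⟨g', e, h7, h8, rfl⟩ := List.forall₂_cons_left_iff.1 h6
    exact (joinOn_length_le h7.2).trans (Nat.mul_le_mul_right _ h5.length_le)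
  refine h.pullback (fun x => (x.1, (bnd x.2 * bnd x.2.tail,
    joinOn δ.K δ.X (rel x.2) (rel x.2.tail)) :: x.2.tail.tail)) 2 ?_ ?_
  · have e0 : Const fun x : ℕ × Env V => x.2.tail := Const.tail (by fun_prop)
    have e1 : Const fun x : ℕ × Env V => x.1 := by fun_prop
    have e2 : Const fun x : ℕ × Env V => (rel x.2, rel x.2.tail) := by fun_prop
    have e3 : Const fun x : ℕ × Env V => x.2.tail.tail := Const.tail e0
    refine ((e1.computes (fun _ => True) 0).pair (((Computes.mul_bnd).pair
      ((Computes.joinOn δ.K δ.X).comp (e2.computes (fun _ => True) 0) fun _ _ => trivial)).cons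
      (e3.computes _ 0))).weaken 6 fun x hx => ⟨trivial, ?_⟩
    have h1 := key x hx.1 hx.2
    have h2 := hx.1.one_le_volume
    have h3 := sortTime_le (x := x) (m := (rel x.2).length + (rel x.2.tail).length) h2 (by
      obtain ⟨B, _ | ⟨g, _ | ⟨g', e⟩⟩⟩ := x <;> simp [rel, volume]
      omega)
    have h4 : volume x * lg x ≤ volume x * lg x ^ 2 :=
      Nat.mul_le_mul_left _ (Nat.le_self_pow (by norm_num) _)
    have h5 : 1 * lg x ^ 2 ≤ volume x * lg x ^ 2 := Nat.mul_le_mul_right _ h2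
    have h6 : volume x * 1 ≤ volume x * lg x ^ 2 :=
      Nat.mul_le_mul_left _ (Nat.pow_pos (lg_pos x))
    have h7 : x.1 ≤ volume x := Nat.le_add_right _ _
    have h8 := hx.2
    simp only [Pi.zero_apply]
    omega
  · rintro ⟨B, e⟩ ⟨hv, h4⟩
    have h9 := key _ hv h4
    obtain ⟨h1, h2, h3⟩ := hv
    obtain ⟨g, e, h5, h6, rfl⟩ := List.forall₂_cons_left_iff.1 h1
    obtain ⟨g', e, h7, h8, rfl⟩ := List.forall₂_cons_left_iff.1 h6
    simp only [bnd, rel, List.headD_cons, List.tail_cons] at h4 h9 ⊢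
    refine ⟨⟨.cons (guards_uncond (Nat.mul_pos h5.1 h7.1) h9) h8, h2, ?_⟩, trivial, ?_, ?_, fun t ht => ?_⟩
    · simpa [mul_assoc] using h3
    · simp [volume]; omega
    · simp [volume, total]; omega
    · obtain ⟨ht1, ht2⟩ := List.forall₂_cons.1 ht
      obtain ⟨ht2, ht3⟩ := List.forall₂_cons.1 ht2
      refine .cons ?_ ht3
      have := mem_joinOn (K := δ.K) (Y := δ.X) ht1 ht2 (by
        funext v
        by_cases hv : v ∈ δ.K
        · simp [mask, hv, Slot.uncond, δ.sub hv]
        · simp [mask, hv])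
      convert this using 1
      funext v
      by_cases hv : v ∈ δ.X
      · simp [mask, glue, hv, Slot.uncond]
      · have hv' : v ∉ δ.K := fun h => hv (δ.sub h)
        simp [mask, glue, hv, hv', Slot.uncond]

/-- A projection of a guard of `X ∪ W` guards `X`. -/
theorem SolvableOn.project {X W : Finset V}
    (h : SolvableOn idx So (Slot.uncond X :: Ds) (Valid (Slot.uncond X :: Ds) z s)) :
    SolvableOn idx So (Slot.uncond (X ∪ W) :: Ds) (Valid (Slot.uncond (X ∪ W) :: Ds) z s) := by
  refine h.pullback (fun x => (x.1, (bnd x.2, (rel x.2).map (mask X)) :: x.2.tail)) 0 ?_ ?_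
  · have e0 : Const fun x : ℕ × Env V => x.2.tail := Const.tail (by fun_prop)
    have e1 : Const fun x : ℕ × Env V => x.1 := by fun_prop
    have e2 : Const fun x : ℕ × Env V => (false, rel x.2) := by fun_prop
    have e3 : Const fun x : ℕ × Env V => bnd x.2 := by fun_prop
    have e4 : Const fun x : Bool × Vec V => mask X x.2 := by fun_prop
    refine ((e1.computes (fun _ => True) 0).pair (((e3.computes _ 0).pair
      ((Computes.map_const (f := fun (_ : Bool) t => mask X t) e4).comp
        (e2.computes (fun _ => True) 0) fun _ _ => trivial)).cons
      (e0.computes _ 0))).weaken 1 fun x _ => ⟨trivial, ?_⟩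
    obtain ⟨B, _ | ⟨g, e⟩⟩ := x <;> simp [rel, volume]
    omega
  · rintro ⟨B, e⟩ ⟨h1, h2, h3⟩
    obtain ⟨g, e, h5, h6, rfl⟩ := List.forall₂_cons_left_iff.1 h1
    simp only [bnd, rel, List.headD_cons, List.tail_cons]
    refine ⟨⟨.cons (guards_uncond h5.1 (by simpa using h5.length_le)) h6, h2, by simpa using h3⟩, trivial,
      ?_, ?_, fun t ht => ?_⟩
    · simp [volume]; omega
    · simp [volume, total]; omega
    · obtain ⟨ht1, ht2⟩ := List.forall₂_cons.1 ht
      refine .cons (List.mem_map.2 ⟨_, ht1, ?_⟩) ht2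
      funext v
      by_cases hv : v ∈ X <;> simp [mask, hv, Slot.uncond]

/-- The guards after a decomposition of the first one, for the keys of degree between `p` and `2 * p`. -/
noncomputable def decomposeAt (X : Finset V) (x : ℕ × Env V) (p : ℕ) : ℕ × Env V :=
  (x.1, (split (sizedGroups (mask X) (rel x.2)) p).1 ::
    (split (sizedGroups (mask X) (rel x.2)) p).2 :: x.2.tail)

theorem Computes.decomposeAt (X : Finset V) :
    Computes (fun x : (ℕ × Env V) × ℕ => 1 ≤ volume x.1 ∧ x.2 ≤ bnd x.1.2)
      (fun x => decomposeAt X x.1 x.2) (fun x => volume x.1 * lg x.1) := by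
  have e0 : Const fun x : (ℕ × Env V) × ℕ => x.1.2.tail := Const.tail (by fun_prop)
  have e1 : Const fun x : (ℕ × Env V) × ℕ => rel x.1.2 := by fun_prop
  have e2 : Const fun x : (ℕ × Env V) × ℕ => x.2 := by fun_prop
  have e3 : Const fun x : (ℕ × Env V) × ℕ => x.1 := by fun_prop
  have e4 : Const fun y : ((ℕ × List (Vec V)) × (ℕ × List (Vec V))) × ((ℕ × Env V) × ℕ) =>
      (y.2.1.1, y.1.1 :: y.1.2 :: y.2.1.2.tail) := by
    have : Const fun y : ((ℕ × List (Vec V)) × (ℕ × List (Vec V))) × ((ℕ × Env V) × ℕ) =>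
      y.2.1.2.tail := Const.tail (by fun_prop)
    fun_prop
  have e5 : Const fun x : (ℕ × Env V) × ℕ => x := Const.id
  have hm : Const (mask X : Vec V → Vec V) := by fun_prop
  have h1 := Computes.split.comp (((Computes.sizedGroups hm).comp (e1.computes (fun _ => True) 0)
    fun _ _ => trivial).pair (e2.computes _ 0)) fun _ _ => trivial
  have h2 := (e4.computes (fun _ => True) 0).comp (h1.pair (e5.computes _ 0)) fun _ _ => trivial
  refine h2.weaken 8 ?_
  rintro ⟨⟨B, e⟩, p⟩ ⟨hx, hp⟩
  refine ⟨trivial, ?_⟩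
  change 1 ≤ volume (B, e) at hx
  have a1 : (rel e).length ≤ volume (B, e) := by
    obtain _ | ⟨g, e⟩ := e <;> simp [rel, volume]
    omega
  have a2 := sortTime_le hx a1
  have a3 : (Panda.sizedGroups (mask X) (rel e)).length ≤ (rel e).length := by
    rw [Panda.sizedGroups, List.length_map]
    exact groupBy_length_le _ _
  have a4 : ((Panda.sizedGroups (mask X) (rel e)).map fun e => e.2.2.length).sum = (rel e).length := by
    rw [Panda.sizedGroups, List.map_map]
    exact groupBy_sum_length _ _
  have a5 : (Panda.sizedGroups (mask X) (rel e)).length.size + 1 ≤ lg (B, e) :=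
    Nat.succ_le_succ (Nat.size_le_size (a3.trans (a1.trans (Nat.le_add_right _ _))))
  have a6 := Nat.mul_le_mul (a3.trans a1) a5
  have a7 : p.size + 1 ≤ lg (B, e) :=
    (Nat.succ_le_succ (Nat.size_le_size hp)).trans (size_bnd_le (B, e))
  have a8 : 1 * lg (B, e) ≤ volume (B, e) * lg (B, e) := Nat.mul_le_mul_right _ hx
  have a9 : volume (B, e) * 1 ≤ volume (B, e) * lg (B, e) := Nat.mul_le_mul_left _ (lg_pos _)
  simp only [Pi.zero_apply]
  omega

/-- A guard of `K ∪ Y` is decomposed, for each power of two `p`, into the keys of degree about `p`,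
which guard `K`, and the tuples with these keys, which guard the term `δ`. If the guard has the
bound `n`, the new bounds are at most `n / p` (or `1`) and `2 * p`, so that one factor `2` of the
reserve is spent; there are only logarithmically many powers of two up to `n`. -/
theorem SolvableOn.decompose {δ : Slot V}
    (h : SolvableOn idx So (Slot.uncond δ.K :: δ :: Ds) (Valid (Slot.uncond δ.K :: δ :: Ds) z s)) :
    SolvableOn idx So (Slot.uncond (δ.K ∪ δ.Y) :: Ds)
      (Valid (Slot.uncond (δ.K ∪ δ.Y) :: Ds) z (s + 1)) := by
  obtain ⟨f, k, c, hf, hfc⟩ := h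
  have key : ∀ x p, Valid (Slot.uncond (δ.K ∪ δ.Y) :: Ds) z (s + 1) x → p ∈ powersFrom (bnd x.2) 1 →
      Valid (Slot.uncond δ.K :: δ :: Ds) z s (decomposeAt δ.K x p) ∧
      volume (decomposeAt δ.K x p) ≤ 4 * volume x ∧ total (decomposeAt δ.K x p) ≤ 4 * total x := by
    rintro ⟨B, e⟩ p ⟨h1, h2, h3⟩ hp
    obtain ⟨g, e, h5, h6, rfl⟩ := List.forall₂_cons_left_iff.1 h1
    simp only [decomposeAt, bnd, rel, List.headD_cons, List.tail_cons] at h2 hp ⊢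
    obtain ⟨hp1, hp2⟩ := mem_powersFrom one_pos hp
    have a1 := split_keys_length (key := mask δ.K) (R := g.2) (p := p)
    have a2 := split_bound (key := mask δ.K) (R := g.2) (p := p)
    have a3 := split_elements_length (key := mask δ.K) (R := g.2) (p := p)
    have a4 := split_elements_count (key := mask δ.K) (R := g.2) (p := p)
    have a5 : (split (sizedGroups (mask δ.K) g.2) p).2.1 = p + p := rfl
    have a6 := h5.length_le
    set S := split (sizedGroups (mask δ.K) g.2) p
    have a7 : S.1.1 * p ≤ g.1 := by
      rw [a2]
      rcases max_choice 1 S.1.2.length with h | h <;> rw [h] <;> omega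
    have a8 : S.1.2.length ≤ g.2.length := le_trans (Nat.le_mul_of_pos_right _ hp1) a1
    refine ⟨⟨.cons (guards_uncond (n := S.1.1) (l := S.1.2) (by omega) (by omega)) (.cons ⟨by omega, fun k => by
      rw [a5]; exact a4 k⟩ h6), h2, ?_⟩, ?_, ?_⟩
    · refine le_trans ?_ h3
      simp only [List.map_cons, List.prod_cons, a5]
      calc S.1.1 * ((p + p) * (List.map Prod.fst e).prod) * 2 ^ s
          = (S.1.1 * p) * (List.map Prod.fst e).prod * 2 ^ (s + 1) := by ring
        _ ≤ _ := Nat.mul_le_mul_right _ (Nat.mul_le_mul_right _ a7)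
    · simp only [volume, List.map_cons, List.sum_cons]; omega
    · simp only [volume, total, List.map_cons, List.sum_cons, a5]; omega
  have hmem : ∀ x p, p ∈ powersFrom (bnd x.2) 1 → p ≤ bnd (V := V) (Prod.snd (α := ℕ) x) :=
    fun x p hp => (mem_powersFrom one_pos hp).2
  have hlen : ∀ x : ℕ × Env V, (powersFrom (bnd x.2) 1).length ≤ lg x := fun x =>
    (powersFrom_length_le _).trans ((Nat.le_succ _).trans (size_bnd_le x))
  have hout : ∀ x p, Valid (Slot.uncond (δ.K ∪ δ.Y) :: Ds) z (s + 1) x →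
      p ∈ powersFrom (bnd x.2) 1 →
      (f (decomposeAt δ.K x p)).length ≤ c * 3 ^ k * (x.1 * lg x ^ k) := fun x p hx hp => by
    obtain ⟨h1, h2, h3⟩ := key x p hx hp
    refine (hfc _ h1).1.trans ?_
    calc c * (x.1 * lg (decomposeAt δ.K x p) ^ k) ≤ c * (x.1 * (3 ^ k * lg x ^ k)) :=
          Nat.mul_le_mul_left _ (Nat.mul_le_mul_left _ (lg_pow_le h3 k))
      _ = _ := by ring
  refine ⟨fun x => (powersFrom (bnd x.2) 1).flatMap fun p => f (decomposeAt δ.K x p), k + 2,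
    c * 3 ^ k, ?_, fun x hx => ⟨?_, fun t ht => ?_⟩⟩
  · have e1 : Const fun x : ℕ × Env V => x := Const.id
    have e2 : Const fun x : ℕ × Env V => bnd x.2 := by fun_prop
    have h1 := (hf.comp ((Computes.decomposeAt δ.K).weaken
      (q := fun y => Valid (Slot.uncond (δ.K ∪ δ.Y) :: Ds) z (s + 1) y.1 ∧
        y.2 ∈ powersFrom (bnd y.1.2) 1) (U := fun y => volume y.1 * lg y.1) 1
      fun y hy => ⟨⟨hy.1.one_le_volume, hmem _ _ hy.2⟩, by omega⟩)
      fun y hy => (key _ _ hy.1 hy.2).1)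
    have h2 := (Computes.flatMap (f := fun (x : ℕ × Env V) p => f (decomposeAt δ.K x p)) h1).comp
      ((e1.computes (fun x => Valid (Slot.uncond (δ.K ∪ δ.Y) :: Ds) z (s + 1) x) 0).pair
        (Computes.powersFrom.comp (e2.computes _ 0) fun _ _ => trivial)) fun x hx p hp => ⟨hx, hp⟩
    refine h2.weaken (3 + 4 * 3 ^ k + c * 3 ^ k) fun x hx => ⟨hx, ?_⟩
    have hB : x.1 ≤ volume x := Nat.le_add_right _ _
    have h3 : ∀ p ∈ powersFrom (bnd x.2) 1, volume x * lg x + volume (decomposeAt δ.K x p) *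
        lg (decomposeAt δ.K x p) ^ k + (f (decomposeAt δ.K x p)).length + 1 ≤
        (2 + 4 * 3 ^ k + c * 3 ^ k) * (volume x * lg x ^ (k + 1)) := fun p hp => by
      obtain ⟨a1, a2, a3⟩ := key x p hx hp
      have a4 : volume (decomposeAt δ.K x p) * lg (decomposeAt δ.K x p) ^ k ≤
          4 * volume x * (3 ^ k * lg x ^ (k + 1)) := Nat.mul_le_mul a2
        ((lg_pow_le a3 k).trans (Nat.mul_le_mul_left _ (lg_pow_mono x (Nat.le_succ k))))
      have a5 : volume x * lg x ^ 1 ≤ volume x * lg x ^ (k + 1) :=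
        Nat.mul_le_mul_left _ (lg_pow_mono x (by omega))
      have a6 : c * 3 ^ k * (x.1 * lg x ^ k) ≤ c * 3 ^ k * (volume x * lg x ^ (k + 1)) :=
        Nat.mul_le_mul_left _ (Nat.mul_le_mul hB (lg_pow_mono x (Nat.le_succ k)))
      have a7 : 1 ≤ volume x * lg x ^ (k + 1) :=
        Nat.mul_pos hx.one_le_volume (Nat.pow_pos (lg_pos x))
      have a8 := hout x p hx hp
      rw [pow_one] at a5
      calc _ ≤ volume x * lg x ^ (k + 1) + 4 * volume x * (3 ^ k * lg x ^ (k + 1)) +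
            c * 3 ^ k * (volume x * lg x ^ (k + 1)) + volume x * lg x ^ (k + 1) := by omega
        _ = _ := by ring
    have h4 := (List.sum_le_sum h3)
    rw [List.map_const', List.sum_replicate, smul_eq_mul] at h4
    have h5 := h4.trans (Nat.mul_le_mul_right _ (hlen x))
    have h6 : (bnd x.2).size ^ 2 ≤ volume x * lg x ^ (k + 2) := by
      calc (bnd x.2).size ^ 2 ≤ 1 * lg x ^ 2 := by
            rw [one_mul]
            exact Nat.pow_le_pow_left ((Nat.le_succ _).trans (size_bnd_le x)) 2
        _ ≤ _ := Nat.mul_le_mul hx.one_le_volume (lg_pow_mono x (by omega))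
    simp only [Pi.zero_apply]
    calc _ ≤ volume x * lg x ^ (k + 2) + lg x * ((2 + 4 * 3 ^ k + c * 3 ^ k) *
          (volume x * lg x ^ (k + 1))) := by omega
      _ = (3 + 4 * 3 ^ k + c * 3 ^ k) * (volume x * lg x ^ (k + 2)) := by ring
      _ ≤ _ := Nat.mul_le_mul_left _ (Nat.le_succ _)
  · rw [List.length_flatMap]
    have h4 := List.sum_le_sum fun p hp => hout x p hx hp
    rw [List.map_const', List.sum_replicate, smul_eq_mul] at h4
    refine h4.trans ((Nat.mul_le_mul_right _ (hlen x)).trans ?_)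
    calc lg x * (c * 3 ^ k * (x.1 * lg x ^ k)) = c * 3 ^ k * (x.1 * lg x ^ (k + 1)) := by ring
      _ ≤ _ := Nat.mul_le_mul_left _ (Nat.mul_le_mul_left _ (lg_pow_mono x (Nat.le_succ _)))
  · obtain ⟨B, e⟩ := x
    obtain ⟨g, e, h5, h6, rfl⟩ := List.forall₂_cons_left_iff.1 hx.1
    obtain ⟨ht1, ht2⟩ := List.forall₂_cons.1 ht
    obtain ⟨p, hp, h7, h8⟩ := exists_split (key := mask δ.K) h5.length_le ht1
    have e1 : mask ((Slot.uncond (δ.K ∪ δ.Y)).K ∪ (Slot.uncond (δ.K ∪ δ.Y)).Y) t =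
        mask (δ.K ∪ δ.Y) t := by
      simp only [Slot.uncond, Finset.empty_union]
    have e2 : mask ((Slot.uncond δ.K).K ∪ (Slot.uncond δ.K).Y) t = mask δ.K (mask (δ.K ∪ δ.Y) t) := by
      funext v
      by_cases hv : v ∈ δ.K <;> simp [mask, hv, Slot.uncond]
    rw [e1] at h7 h8
    rw [← e2] at h7
    obtain ⟨Z, hZ, h9⟩ := (hfc _ (key _ p hx hp).1).2 t (.cons h7 (.cons h8 ht2))
    exact ⟨Z, hZ, List.mem_flatMap.2 ⟨p, hp, h9⟩⟩

/-- If there is an output relation without attributes, the empty tuple is an answer for all vectors. -/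
theorem SolvableOn.of_empty_mem (h : ∅ ∈ So) : SolvableOn idx So Ds (Valid Ds z s) :=
  ⟨fun _ => [(idx ∅, fun _ => 0)], 0, 1, (Const.const _).computes _ _, fun x hx =>
    ⟨by simpa using hx.2.1, fun t _ => ⟨∅, h, by simp [mask_empty]⟩⟩⟩

/-- Induction on the number of terms of an identity: a nonzero unconditional term has a partner, and
each kind of partner corresponds to an operation on the guards that yields a smaller identity,
unless the bound of the new guard would exceed the budget; then the reset lemma applies. -/
theorem solvableUpTo (idx : Finset V → ℕ) (So : Schema V) (n : ℕ) : SolvableUpTo idx So n := by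
  induction n with
  | zero =>
    intro Zs Ds Ms Ss hI hZ hn h0
    obtain rfl : Ds = [] := List.length_eq_zero_iff.1 (by omega)
    by_cases h : ∅ ∈ Zs
    · exact .of_empty_mem (hZ _ h)
    · obtain ⟨δ, hδ, -⟩ := hI.exists_uncond (Multiset.card_pos.1 h0) h
      simp at hδ
  | succ n ih =>
    intro Zs Ds Ms Ss hI hZ hn h0
    by_cases h : ∅ ∈ Zs
    · exact .of_empty_mem (hZ _ h)
    obtain ⟨δ, hδ, hδX, hY⟩ := hI.exists_uncond (Multiset.card_pos.1 h0) h
    rw [Slot.eq_uncond hδX] at hδ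
    generalize δ.Y = Y at hδ hY
    obtain ⟨Ds', hDs⟩ := Multiset.exists_cons_of_mem hδ
    obtain ⟨Ds', rfl⟩ := Quot.exists_rep Ds'
    rw [hDs] at hI
    have hlen : Ds.length = Ds'.length + 1 := by
      have := congrArg Multiset.card hDs
      simpa using this
    suffices hs : SolvableOn idx So (Slot.uncond Y :: Ds')
        (Valid (Slot.uncond Y :: Ds') (Multiset.card Zs) (Multiset.card Ss)) from
      hs.select hDs.ge
    have hlt : Const fun x : ℕ × Env V => decide (x.1 < bnd x.2) := by fun_prop
    rcases hI.partner hY with h | ⟨δ, h, rfl⟩ | ⟨μ, h, rfl⟩ | ⟨σ, h, hσ⟩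
    · refine (SolvableOn.reset (pre := [Slot.uncond Y]) ih hI hZ (by omega) le_rfl).branch
        (SolvableOn.target (hZ _ h)) (fun x => decide (x.1 < bnd x.2)) 0 (hlt.computes _ _)
        (fun x hx hb => ⟨hx, ?_⟩) fun x hx hb => ⟨hx, by simpa using hb⟩
      obtain ⟨B, e⟩ := x
      obtain ⟨g, e, -, -, rfl⟩ := List.forall₂_cons_left_iff.1 hx.1
      simpa [bnd] using hb
    · obtain ⟨Ds₂, hDs₂⟩ := Multiset.exists_cons_of_mem h
      obtain ⟨Ds₂, rfl⟩ := Quot.exists_rep Ds₂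
      have hlen₂ : Ds'.length = Ds₂.length + 1 := by
        have := congrArg Multiset.card hDs₂
        simpa using this
      have hI₂ : Ident Zs (Slot.uncond δ.X ::ₘ δ ::ₘ (Ds₂ : Multiset (Slot V))) Ms Ss := by
        rw [← show _ = δ ::ₘ (Ds₂ : Multiset (Slot V)) from hDs₂]; exact hI
      suffices hs : SolvableOn idx So (Slot.uncond δ.X :: δ :: Ds₂)
          (Valid (Slot.uncond δ.X :: δ :: Ds₂) (Multiset.card Zs) (Multiset.card Ss)) from
        hs.select (Multiset.cons_le_cons _ hDs₂.ge)
      have hmul : Computes (fun x => Valid (Slot.uncond δ.X :: δ :: Ds₂) (Multiset.card Zs)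
          (Multiset.card Ss) x) (fun x => decide (x.1 < bnd x.2 * bnd x.2.tail))
          (fun x => volume x * lg x ^ 2) := by
        have e1 : Const fun x : ℕ × Env V => x.1 := by fun_prop
        have e2 : Const fun x : ℕ × ℕ => decide (x.1 < x.2) := by fun_prop
        refine ((e2.computes (fun _ => True) 0).comp ((e1.computes (fun _ => True) 0).pair
          Computes.mul_bnd) fun _ _ => trivial).weaken 1 fun x hx => ⟨trivial, ?_⟩
        have := Nat.mul_le_mul_right (lg x ^ 2) hx.one_le_volume
        simp only [Pi.zero_apply]
        omega
      refine (SolvableOn.reset (pre := [Slot.uncond δ.X, δ]) ih hI₂.compose hZ (by omega)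
        le_rfl).branch (SolvableOn.compose (ih Zs (Slot.uncond (δ.X ∪ δ.Y) :: Ds₂) Ms Ss hI₂.compose hZ
          (by rw [List.length_cons]; omega) h0))
        (fun x => decide (x.1 < bnd x.2 * bnd x.2.tail)) 2 hmul
        (fun x hx hb => ⟨hx, ?_⟩) fun x hx hb => ⟨hx, by simpa using hb⟩
      obtain ⟨B, e⟩ := x
      obtain ⟨g, e, -, h2, rfl⟩ := List.forall₂_cons_left_iff.1 hx.1
      obtain ⟨g', e, -, -, rfl⟩ := List.forall₂_cons_left_iff.1 h2
      simpa [bnd] using hb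
    · obtain ⟨Ms, rfl⟩ := Multiset.exists_cons_of_mem h
      rw [Multiset.card_cons] at hn
      exact SolvableOn.project (ih Zs (Slot.uncond μ.X :: Ds') Ms Ss hI.project hZ
        (by rw [List.length_cons]; omega) h0)
    · obtain ⟨Ss, rfl⟩ := Multiset.exists_cons_of_mem h
      obtain ⟨τ, hτ, hI⟩ : ∃ τ : Sub V, τ.X ∪ τ.Y = Y ∧
          Ident Zs (Slot.uncond Y ::ₘ (Ds' : Multiset (Slot V))) Ms (τ ::ₘ Ss) := by
        rcases hσ with h | h
        exacts [⟨σ, h, hI⟩, ⟨σ.swap, h, hI.swap⟩]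
      subst hτ
      rw [Multiset.card_cons] at hn ⊢
      exact SolvableOn.decompose (δ := τ.slot) (ih Zs (Slot.uncond τ.X :: τ.slot :: Ds') Ms Ss
        hI.decompose hZ (by simp only [List.length_cons]; omega) h0)

end steps

/-! ### Guards from the input relations -/

section input
variable {V : Type*} [Fintype V] [DecidableEq V]

/-- Lists of the tuples of the relations of an instance, in the form in which instances are stored. -/
def Listing (S : Schema V) : Type _ := (X : {X // X ∈ S}) → List (Tuple X.1)

variable {S : Schema V}

noncomputable instance : Enc (Listing S) :=
  ⟨fun l => Val.ofList (S.attach.toList.map fun X => Val.ofList ((l X).map encodeTuple))⟩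

/-- The number of tuples. -/
def Listing.size (l : Listing S) : ℕ := ∑ X, (l X).length

/-- The tuples of the relation with attributes `X`, as vectors. -/
def Listing.vecs (l : Listing S) (X : Finset V) : List (Vec V) :=
  if h : X ∈ S then (l ⟨X, h⟩).map extend else []

/-- A logarithm of the size, as a natural number that is at least `1`. -/
def Listing.lg (l : Listing S) : ℕ := (l.size + 2).size

theorem Listing.one_le_lg (l : Listing S) : 1 ≤ l.lg :=
  Nat.size_pos.2 (Nat.succ_pos _)

theorem Listing.lg_pow_mono (l : Listing S) {j k : ℕ} (h : j ≤ k) : l.lg ^ j ≤ l.lg ^ k :=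
  Nat.pow_le_pow_right l.one_le_lg h

theorem Listing.length_le_size (l : Listing S) (X : {X // X ∈ S}) : (l X).length ≤ l.size :=
  Finset.single_le_sum (f := fun X => (l X).length) (fun _ _ => Nat.zero_le _) (Finset.mem_univ X)

theorem Listing.length_vecs_le (l : Listing S) (X : Finset V) : (l.vecs X).length ≤ l.size := by
  unfold vecs
  split_ifs with h
  · simpa using l.length_le_size ⟨X, h⟩
  · simp

theorem Const.listing (X : {X // X ∈ S}) : Const fun l : Listing S => l X :=
  Const.get (l := S.attach.toList) (i := X) (by simp)
    (G := fun l X => Val.ofList ((l X).map encodeTuple)) (fun _ => rfl) fun _ => rfl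

/-- Quasi-linear time in the size of the input and a budget `b`. -/
def Listing.time (l : Listing S) (b k : ℕ) : ℕ := (l.size + b + 1) * l.lg ^ k

theorem Listing.time_mono (l : Listing S) {b b' k k' : ℕ} (hb : b ≤ b') (hk : k ≤ k') :
    l.time b k ≤ l.time b' k' :=
  Nat.mul_le_mul (by omega) (l.lg_pow_mono hk)

theorem Listing.lg_pow_le_time (l : Listing S) (b k : ℕ) : l.lg ^ k ≤ l.time b k :=
  Nat.le_mul_of_pos_left _ (Nat.succ_pos _)

theorem Listing.sortTime_le (l : Listing S) {m : ℕ} (hm : m ≤ l.size) : sortTime m ≤ 2 * l.time 0 1 := by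
  have h1 : Nat.clog 2 m ≤ l.lg := by
    rw [Nat.clog_le_iff_le_pow (by norm_num)]
    have := Nat.lt_size_self (l.size + 2)
    unfold lg
    omega
  have := l.one_le_lg
  rw [sortTime, time, pow_one, mul_left_comm]
  exact Nat.mul_le_mul (by omega) (by omega)

theorem Computes.vecs (X : Finset V) :
    Computes (fun _ => True) (fun l : Listing S => l.vecs X) (fun l => l.size) := by
  by_cases h : X ∈ S
  · have e1 : Const fun x : Bool × Tuple X => extend x.2 := by fun_prop
    have e2 := Const.listing (S := S) ⟨X, h⟩
    have e3 : Const fun l : Listing S => (false, l ⟨X, h⟩) := (Const.const false).mk e2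
    refine ((Computes.map_const (f := fun (_ : Bool) t => extend t) e1).comp
      (e3.computes (fun _ => True) 0) fun _ _ => trivial).mono _ _ 1 fun l _ =>
      ⟨trivial, by simp [Listing.vecs, h], ?_⟩
    have := l.length_le_size ⟨X, h⟩
    simp only [Pi.zero_apply]
    omega
  · simp only [Listing.vecs, h, dif_neg, not_false_eq_true]
    exact (Const.const []).computes _ _

/-- The term `h(δ)`, when it is guarded by a relation with the attributes `X`; such a relation
restricts the condition `δ.X` on the attributes in `δ.X ∩ X` only. -/
def Mon.slot (δ : Mon V) (X : Finset V) : Slot V := ⟨δ.X, δ.Y, δ.X ∩ X, Finset.inter_subset_left⟩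

/-- The relation of the guard of `δ` that is obtained from the relation with attributes `X`. -/
noncomputable def Listing.guardRel (l : Listing S) (δ : Mon V) (X : Finset V) : List (Vec V) :=
  distinct ((l.vecs X).map (mask (δ.X ∩ X ∪ δ.Y)))

/-- The guard of `δ` that is obtained from the relation with attributes `X`. -/
noncomputable def Listing.guard (l : Listing S) (δ : Mon V) (X : Finset V) : ℕ × List (Vec V) :=
  (maxDegree (mask (δ.X ∩ X)) (l.guardRel δ X), l.guardRel δ X)

theorem Listing.length_guardRel_le (l : Listing S) (δ : Mon V) (X : Finset V) :
    (l.guardRel δ X).length ≤ l.size := by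
  refine (distinct_length_le _).trans ?_
  rw [List.length_map]
  exact l.length_vecs_le X

theorem Computes.guard (δ : Mon V) (X : Finset V) :
    Computes (fun _ => True) (fun l : Listing S => l.guard δ X) (fun l => l.time 0 1) := by
  have e1 : Const fun x : Bool × Vec V => mask (δ.X ∩ X ∪ δ.Y) x.2 := by fun_prop
  have e2 : Const fun l : List (Vec V) => (false, l) := by fun_prop
  have e3 : Const (mask (δ.X ∩ X) : Vec V → Vec V) := by fun_prop
  have h1 := Computes.distinct.comp ((Computes.map_const
    (f := fun (_ : Bool) => mask (δ.X ∩ X ∪ δ.Y)) e1).comp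
    ((e2.computes (fun _ => True) 0).comp (Computes.vecs (S := S) X) fun _ _ => trivial)
    fun _ _ => trivial) fun _ _ => trivial
  have h2 := h1.weaken (q := fun _ => True) (U := fun l => l.time 0 1) 4 fun l _ => ⟨trivial, by
    have h3 := l.length_vecs_le X
    have h4 := l.sortTime_le h3
    have h5 : (l.size + 0 + 1) * 1 ≤ l.time 0 1 :=
      Nat.mul_le_mul_left _ (Nat.pow_pos l.one_le_lg)
    simp only [Pi.zero_apply, List.length_map]
    omega⟩
  refine (((Computes.maxDegree e3).comp h2 fun _ _ => trivial).pair h2).weaken 6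
    fun l _ => ⟨trivial, ?_⟩
  have := l.sortTime_le (l.length_guardRel_le δ X)
  simp only [Listing.guardRel] at this
  simp only
  omega

/-- The product of the bounds of the guards of the terms in `ds`. -/
noncomputable def Listing.guardProd (l : Listing S) (γ : Mon V → Finset V) (ds : List (Mon V)) : ℕ :=
  (ds.map fun δ => (l.guard δ (γ δ)).1).prod

theorem Listing.guard_le (l : Listing S) (δ : Mon V) (X : Finset V) : (l.guard δ X).1 ≤ l.size := by
  refine le_trans ?_ (l.length_guardRel_le δ X)
  rcases maxDegree_eq (mask (δ.X ∩ X)) (R := l.guardRel δ X) (distinct_nodup _) with h | ⟨k, g, h1, h2, h3⟩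
  · exact h.trans_le (Nat.zero_le _)
  · exact h2.symm.trans_le (h1.subperm fun x hx => (h3 x hx).1).length_le

theorem Listing.guardProd_le (l : Listing S) (γ : Mon V → Finset V) (ds : List (Mon V)) :
    l.guardProd γ ds ≤ (l.size + 2) ^ ds.length := by
  refine (List.prod_le_pow_card _ (l.size + 2) ?_).trans_eq (by rw [List.length_map])
  simp only [List.mem_map]
  rintro _ ⟨δ, -, rfl⟩
  exact (l.guard_le δ _).trans (Nat.le_add_right _ _)

theorem Computes.guardProd (γ : Mon V → Finset V) (ds : List (Mon V)) :
    Computes (fun _ => True) (fun l : Listing S => l.guardProd γ ds) (fun l => l.time 0 2) := by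
  induction ds with
  | nil => exact (Const.const 1).computes _ _
  | cons δ ds ih =>
    have e : Const fun g : ℕ × List (Vec V) => g.1 := by fun_prop
    refine (mul_prim.comp (((e.computes (fun _ => True) 0).comp (Computes.guard δ (γ δ))
      fun _ _ => trivial).pair ih) fun _ _ => trivial).mono _ _ (2 + 2 * (ds.length + 2)) fun l _ =>
      ⟨trivial, by simp [Listing.guardProd], ?_⟩
    have h1 : (l.guard δ (γ δ)).1.size ≤ l.lg :=
      Nat.size_le_size ((l.guard_le _ _).trans (Nat.le_add_right _ _))
    have h2 : (l.guardProd γ ds).size ≤ ds.length * l.lg + 1 :=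
      (Nat.size_le_size (l.guardProd_le γ ds)).trans (size_pow_le _ _)
    have h3 := l.one_le_lg
    have h4 : ((l.guard δ (γ δ)).1.size + 1) * ((l.guardProd γ ds).size + 1) ≤
        (2 * l.lg) * ((ds.length + 2) * l.lg) :=
      Nat.mul_le_mul (by omega) (by rw [add_mul]; omega)
    have h5 := l.lg_pow_le_time 0 2
    have h6 := l.time_mono (b := 0) (b' := 0) (k := 1) (k' := 2) le_rfl (by norm_num)
    have h7 : (2 * l.lg) * ((ds.length + 2) * l.lg) ≤ 2 * (ds.length + 2) * l.time 0 2 := by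
      calc _ = 2 * (ds.length + 2) * l.lg ^ 2 := by ring
        _ ≤ _ := Nat.mul_le_mul_left _ h5
    simp only [Pi.zero_apply]
    calc _ ≤ 2 * l.time 0 2 + 2 * (ds.length + 2) * l.time 0 2 := by omega
      _ = (2 + 2 * (ds.length + 2)) * l.time 0 2 := by ring
      _ ≤ _ := Nat.mul_le_mul_left _ (Nat.le_succ _)

theorem Computes.guards (γ : Mon V → Finset V) (ds : List (Mon V)) :
    Computes (fun _ => True) (fun l : Listing S => ds.map fun δ => l.guard δ (γ δ))
      (fun l => l.time 0 1) := by
  induction ds with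
  | nil => exact (Const.const []).computes _ _
  | cons δ ds ih =>
    exact ((Computes.guard δ (γ δ)).cons ih).weaken 2 fun l _ => ⟨trivial, by omega⟩

/-- The inputs of which all relations are nonempty. On these, all guards have bounds of at least `1`. -/
def Listing.Full (l : Listing S) : Prop := ∀ X, l X ≠ []

/-- The vectors of the join of the listed relations are consistent with the guards. -/
theorem Listing.mask_mem_guardRel {l : Listing S} {δ : Mon V} {X : Finset V} (hX : X ∈ S)
    (hY : δ.Y ⊆ X) {t : Vec V} (ht : ∀ X, proj X.1 t ∈ l X) :
    mask (δ.X ∩ X ∪ δ.Y) t ∈ l.guardRel δ X := by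
  rw [guardRel, mem_distinct, vecs, dif_pos hX]
  refine List.mem_map.2 ⟨_, List.mem_map.2 ⟨_, ht ⟨X, hX⟩, rfl⟩, ?_⟩
  funext v
  simp only [mask, extend, proj]
  by_cases hv : v ∈ δ.X ∩ X ∪ δ.Y
  · have hvX : v ∈ X := by
      rcases Finset.mem_union.1 hv with h | h
      exacts [(Finset.mem_inter.1 h).2, hY h]
    rw [if_pos hv, if_pos hv, dif_pos hvX]
  · rw [if_neg hv, if_neg hv]

theorem Listing.one_le_guard {l : Listing S} {δ : Mon V} {X : Finset V} (hX : X ∈ S)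
    (hl : l.Full) : 1 ≤ (l.guard δ X).1 := by
  obtain ⟨r, hr⟩ := List.exists_mem_of_ne_nil _ (hl ⟨X, hX⟩)
  have h1 : mask (δ.X ∩ X ∪ δ.Y) (extend r) ∈ l.guardRel δ X := by
    rw [guardRel, mem_distinct, vecs, dif_pos hX]
    exact List.mem_map.2 ⟨_, List.mem_map.2 ⟨_, hr, rfl⟩, rfl⟩
  refine le_trans ?_ (count_le_maxDegree (mask (δ.X ∩ X)) (l.guardRel δ X)
    (mask (δ.X ∩ X) (mask (δ.X ∩ X ∪ δ.Y) (extend r))))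
  exact List.length_pos_of_mem (List.mem_filter.2 ⟨h1, by simp⟩)

/-- On the inputs with the property `p`, a program finds in quasi-linear time a list of tagged
tuples, of length at most `b` up to logarithmic factors, which contains the projection of each
vector of the join to one of the sets in `So`; the bound `b` itself can be computed, too. -/
def Answers (idx : Finset V → ℕ) (So : Schema V) (p : Listing S → Prop) (b : Listing S → ℕ) : Prop :=
  ∃ (f : Listing S → List (ℕ × Vec V)) (k c : ℕ),
    Computes p b (fun l => l.time 0 k) ∧ Computes p f (fun l => l.time (b l) k) ∧
    ∀ l, p l → (f l).length ≤ c * (b l * l.lg ^ k) ∧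
      ∀ t : Vec V, (∀ X, proj X.1 t ∈ l X) → ∃ Z ∈ So, (idx Z, mask Z t) ∈ f l

variable {idx : Finset V → ℕ} {So : Schema V} {p : Listing S → Prop}

/-- Of two programs, run the one with the smaller bound; the bounds are computed beforehand. -/
theorem Answers.min {b₁ b₂ : Listing S → ℕ} (h1 : Answers idx So p b₁) (h2 : Answers idx So p b₂) :
    Answers idx So p fun l => min (b₁ l) (b₂ l) := by
  obtain ⟨f₁, k₁, c₁, hb₁, hf₁, h1⟩ := h1
  obtain ⟨f₂, k₂, c₂, hb₂, hf₂, h2⟩ := h2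
  have e1 : Const fun x : ℕ × ℕ => decide (x.1 < x.2) := by fun_prop
  have e2 : Const fun x : ℕ × ℕ => bif decide (x.1 < x.2) then x.1 else x.2 := by fun_prop
  have hb := hb₁.pair hb₂
  have time_le₁ : ∀ l : Listing S, ∀ b, l.time b k₁ ≤ l.time b (k₁ + k₂) :=
    fun l b => l.time_mono le_rfl (by omega)
  have time_le₂ : ∀ l : Listing S, ∀ b, l.time b k₂ ≤ l.time b (k₁ + k₂) :=
    fun l b => l.time_mono le_rfl (by omega)
  refine ⟨fun l => bif decide (b₁ l < b₂ l) then f₁ l else f₂ l, k₁ + k₂, c₁ + c₂, ?_, ?_, fun l hl => ?_⟩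
  · refine ((e2.computes (fun _ => True) 0).comp hb fun _ _ => trivial).mono _ _ 2 fun l hl =>
      ⟨hl, ?_, ?_⟩
    · by_cases h : b₁ l < b₂ l
      · simp [h, h.le]
      · simp [h, not_lt.1 h]
    · have h3 := time_le₁ l 0
      have h4 := time_le₂ l 0
      simp only [Pi.zero_apply]
      omega
  · refine (Computes.branch (U := fun l => 3 * l.time (Min.min (b₁ l) (b₂ l)) (k₁ + k₂))
      ((e1.computes (fun _ => True) 0).comp hb fun _ _ => trivial) hf₁ hf₂
      (fun l hl h => ⟨hl, ?_⟩) fun l hl h => ⟨hl, ?_⟩).weaken 3 fun l hl => ⟨hl, Nat.mul_le_mul_left 3 (Nat.le_succ _)⟩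
    · simp only [decide_eq_true_eq] at h
      rw [min_eq_left h.le]
      have h3 := (time_le₁ l 0).trans (l.time_mono (Nat.zero_le (b₁ l)) le_rfl)
      have h4 := (time_le₂ l 0).trans (l.time_mono (Nat.zero_le (b₁ l)) le_rfl)
      have h5 := time_le₁ l (b₁ l)
      simp only [Pi.zero_apply]
      omega
    · simp only [decide_eq_false_iff_not, not_lt] at h
      rw [min_eq_right h]
      have h3 := (time_le₁ l 0).trans (l.time_mono (Nat.zero_le (b₂ l)) le_rfl)
      have h4 := (time_le₂ l 0).trans (l.time_mono (Nat.zero_le (b₂ l)) le_rfl)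
      have h5 := time_le₂ l (b₂ l)
      simp only [Pi.zero_apply]
      omega
  · by_cases h : b₁ l < b₂ l
    · obtain ⟨h3, h4⟩ := h1 l hl
      simp only [h, decide_true, cond_true, min_eq_left h.le]
      exact ⟨h3.trans (Nat.mul_le_mul (Nat.le_add_right _ _)
        (Nat.mul_le_mul_left _ (l.lg_pow_mono (Nat.le_add_right _ _)))), h4⟩
    · obtain ⟨h3, h4⟩ := h2 l hl
      simp only [h, decide_false, cond_false, min_eq_right (not_lt.1 h)]
      exact ⟨h3.trans (Nat.mul_le_mul (Nat.le_add_left _ _)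
        (Nat.mul_le_mul_left _ (l.lg_pow_mono (Nat.le_add_left _ _)))), h4⟩

theorem Answers.exists_min {ι : Type*} {F : Set ι} (hF : F.Finite) {b : ι → Listing S → ℕ}
    (h : ∀ i ∈ F, Answers idx So p (b i)) (h0 : F.Nonempty) :
    ∃ b', Answers idx So p b' ∧ ∀ i ∈ F, ∀ l, b' l ≤ b i l := by
  induction F, hF using Set.Finite.induction_on with
  | empty => exact absurd h0 Set.not_nonempty_empty
  | @insert i F _ _ ih =>
    have hi := h i (Set.mem_insert i F)
    rcases F.eq_empty_or_nonempty with rfl | hF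
    · exact ⟨b i, hi, fun j hj l => by rw [Set.mem_insert_iff] at hj; simp_all⟩
    · obtain ⟨b', h1, h2⟩ := ih (fun j hj => h j (Set.mem_insert_of_mem _ hj)) hF
      refine ⟨_, hi.min h1, fun j hj l => ?_⟩
      rcases Set.mem_insert_iff.1 hj with rfl | hj
      exacts [min_le_left _ _, (min_le_right _ _).trans (h2 j hj l)]

end input

/-! ### Budgets of certificates and degrees of the input -/

section certificates
variable {V : Type*} [Fintype V] [DecidableEq V] {S : Schema V} {So : Schema V}

theorem Listing.forall₂_guards {l : Listing S} {γ : Mon V → Finset V} {ds : List (Mon V)}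
    (hγ : ∀ δ ∈ ds, γ δ ∈ S ∧ δ.Y ⊆ γ δ) (hl : l.Full) :
    List.Forall₂ Guards (ds.map fun δ => δ.slot (γ δ)) (ds.map fun δ => l.guard δ (γ δ)) := by
  rw [List.forall₂_map_left_iff, List.forall₂_map_right_iff, List.forall₂_same]
  exact fun δ hδ => ⟨Listing.one_le_guard (hγ δ hδ).1 hl, fun k => count_le_maxDegree _ _ _⟩

theorem Listing.fits_guards {l : Listing S} {γ : Mon V → Finset V} {ds : List (Mon V)}
    (hγ : ∀ δ ∈ ds, γ δ ∈ S ∧ δ.Y ⊆ γ δ) {t : Vec V} (ht : ∀ X, proj X.1 t ∈ l X) :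
    Fits (ds.map fun δ => δ.slot (γ δ)) (ds.map fun δ => l.guard δ (γ δ)) t := by
  rw [Fits, List.forall₂_map_left_iff, List.forall₂_map_right_iff, List.forall₂_same]
  exact fun δ hδ => Listing.mask_mem_guardRel (hγ δ hδ).1 (hγ δ hδ).2 ht

theorem budget_le {q P : ℕ} (hq : 0 < q) (hP : 0 < P) : budget q P ≤ 2 * P := by
  rcases (budget_spec hq hP).2 with h | ⟨s, h, h1⟩
  · omega
  · have := Nat.le_self_pow hq.ne' s
    omega

/-- The budget of a certificate, for a choice `γ` of the relations that guard its terms. -/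
noncomputable def Listing.cost (l : Listing S) (c : Cert V) (γ : Mon V → Finset V) : ℕ :=
  budget (Multiset.card c.Zs) (l.guardProd γ c.Ds.toList * 2 ^ Multiset.card c.Ss)

theorem Listing.guardProd_pos {l : Listing S} {γ : Mon V → Finset V} {ds : List (Mon V)}
    (hγ : ∀ δ ∈ ds, γ δ ∈ S ∧ δ.Y ⊆ γ δ) (hl : l.Full) : 0 < l.guardProd γ ds := by
  refine List.prod_pos fun a ha => ?_
  obtain ⟨δ, hδ, rfl⟩ := List.mem_map.1 ha
  exact Listing.one_le_guard (hγ δ hδ).1 hl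

theorem Listing.sum_guardRel_le (l : Listing S) (γ : Mon V → Finset V) (ds : List (Mon V)) :
    ((ds.map fun δ => l.guard δ (γ δ)).map fun g => g.2.length).sum ≤ ds.length * l.size := by
  rw [List.map_map]
  have := List.sum_le_sum (l := ds) (f := fun δ => (l.guard δ (γ δ)).2.length)
    (g := fun _ => l.size) fun δ _ => l.length_guardRel_le δ _
  rw [List.map_const', List.sum_replicate, smul_eq_mul] at this
  exact this

theorem Listing.sum_guard_le (l : Listing S) (γ : Mon V → Finset V) (ds : List (Mon V)) :
    ((ds.map fun δ => l.guard δ (γ δ)).map Prod.fst).sum ≤ ds.length * l.size := by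
  rw [List.map_map]
  have := List.sum_le_sum (l := ds) (f := fun δ => (l.guard δ (γ δ)).1)
    (g := fun _ => l.size) fun δ _ => l.guard_le δ _
  rw [List.map_const', List.sum_replicate, smul_eq_mul] at this
  exact this

theorem Listing.prod_size_le (l : Listing S) (γ : Mon V → Finset V) (ds : List (Mon V)) (s : ℕ) :
    l.guardProd γ ds * 2 ^ s ≤ (l.size + 2) ^ (ds.length + s) := by
  rw [pow_add]
  exact Nat.mul_le_mul (l.guardProd_le γ ds) (Nat.pow_le_pow_left (by omega) s)

theorem Computes.cost (c : Cert V) (γ : Mon V → Finset V) :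
    Computes (fun _ => True) (fun l : Listing S => l.cost c γ) (fun l => l.time 0 3) := by
  set s := Multiset.card c.Ss
  set ds := c.Ds.toList
  have h1 := mul_prim.comp ((Computes.guardProd (S := S) γ ds).pair
    ((Const.const (2 ^ s)).computes _ 0)) fun _ _ => trivial
  have h2 := (Computes.budget (Multiset.card c.Zs)).comp h1 fun _ _ => trivial
  have h3 : (2 ^ s).size = s + 1 := Nat.size_pow
  refine h2.weaken (1 + (s + 2) * (ds.length + 2) + (ds.length + s + 2) ^ 3) fun l _ => ⟨trivial, ?_⟩
  have h4 := l.one_le_lg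
  have h5 : (l.guardProd γ ds).size ≤ ds.length * l.lg + 1 :=
    (Nat.size_le_size (l.guardProd_le γ ds)).trans (size_pow_le _ _)
  have h6 : (l.guardProd γ ds * 2 ^ s).size ≤ (ds.length + s) * l.lg + 1 :=
    (Nat.size_le_size (l.prod_size_le γ ds s)).trans (size_pow_le _ _)
  have h7 : ((l.guardProd γ ds).size + 1) * ((2 ^ s).size + 1) ≤ (s + 2) * (ds.length + 2) * l.time 0 3 := by
    rw [h3]
    calc _ ≤ ((ds.length + 2) * l.lg ^ 3) * (s + 2) := by
          refine Nat.mul_le_mul_right _ ?_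
          have := Nat.le_self_pow (n := 3) (by norm_num) l.lg
          calc _ ≤ (ds.length + 2) * l.lg := by rw [add_mul]; omega
            _ ≤ _ := Nat.mul_le_mul_left _ this
      _ = (s + 2) * (ds.length + 2) * l.lg ^ 3 := by ring
      _ ≤ _ := Nat.mul_le_mul_left _ (l.lg_pow_le_time 0 3)
  have h8 : ((l.guardProd γ ds * 2 ^ s).size + 1) ^ 3 ≤ (ds.length + s + 2) ^ 3 * l.time 0 3 := by
    calc _ ≤ ((ds.length + s + 2) * l.lg) ^ 3 := Nat.pow_le_pow_left (by rw [add_mul]; omega) 3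
      _ = (ds.length + s + 2) ^ 3 * l.lg ^ 3 := mul_pow _ _ _
      _ ≤ _ := Nat.mul_le_mul_left _ (l.lg_pow_le_time 0 3)
  have h9 := l.time_mono (b := 0) (b' := 0) (k := 2) (k' := 3) le_rfl (by norm_num)
  simp only [Pi.zero_apply]
  calc _ ≤ l.time 0 3 + (s + 2) * (ds.length + 2) * l.time 0 3 +
        (ds.length + s + 2) ^ 3 * l.time 0 3 := by omega
    _ = (1 + (s + 2) * (ds.length + 2) + (ds.length + s + 2) ^ 3) * l.time 0 3 := by ring
    _ ≤ _ := Nat.mul_le_mul_left _ (Nat.le_succ _)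

/-- Each certificate, with a choice of the relations that guard its terms, leads to answers within
its budget. -/
theorem Answers.of_cert (idx : Finset V → ℕ) {c : Cert V} {γ : Mon V → Finset V}
    (h0 : 0 < Multiset.card c.Zs) (hZ : ∀ Z ∈ c.Zs, Z ∈ So)
    (hγ : ∀ δ ∈ c.Ds, γ δ ∈ S ∧ δ.Y ⊆ γ δ) :
    Answers idx So (fun l : Listing S => l.Full) fun l => l.cost c γ := by
  set s := Multiset.card c.Ss with hs
  set ds := c.Ds.toList with hds
  have hγ : ∀ δ ∈ ds, γ δ ∈ S ∧ δ.Y ⊆ γ δ := fun δ hδ => hγ δ (Multiset.mem_toList.1 hδ)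
  have hI : Ident c.Zs (ds.map fun δ => δ.slot (γ δ) : List (Slot V)) c.Ms c.Ss := fun h => by
    rw [c.ident h, ← Multiset.map_coe, hds, Multiset.coe_toList, Multiset.map_map]
    rfl
  obtain ⟨f, k, a, hf, hfa⟩ := solvableUpTo idx So _ c.Zs _ c.Ms c.Ss hI hZ le_rfl h0
  -- `lg` of the input of the solver is at most `E` times the logarithm of the input size
  set E := (2 * ds.length + 2).size + ds.length + s + 3 with hE
  have hvalid : ∀ l : Listing S, l.Full → Valid (ds.map fun δ => δ.slot (γ δ)) (Multiset.card c.Zs) s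
      (l.cost c γ, ds.map fun δ => l.guard δ (γ δ)) := fun l hl => by
    have h1 := budget_spec h0 (Nat.mul_pos (Listing.guardProd_pos hγ hl) (Nat.pow_pos (n := s) two_pos))
    refine ⟨Listing.forall₂_guards hγ hl, ?_, ?_⟩
    · refine Nat.pos_of_ne_zero fun h => ?_
      have h2 := h1.1
      rw [show budget _ _ = 0 from h, zero_pow h0.ne'] at h2
      have := Nat.mul_pos (Listing.guardProd_pos hγ hl) (Nat.pow_pos (n := s) two_pos)
      omega
    · simp only [List.map_map]
      exact h1.1
  have hvol : ∀ l : Listing S, volume (l.cost c γ, ds.map fun δ => l.guard δ (γ δ)) ≤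
      (ds.length + 1) * (l.size + l.cost c γ + 1) := fun l => by
    have := l.sum_guardRel_le γ ds
    simp only [volume]
    nlinarith
  have hlg : ∀ l : Listing S, l.Full → lg (l.cost c γ, ds.map fun δ => l.guard δ (γ δ)) ≤ E * l.lg :=
      fun l hl => by
    have h1 := l.sum_guardRel_le γ ds
    have h2 := l.sum_guard_le γ ds
    have h3 := budget_le h0 (Nat.mul_pos (Listing.guardProd_pos hγ hl) (Nat.pow_pos (n := s) two_pos))
    have h4 := l.prod_size_le γ ds s
    have h5 : total (l.cost c γ, ds.map fun δ => l.guard δ (γ δ)) ≤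
        (2 * ds.length + 2) * (l.size + 2) ^ (ds.length + s + 1) := by
      have h6 : (l.size + 2) ^ (ds.length + s) ≤ (l.size + 2) ^ (ds.length + s + 1) :=
        Nat.pow_le_pow_right (by omega) (by omega)
      have h7 : l.size ≤ (l.size + 2) ^ (ds.length + s + 1) :=
        (Nat.le_add_right _ 2).trans (Nat.le_self_pow (by omega) _)
      have h8 := Nat.mul_le_mul_left (2 * ds.length) h7
      have h9 : l.cost c γ ≤ 2 * (l.guardProd γ ds * 2 ^ s) := h3
      simp only [total, volume]
      calc _ ≤ 2 * (l.size + 2) ^ (ds.length + s + 1) + 2 * ds.length * l.size := by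
            rw [mul_assoc]; omega
        _ ≤ _ := by rw [add_mul (2 * ds.length)]; omega
    have h6 := (Nat.size_le_size h5).trans (size_mul_le _ _)
    have h7 := size_pow_le (l.size + 2) (ds.length + s + 1)
    change _ ≤ (ds.length + s + 1) * l.lg + 1 at h7
    have h8 : (2 * ds.length + 2).size * 1 ≤ (2 * ds.length + 2).size * l.lg :=
      Nat.mul_le_mul_left _ l.one_le_lg
    have h9 := l.one_le_lg
    calc _ ≤ (2 * ds.length + 2).size * l.lg + (ds.length + s + 1) * l.lg + 2 * l.lg := by
          simp only [lg]; omega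
      _ = _ := by rw [hE]; ring
  have hpow : ∀ l : Listing S, l.Full → lg (l.cost c γ, ds.map fun δ => l.guard δ (γ δ)) ^ k ≤
      E ^ k * l.lg ^ (k + 3) := fun l hl => by
    refine (Nat.pow_le_pow_left (hlg l hl) k).trans ?_
    rw [mul_pow]
    exact Nat.mul_le_mul_left _ (l.lg_pow_mono (by omega))
  refine ⟨fun l => f (l.cost c γ, ds.map fun δ => l.guard δ (γ δ)), k + 3, a * E ^ k, ?_, ?_,
    fun l hl => ⟨?_, fun t ht => (hfa _ (hvalid l hl)).2 t (Listing.fits_guards hγ ht)⟩⟩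
  · exact (Computes.cost c γ).weaken 1 fun l _ => ⟨trivial, by
      have := l.time_mono (b := 0) (b' := 0) (k := 3) (k' := k + 3) le_rfl (by omega)
      omega⟩
  · refine (hf.comp (((Computes.cost (S := S) c γ).pair (Computes.guards γ ds)).weaken
      (q := fun l => l.Full) (U := fun l => l.time 0 3 + l.time 0 1) 1 fun l _ => ⟨trivial, by omega⟩)
      hvalid).weaken (2 + (ds.length + 1) * E ^ k) fun l hl => ⟨hl, ?_⟩
    have h1 := l.time_mono (b := 0) (b' := l.cost c γ) (k := 3) (k' := k + 3) (by omega) (by omega)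
    have h2 := l.time_mono (b := 0) (b' := l.cost c γ) (k := 1) (k' := k + 3) (by omega) (by omega)
    have h3 := Nat.mul_le_mul (hvol l) (hpow l hl)
    calc _ ≤ 2 * l.time (l.cost c γ) (k + 3) + (ds.length + 1) * (l.size + l.cost c γ + 1) *
          (E ^ k * l.lg ^ (k + 3)) := by omega
      _ = (2 + (ds.length + 1) * E ^ k) * l.time (l.cost c γ) (k + 3) := by
        simp only [Listing.time]; ring
      _ ≤ _ := Nat.mul_le_mul_left _ (Nat.le_succ _)
  · refine (hfa _ (hvalid l hl)).1.trans ?_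
    calc _ ≤ a * (l.cost c γ * (E ^ k * l.lg ^ (k + 3))) :=
          Nat.mul_le_mul_left _ (Nat.mul_le_mul_left _ (hpow l hl))
      _ = _ := by ring

end certificates

section degrees
variable {V : Type*} [Fintype V] [DecidableEq V] {S : Schema V}

/-- A nonempty relation has finite degrees only for terms `h(Y | X)` such that it has all attributes
in `Y`. -/
theorem subset_of_deg_ne_top {A : Finset V} {R : Finset (Tuple A)} (hR : R.Nonempty) {δ : Mon V}
    (h : deg R δ ≠ ⊤) : δ.Y ⊆ A := by
  intro v hvY
  by_contra hvA
  obtain ⟨r, hr⟩ := hR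
  have hvX : v ∉ δ.X := Finset.disjoint_left.1 δ.disj hvY
  -- the attribute `v` is not restricted by `R`, so it takes infinitely many values
  let u : ℕ → Tuple (δ.X ∪ δ.Y) := fun m => proj _ fun a => if a = v then m else extend r a
  have hu : Function.Injective u := fun m m' e => by
    have := congrFun e ⟨v, Finset.mem_union_right _ hvY⟩
    simpa [u, proj] using this
  refine h (top_le_iff.1 (le_trans ?_ (le_iSup (degAt R δ) (proj _ (extend r)))))
  rw [← (Set.infinite_range_of_injective hu).encard_eq]
  refine Set.encard_le_encard ?_
  rintro _ ⟨m, rfl⟩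
  refine ⟨⟨r, hr, fun a _ hA => ?_⟩, fun a => ?_⟩
  · simp [u, proj, extend, hA, ne_of_mem_of_not_mem hA hvA]
  · simp [u, proj, ne_of_mem_of_not_mem a.2 hvX]

/-- The bound of a guard, the maximal degree found in the input, is at most the degree in the sense of
degree constraints. -/
theorem Listing.guard_le_deg {D : Instance S} {l : Listing S} (hl : ∀ X, ∀ t, t ∈ l X ↔ t ∈ D X)
    (δ : Mon V) (X : {X // X ∈ S}) : ((l.guard δ X.1).1 : ℕ∞) ≤ deg (D X) δ := by
  rcases maxDegree_eq (mask (δ.X ∩ X.1)) (R := l.guardRel δ X.1) (distinct_nodup _) with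
    h | ⟨k, g, h1, h2, h3⟩
  · rw [Listing.guard, h]
    exact zero_le
  have h4 : ∀ x ∈ g, ∃ r ∈ D X, mask (δ.X ∩ X.1 ∪ δ.Y) (extend r) = x := fun x hx => by
    have h5 := (h3 x hx).1
    rw [guardRel, mem_distinct, vecs, dif_pos X.2] at h5
    obtain ⟨_, h6, h7⟩ := List.mem_map.1 h5
    obtain ⟨r, h8, rfl⟩ := List.mem_map.1 h6
    exact ⟨r, (hl X r).1 h8, h7⟩
  refine le_trans ?_ (le_iSup (degAt (D X) δ) (proj _ k))
  have hinj : Set.InjOn (fun x : Vec V => (proj (δ.X ∪ δ.Y) x : Tuple (δ.X ∪ δ.Y)))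
      {x | x ∈ g} := fun x hx y hy e => by
    obtain ⟨r, -, rfl⟩ := h4 x hx
    obtain ⟨r', -, rfl⟩ := h4 y hy
    funext v
    by_cases hv : v ∈ δ.X ∪ δ.Y
    · exact congrFun e ⟨v, hv⟩
    · have hv' : v ∉ δ.X ∩ X.1 ∪ δ.Y := fun h =>
        hv (Finset.union_subset_union_left Finset.inter_subset_left h)
      simp only [mask, if_neg hv']
  have hcard : ((l.guard δ X.1).1 : ℕ∞) = Set.encard {x | x ∈ g} := by
    classical
    rw [show {x | x ∈ g} = ((g.toFinset : Finset (Vec V)) : Set (Vec V)) by ext; simp,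
      Set.encard_coe_eq_coe_finsetCard, List.toFinset_card_of_nodup h1, h2]
    rfl
  rw [hcard, ← hinj.encard_image]
  refine Set.encard_le_encard ?_
  rintro _ ⟨x, hx, rfl⟩
  have hk := (h3 x hx).2
  obtain ⟨r, hr, rfl⟩ := h4 x hx
  refine ⟨⟨r, hr, fun v hv hA => ?_⟩, fun v => ?_⟩
  · have : v ∈ δ.X ∩ X.1 ∪ δ.Y := by
      rcases Finset.mem_union.1 hv with h | h
      exacts [Finset.mem_union_left _ (Finset.mem_inter.2 ⟨h, hA⟩), Finset.mem_union_right _ h]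
    simp [proj, mask, this, extend, hA]
  · have hvY : v.1 ∉ δ.Y := Finset.disjoint_right.1 δ.disj v.2
    rw [← hk]
    by_cases hvX : v.1 ∈ X.1
    · simp [proj, mask, hvX, v.2]
    · simp [proj, mask, hvX, hvY]

/-- Some relation of the instance attains a degree that is finite. -/
theorem exists_deg_le {D : Instance S} {δ : Mon V} {N : ℝ≥0}
    (h : ((D.deg δ : ℕ∞) : ℝ≥0∞) ≤ (N : ℝ≥0∞)) : ∃ X, ((deg (D X) δ : ℕ∞) : ℝ≥0∞) ≤ (N : ℝ≥0∞) := by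
  have h0 : D.deg δ ≠ ⊤ := fun h0 => by
    rw [h0] at h
    simp at h
  rcases isEmpty_or_nonempty {X // X ∈ S} with hS | hS
  · exact absurd (iInf_of_empty _) h0
  · obtain ⟨X, hX⟩ := exists_eq_ciInf_of_finite (f := fun X => deg (D X) δ)
    exact ⟨X, by rw [hX]; exact h⟩

/-- A degree constraint that is satisfied provides a relation that guards its term. -/
theorem Listing.exists_guard {D : Instance S} {l : Listing S} (hl : ∀ X, ∀ t, t ∈ l X ↔ t ∈ D X)
    (hF : l.Full) {δ : Mon V} {N : ℝ≥0} (h : ((D.deg δ : ℕ∞) : ℝ≥0∞) ≤ (N : ℝ≥0∞)) :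
    ∃ X ∈ S, δ.Y ⊆ X ∧ ((l.guard δ X).1 : ℝ) ≤ N := by
  obtain ⟨X, hX⟩ := exists_deg_le h
  have hne : (D X).Nonempty := by
    obtain ⟨r, hr⟩ := List.exists_mem_of_ne_nil _ (hF X)
    exact ⟨r, (hl X r).1 hr⟩
  have hY : δ.Y ⊆ X.1 := subset_of_deg_ne_top hne fun h0 => by
    rw [h0] at hX
    simp at hX
  refine ⟨X.1, X.2, hY, ?_⟩
  have h1 := (ENat.toENNReal_le.2 (l.guard_le_deg hl δ X)).trans hX
  rw [ENat.toENNReal_coe] at h1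
  exact_mod_cast h1

end degrees

/-! ### Output relations and numerical bounds -/

section output
variable {V : Type*} [Fintype V] [DecidableEq V] {S So : Schema V}

/-- The listing of empty relations. -/
def Listing.none (S : Schema V) : Listing S := fun _ => []

/-- Does the listing have an empty relation? -/
noncomputable def Listing.hasEmpty (l : Listing S) : Bool := S.attach.toList.any fun X => (l X).isEmpty

theorem Listing.hasEmpty_eq_false {l : Listing S} : l.hasEmpty = false ↔ l.Full := by
  simp [hasEmpty, Full]

theorem Const.hasEmpty : Const fun l : Listing S => l.hasEmpty := by
  unfold Listing.hasEmpty
  induction S.attach.toList with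
  | nil => exact Const.const false
  | cons X L ih =>
    have h1 := Const.listing X
    have h2 : Const fun l : Listing S => bif (l X).isEmpty then true else L.any fun X => (l X).isEmpty :=
      (Const.isEmpty h1).branch (Const.const true) ih
    have e : (fun l : Listing S => (X :: L).any fun X => (l X).isEmpty) =
        fun l => bif (l X).isEmpty then true else L.any fun X => (l X).isEmpty := by
      funext l
      cases h : (l X).isEmpty <;> simp [h]
    rw [e]
    exact h2

/-- The tagged tuples are distributed to the relations of the output, without repetition. -/
noncomputable def distribute (idx : Finset V → ℕ) (So : Schema V) (L : List (ℕ × Vec V)) : Listing So :=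
  fun Z => (distinct ((L.filter fun e => !decide (e.1 < idx Z.1) && !decide (idx Z.1 < e.1)).map
    fun e => mask Z.1 e.2)).map fun t : Vec V => (proj Z.1 t : Tuple Z.1)

theorem proj_mem_distribute {idx : Finset V → ℕ} {L : List (ℕ × Vec V)} {Z : {Z // Z ∈ So}} {t : Vec V}
    (h : (idx Z.1, mask Z.1 t) ∈ L) : proj Z.1 t ∈ distribute idx So L Z := by
  refine List.mem_map.2 ⟨mask Z.1 t, mem_distinct.2 (List.mem_map.2
    ⟨_, List.mem_filter.2 ⟨h, by simp⟩, ?_⟩), ?_⟩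
  · funext v; by_cases hv : v ∈ Z.1 <;> simp [mask, hv]
  · funext v; simp [mask, proj]

theorem distribute_nodup {idx : Finset V → ℕ} {L : List (ℕ × Vec V)} (Z : {Z // Z ∈ So}) :
    (distribute idx So L Z).Nodup := by
  refine List.Nodup.map_on (fun x hx y hy h => ?_) (distinct_nodup _)
  obtain ⟨e, -, rfl⟩ := List.mem_map.1 (mem_distinct.1 hx)
  obtain ⟨e', -, rfl⟩ := List.mem_map.1 (mem_distinct.1 hy)
  funext v
  by_cases hv : v ∈ Z.1
  · exact congrFun h ⟨v, hv⟩
  · simp [mask, hv]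

theorem length_distribute_le (idx : Finset V → ℕ) (L : List (ℕ × Vec V)) (Z : {Z // Z ∈ So}) :
    (distribute idx So L Z).length ≤ L.length := by
  rw [distribute, List.length_map]
  refine (distinct_length_le _).trans ?_
  rw [List.length_map]
  exact List.length_filter_le _ _

theorem size_distribute_le (idx : Finset V → ℕ) (L : List (ℕ × Vec V)) :
    (distribute idx So L).size ≤ So.card * L.length := by
  have := Finset.sum_le_card_nsmul (Finset.univ : Finset {Z // Z ∈ So})
    (fun Z => (distribute idx So L Z).length) L.length fun Z _ => length_distribute_le idx L Z
  simpa [Listing.size] using this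

theorem Computes.distribute (idx : Finset V → ℕ) (So : Schema V) :
    Computes (fun _ => True) (fun L => distribute idx So L) (fun L => sortTime L.length) := by
  refine Computes.record (l := So.attach.toList)
    (G := fun L Z => Val.ofList ((Panda.distribute idx So L Z).map encodeTuple)) (fun _ => rfl)
    fun Z _ => ?_
  have e0 : Const fun L : List (ℕ × Vec V) => (false, L) := by fun_prop
  have e0' : Const fun L : List (Vec V) => (false, L) := by fun_prop
  have e1 : Const fun x : Bool × ℕ × Vec V => !decide (x.2.1 < idx Z.1) && !decide (idx Z.1 < x.2.1) := by
    fun_prop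
  have e2 : Const fun x : Bool × ℕ × Vec V => mask Z.1 x.2.2 := by fun_prop
  have e3 : Const fun x : Bool × Vec V => (proj Z.1 x.2 : Tuple Z.1) := by fun_prop
  have h1 := (Computes.filter (c := fun (_ : Bool) (e : ℕ × Vec V) =>
    !decide (e.1 < idx Z.1) && !decide (idx Z.1 < e.1)) e1).comp (e0.computes (fun _ => True) 0)
    fun _ _ => trivial
  have h2 := (Computes.map_const (f := fun (_ : Bool) (e : ℕ × Vec V) => mask Z.1 e.2) e2).comp
    ((e0.computes (fun _ => True) 0).comp h1 fun _ _ => trivial) fun _ _ => trivial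
  have h3 := (Computes.map_const (f := fun (_ : Bool) (t : Vec V) => (proj Z.1 t : Tuple Z.1)) e3).comp
    ((e0'.computes (fun _ => True) 0).comp (Computes.distinct.comp h2 fun _ _ => trivial)
      fun _ _ => trivial) fun _ _ => trivial
  refine h3.of_enc 4 fun L _ => ⟨L, trivial, rfl, rfl, ?_⟩
  set M := L.filter fun e => !decide (e.1 < idx Z.1) && !decide (idx Z.1 < e.1)
  have a1 : M.length ≤ L.length := List.length_filter_le _ _
  have a2 := le_sortTime L.length
  have a3 := distinct_length_le (M.map fun e => mask Z.1 e.2)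
  have a4 := sortTime_mono a1
  rw [List.length_map] at a3
  simp only [Pi.zero_apply, List.length_map]
  omega

variable {idx : Finset V → ℕ} {p : Listing S → Prop} {b : Listing S → ℕ}

theorem Listing.lg_le_size (l : Listing S) : l.lg ≤ l.size + 2 :=
  Nat.size_le.2 Nat.lt_two_pow_self

/-- The budget, or zero if some relation is empty. -/
noncomputable def Listing.cut (l : Listing S) (b : Listing S → ℕ) : ℕ := bif l.hasEmpty then 0 else b l

/-- A program that lists a model, from a program that lists tagged tuples. It is also correct for
inputs with an empty relation: the join is empty, and so is the output. -/
theorem Answers.exists_models (h : Answers idx So p b) {e : ℕ}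
    (hb : ∀ l, p l → b l ≤ (l.size + 2) ^ e) :
    ∃ (g : Listing S → Listing So) (k c : ℕ),
      Computes (fun l => l.Full → p l) g (fun l => l.time (l.cut b) k) ∧
      ∀ l, (l.Full → p l) → (∀ Z, (g l Z).Nodup) ∧ (g l).size ≤ c * (l.cut b * l.lg ^ k) ∧
        ∀ t : Vec V, (∀ X, proj X.1 t ∈ l X) → ∃ Z, proj Z.1 t ∈ g l Z := by
  obtain ⟨f, k, c, -, hf, hfc⟩ := h
  set E := c.size + e + k + 2 with hE
  have hsort : ∀ l, p l → sortTime (f l).length ≤ (c + 1) * E * l.time (b l) (k + 1) := fun l hl => by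
    have h1 := (hfc l hl).1
    have h2 : (f l).length ≤ c * (l.size + 2) ^ (e + k) := by
      refine h1.trans (Nat.mul_le_mul_left _ ?_)
      rw [pow_add]
      exact Nat.mul_le_mul (hb l hl) (Nat.pow_le_pow_left l.lg_le_size k)
    have h3 : Nat.clog 2 (f l).length ≤ (f l).length.size := by
      rw [Nat.clog_le_iff_le_pow (by norm_num)]
      exact (Nat.lt_size_self _).le
    have h4 := (Nat.size_le_size h2).trans (size_mul_le _ _)
    have h5 := size_pow_le (l.size + 2) (e + k)
    change _ ≤ (e + k) * l.lg + 1 at h5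
    have h6 := l.one_le_lg
    have h7 : c.size * 1 ≤ c.size * l.lg := Nat.mul_le_mul_left _ h6
    have h8 : Nat.clog 2 (f l).length + 1 ≤ E * l.lg := by
      calc _ ≤ c.size * l.lg + (e + k) * l.lg + 2 * l.lg := by omega
        _ = _ := by rw [hE]; ring
    have h9 : (f l).length + 1 ≤ (c + 1) * l.time (b l) k := by
      have h10 : c * (b l * l.lg ^ k) ≤ c * l.time (b l) k :=
        Nat.mul_le_mul_left _ (Nat.mul_le_mul_right _ (by omega))
      have h11 : 1 ≤ l.time (b l) k := Nat.mul_pos (Nat.succ_pos _) (Nat.pow_pos h6)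
      rw [add_mul, one_mul]
      omega
    calc _ ≤ (c + 1) * l.time (b l) k * (E * l.lg) := Nat.mul_le_mul h9 h8
      _ = _ := by simp only [Listing.time]; ring
  refine ⟨fun l => bif l.hasEmpty then .none So else Panda.distribute idx So (f l), k + 1,
    So.card * c, ?_, fun l hl => ?_⟩
  · refine (Computes.branch (U := fun l => (1 + (c + 1) * E) * l.time (l.cut b) (k + 1))
      (Const.hasEmpty.computes _ 0) ((Const.const (Listing.none So)).computes _ 0)
      ((Computes.distribute idx So).comp hf fun _ _ => trivial)
      (fun l hl h => ⟨trivial, ?_⟩) fun l hl h => ⟨hl (Listing.hasEmpty_eq_false.1 h), ?_⟩).weaken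
      (1 + (c + 1) * E) fun l hl => ⟨hl, Nat.mul_le_mul_left _ (Nat.le_succ _)⟩
    · simp
    · have h1 := hsort l (hl (Listing.hasEmpty_eq_false.1 h))
      have h2 := l.time_mono (b := b l) (b' := b l) (k := k) (k' := k + 1) le_rfl (by omega)
      simp only [Listing.cut, h, cond_false, Pi.zero_apply]
      calc _ ≤ l.time (b l) (k + 1) + (c + 1) * E * l.time (b l) (k + 1) := by omega
        _ = _ := by ring
  · cases h : l.hasEmpty
    · have hp := hl (Listing.hasEmpty_eq_false.1 h)
      obtain ⟨h1, h2⟩ := hfc l hp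
      simp only [Listing.cut, h, cond_false]
      refine ⟨distribute_nodup, (size_distribute_le idx (f l)).trans ?_, fun t ht => ?_⟩
      · rw [mul_assoc]
        exact Nat.mul_le_mul_left _ (h1.trans (Nat.mul_le_mul_left _ (Nat.mul_le_mul_left _
          (l.lg_pow_mono (Nat.le_succ k)))))
      · obtain ⟨Z, hZ, h3⟩ := h2 t ht
        exact ⟨⟨Z, hZ⟩, proj_mem_distribute h3⟩
    · simp only [Listing.cut, h, cond_true]
      refine ⟨fun _ => List.nodup_nil, by simp [Listing.size, Listing.none], fun t ht => ?_⟩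
      obtain ⟨X, -, hX⟩ := List.any_eq_true.1 h
      have := ht X
      rw [List.isEmpty_iff.1 hX] at this
      simp at this

end output

section bounds
variable {V : Type*} [Fintype V] [DecidableEq V] {S : Schema V}

/-- Rounding and the reserve for the decompositions cost only a constant factor. -/
theorem Listing.cost_le {l : Listing S} {c : Cert V} {γ : Mon V → Finset V} {B : ℝ} (hB : 1 ≤ B)
    (hq : 0 < Multiset.card c.Zs) (hP : 0 < l.guardProd γ c.Ds.toList)
    (h : (l.guardProd γ c.Ds.toList : ℝ) ≤ B ^ Multiset.card c.Zs) :
    (l.cost c γ : ℝ) ≤ 2 ^ (Multiset.card c.Ss + 1) * B := by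
  set s := Multiset.card c.Ss
  have h2 : (1 : ℝ) ≤ 2 ^ s := one_le_pow₀ (by norm_num)
  rcases (budget_spec hq (Nat.mul_pos hP (Nat.pow_pos (n := s) two_pos))).2 with h1 | ⟨r, h1, h3⟩
  · rw [Listing.cost, h1, pow_succ]
    push_cast
    nlinarith
  · have h4 : (r : ℝ) ^ Multiset.card c.Zs < (2 ^ s * B) ^ Multiset.card c.Zs := by
      calc (r : ℝ) ^ Multiset.card c.Zs < l.guardProd γ c.Ds.toList * 2 ^ s := by exact_mod_cast h3
        _ ≤ B ^ Multiset.card c.Zs * (2 ^ s) ^ Multiset.card c.Zs :=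
          mul_le_mul h (le_self_pow₀ h2 hq.ne') (by positivity) (by positivity)
        _ = _ := by rw [mul_pow, mul_comm]
    have h5 := lt_of_pow_lt_pow_left₀ _ (by positivity) h4
    rw [Listing.cost, h1, pow_succ]
    push_cast
    linarith

theorem Listing.lg_le_log (l : Listing S) : (l.lg : ℝ) ≤ 4 * Real.log (l.size + 2) := by
  have h1 : 2 ^ (l.lg - 1) ≤ l.size + 2 := by
    rw [← Nat.lt_size]
    have := l.one_le_lg
    unfold lg at this ⊢
    omega
  have h2 : (2 : ℝ) ^ (l.lg - 1) ≤ l.size + 2 := by exact_mod_cast h1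
  have h3 := Real.log_le_log (by positivity) h2
  rw [Real.log_pow, Nat.cast_sub l.one_le_lg] at h3
  have h4 := Real.log_two_gt_d9
  have h5 : Real.log 2 ≤ Real.log (l.size + 2) := Real.log_le_log (by norm_num) (by simp)
  have h6 : (1 : ℝ) ≤ l.lg := by exact_mod_cast l.one_le_lg
  push_cast at h3
  nlinarith

theorem half_lt_log (n : ℕ) : 1 / 2 < Real.log (n + 2) := by
  have h4 := Real.log_two_gt_d9
  have h5 : Real.log 2 ≤ Real.log (n + 2) := Real.log_le_log (by norm_num) (by simp)
  linarith

end bounds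

/-! ### The program and its budget -/

section main
variable {V : Type*} [Fintype V] [DecidableEq V] {S So : Schema V}

/-- A finite set of certificates gives one program, whose budget `b` is the least one among the
certificates, over all choices of the relations that guard their terms. If there is no such choice
at all, the property `p` is never satisfied, and the program is only used for inputs with an empty
relation. -/
theorem exists_program {F : Set (Cert V)} (hF : F.Finite)
    (h : ∀ c ∈ F, 0 < Multiset.card c.Zs ∧ ∀ Z ∈ c.Zs, Z ∈ So) :
    ∃ (b : Listing S → ℕ) (p : Listing S → Prop) (g : Listing S → Listing So) (k a M : ℕ),
      Computes (fun l => l.Full → p l) g (fun l => l.time (l.cut b) k) ∧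
      (∀ l, (l.Full → p l) → (∀ Z, (g l Z).Nodup) ∧ (g l).size ≤ a * (l.cut b * l.lg ^ k) ∧
        ∀ t : Vec V, (∀ X, proj X.1 t ∈ l X) → ∃ Z, proj Z.1 t ∈ g l Z) ∧
      ∀ c ∈ F, ∀ γ : Mon V → Finset V, (∀ δ ∈ c.Ds, γ δ ∈ S ∧ δ.Y ⊆ γ δ) →
        2 ^ (Multiset.card c.Ss + 1) ≤ M ∧ ∀ l : Listing S, l.Full → p l ∧ b l ≤ l.cost c γ := by
  set idx : Finset V → ℕ := fun Z => (Fintype.equivFin (Finset V) Z).val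
  set F' : Set (Cert V × (Mon V → Finset V)) :=
    {i | i.1 ∈ F ∧ ∀ δ ∈ i.1.Ds, i.2 δ ∈ S ∧ δ.Y ⊆ i.2 δ} with hF'
  have hfin : F'.Finite := (hF.prod Set.finite_univ).subset fun i hi => ⟨hi.1, Set.mem_univ _⟩
  obtain ⟨M, hM⟩ := (hfin.image fun i => 2 ^ (Multiset.card i.1.Ss + 1)).bddAbove
  have hM' : ∀ i ∈ F', 2 ^ (Multiset.card i.1.Ss + 1) ≤ M := fun i hi => hM (Set.mem_image_of_mem _ hi)
  have key : ∀ i ∈ F', Answers idx So (fun l : Listing S => l.Full) fun l => l.cost i.1 i.2 :=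
    fun i hi => Answers.of_cert idx (h _ hi.1).1 (h _ hi.1).2 hi.2
  rcases F'.eq_empty_or_nonempty with h0 | h0
  · have h1 : Answers idx So (fun _ : Listing S => False) fun _ => 0 :=
      ⟨fun _ => [], 0, 0, (Const.const 0).computes _ _, (Const.const []).computes _ _,
        fun _ h => h.elim⟩
    obtain ⟨g, k, a, h2, h3⟩ := h1.exists_models (e := 0) fun _ h => h.elim
    refine ⟨_, _, g, k, a, M, h2, h3, fun c hc γ hγ => ?_⟩
    have : (c, γ) ∈ F' := ⟨hc, hγ⟩
    simp [h0] at this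
  · obtain ⟨b, h1, hb⟩ := Answers.exists_min hfin key h0
    obtain ⟨⟨c, γ⟩, hi⟩ := h0
    obtain ⟨g, k, a, h2, h3⟩ := h1.exists_models
      (e := c.Ds.toList.length + Multiset.card c.Ss + 1) fun l hl => by
        have h4 := budget_le (h c hi.1).1 (Nat.mul_pos (Listing.guardProd_pos (l := l)
          (ds := c.Ds.toList) (fun δ hδ => hi.2 δ (Multiset.mem_toList.1 hδ)) hl)
          (Nat.pow_pos (n := Multiset.card c.Ss) two_pos))
        have h5 := l.prod_size_le γ c.Ds.toList (Multiset.card c.Ss)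
        calc b l ≤ 2 * (l.guardProd γ c.Ds.toList * 2 ^ Multiset.card c.Ss) :=
              (hb _ hi l).trans h4
          _ ≤ (l.size + 2) * (l.size + 2) ^ (c.Ds.toList.length + Multiset.card c.Ss) :=
              Nat.mul_le_mul (by omega) h5
          _ = _ := by ring
    exact ⟨b, _, g, k, a, M, h2, h3, fun c hc γ hγ =>
      ⟨hM' (c, γ) ⟨hc, hγ⟩, fun l hl => ⟨hl, hb (c, γ) ⟨hc, hγ⟩ l⟩⟩⟩

/-- On an instance that satisfies the degree constraints, some certificate has a budget of at most
the bound, up to a constant factor. It is compared with the actual degrees, which are at least `1`,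
rather than with `N`. -/
theorem exists_cost_le {F : Set (Cert V)} {Δ : Finset (Mon V)} {w : Mon V → ℝ}
    (hw : ∀ δ ∈ Δ, 0 ≤ w δ) (h : ∀ c ∈ F, 0 < Multiset.card c.Zs ∧ ∀ δ ∈ c.Ds, δ ∈ Δ)
    (hd : ∀ d : Mon V → ℝ, (∀ δ ∈ Δ, 1 ≤ d δ) →
      ∃ c ∈ F, (c.Ds.map d).prod ≤ (∏ δ ∈ Δ, d δ ^ w δ) ^ Multiset.card c.Zs)
    {D : Instance S} {N : Mon V → ℝ≥0} (hD : Satisfies D Δ N) {l : Listing S}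
    (hl : ∀ X, ∀ t, t ∈ l X ↔ t ∈ D X) (hFull : l.Full) :
    ∃ c ∈ F, ∃ γ : Mon V → Finset V, (∀ δ ∈ c.Ds, γ δ ∈ S ∧ δ.Y ⊆ γ δ) ∧
      (l.cost c γ : ℝ) ≤ 2 ^ (Multiset.card c.Ss + 1) * bound Δ N w := by
  have h1 : ∀ δ : Mon V, ∃ X : Finset V, δ ∈ Δ → X ∈ S ∧ δ.Y ⊆ X ∧ ((l.guard δ X).1 : ℝ) ≤ N δ :=
    fun δ => by
      by_cases hδ : δ ∈ Δ
      · obtain ⟨X, h2, h3, h4⟩ := Listing.exists_guard hl hFull (hD δ hδ)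
        exact ⟨X, fun _ => ⟨h2, h3, h4⟩⟩
      · exact ⟨∅, fun h => (hδ h).elim⟩
  choose γ hγ using h1
  have h2 : ∀ δ ∈ Δ, (1 : ℝ) ≤ (l.guard δ (γ δ)).1 := fun δ hδ => by
    exact_mod_cast Listing.one_le_guard (hγ δ hδ).1 hFull
  obtain ⟨c, hc, h3⟩ := hd (fun δ => (l.guard δ (γ δ)).1) h2
  have hγc : ∀ δ ∈ c.Ds, γ δ ∈ S ∧ δ.Y ⊆ γ δ := fun δ hδ =>
    ⟨(hγ δ ((h c hc).2 δ hδ)).1, (hγ δ ((h c hc).2 δ hδ)).2.1⟩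
  have h4 : ∏ δ ∈ Δ, ((l.guard δ (γ δ)).1 : ℝ) ^ w δ ≤ bound Δ N w :=
    Finset.prod_le_prod (fun δ _ => by positivity) fun δ hδ =>
      Real.rpow_le_rpow (by positivity) (hγ δ hδ).2.2 (hw δ hδ)
  have h5 : (1 : ℝ) ≤ ∏ δ ∈ Δ, ((l.guard δ (γ δ)).1 : ℝ) ^ w δ := by
    rw [← Finset.prod_const_one (s := Δ)]
    exact Finset.prod_le_prod (fun _ _ => zero_le_one) fun δ hδ =>
      Real.one_le_rpow (h2 δ hδ) (hw δ hδ)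
  refine ⟨c, hc, γ, hγc, Listing.cost_le (h5.trans h4) (h c hc).1
    (Listing.guardProd_pos (fun δ hδ => hγc δ (Multiset.mem_toList.1 hδ)) hFull) ?_⟩
  have h6 : (l.guardProd γ c.Ds.toList : ℝ) = (c.Ds.map fun δ => ((l.guard δ (γ δ)).1 : ℝ)).prod := by
    rw [Listing.guardProd, Nat.cast_list_prod, List.map_map]
    conv_rhs => rw [← Multiset.coe_toList c.Ds]
    rw [Multiset.map_coe, Multiset.prod_coe]
    rfl
  rw [h6]
  exact h3.trans (pow_le_pow_left₀ (zero_le_one.trans h5) h4 _)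

end main

end Panda

theorem theorem4p1 {V : Type*} [Fintype V] [DecidableEq V]
    (Sin Sout : Panda.Schema V) (Δ : Finset (Panda.Mon V))
    (lam : Finset V → ℝ) (w : Panda.Mon V → ℝ)
    (hlam : ∀ Z ∈ Sout, 0 ≤ lam Z) (hlam1 : ∑ Z ∈ Sout, lam Z = 1)
    (hw : ∀ δ ∈ Δ, 0 ≤ w δ)
    (hShannon : Panda.IsShannon Sout Δ lam w) :
    ∃ (P : Panda.Prog) (C : ℝ) (k : ℕ),
      ∀ (D : Panda.Instance Sin) (N : Panda.Mon V → ℝ≥0), Panda.Satisfies D Δ N →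
        ∀ x : Panda.Val, Panda.Stores D x →
          ∃ (E : Panda.Instance Sout) (y : Panda.Val) (T : ℕ),
            Panda.Prog.Runs P x y T ∧ Panda.Stores E y ∧ Panda.IsModel D E ∧
            (T : ℝ) ≤ C * (D.size + Panda.bound Δ N w + 1) * Real.log (D.size + 2) ^ k ∧
            (E.size : ℝ) ≤ C * Panda.bound Δ N w * Real.log (D.size + 2) ^ k := by
  classical
  open Panda in
  obtain ⟨F, hF, hFc, hFd⟩ := exists_certs hlam hlam1 hw hShannon
  obtain ⟨b, p, g, k, a, M, ⟨P, c, hP⟩, hg, hM⟩ := exists_program (S := Sin) hF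
    fun c hc => ⟨(hFc c hc).1, (hFc c hc).2.1⟩
  refine ⟨P, (2 * c + a) * (M + 1) * 4 ^ k, k, fun D N hD x hx => ?_⟩
  obtain ⟨l, hl, rfl⟩ : ∃ l : Listing Sin, (∀ X, (l X).Nodup ∧ ∀ t, t ∈ l X ↔ t ∈ D X) ∧
    x = Enc.enc l := hx
  have hB : 0 ≤ bound Δ N w := Finset.prod_nonneg fun δ _ => by positivity
  set B := bound Δ N w
  have hsize : D.size = l.size := Finset.sum_congr rfl fun X _ => by
    rw [← List.toFinset_card_of_nodup (hl X).1]
    congr 1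
    ext t
    rw [List.mem_toFinset, (hl X).2]
  -- `B` may be less than `1`, even zero, if some relation is empty; then the cut budget is zero
  have key : (l.Full → p l) ∧ (l.cut b : ℝ) ≤ M * B := by
    cases h0 : l.hasEmpty
    · have hFull := Listing.hasEmpty_eq_false.1 h0
      obtain ⟨c, hc, γ, hγ, h1⟩ := exists_cost_le hw (fun c hc => ⟨(hFc c hc).1, (hFc c hc).2.2⟩) hFd hD
        (fun X => (hl X).2) hFull
      obtain ⟨h2, h3⟩ := hM c hc γ hγ
      obtain ⟨h4, h5⟩ := h3 l hFull
      refine ⟨fun _ => h4, ?_⟩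
      rw [Listing.cut, h0, cond_false]
      calc (b l : ℝ) ≤ l.cost c γ := by exact_mod_cast h5
        _ ≤ 2 ^ (Multiset.card c.Ss + 1) * B := h1
        _ ≤ M * B := mul_le_mul_of_nonneg_right (by exact_mod_cast h2) hB
    · refine ⟨fun h => ?_, ?_⟩
      · rw [Listing.hasEmpty_eq_false.2 h] at h0
        cases h0
      · rw [Listing.cut, h0, cond_true, Nat.cast_zero]
        positivity
  obtain ⟨hp, hcut⟩ := key
  obtain ⟨T, hT, hTc⟩ := hP l hp
  obtain ⟨hg1, hg2, hg3⟩ := hg l hp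
  have hlog : (l.lg : ℝ) ^ k ≤ 4 ^ k * Real.log (l.size + 2) ^ k := by
    rw [← mul_pow]
    exact pow_le_pow_left₀ (by positivity) l.lg_le_log k
  rw [hsize]
  set L := Real.log (l.size + 2) ^ k
  have hL : 0 ≤ L := pow_nonneg ((half_lt_log l.size).le.trans' (by norm_num)) k
  refine ⟨fun Z => (g l Z).toFinset, _, T, hT, ⟨g l, fun Z => ⟨hg1 Z, fun t => by
    rw [List.mem_toFinset]⟩, rfl⟩, fun t ht => ?_, ?_, ?_⟩
  · obtain ⟨Z, hZ⟩ := hg3 t fun X => ((hl X).2 _).2 (ht X)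
    exact ⟨Z, List.mem_toFinset.2 hZ⟩
  · have h1 : (1 : ℝ) ≤ l.time (l.cut b) k := by
      exact_mod_cast Nat.mul_pos (Nat.succ_pos _) (Nat.pow_pos l.one_le_lg)
    have h2 : (l.time (l.cut b) k : ℝ) ≤ ((M + 1) * (l.size + B + 1)) * (4 ^ k * L) := by
      rw [Listing.time]
      push_cast
      refine mul_le_mul ?_ hlog (by positivity) (by positivity)
      have h3 : (0 : ℝ) ≤ M * l.size := by positivity
      have h4 : (0 : ℝ) ≤ M := by positivity
      nlinarith
    calc (T : ℝ) ≤ c * (l.time (l.cut b) k + 1) := by exact_mod_cast hTc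
      _ ≤ 2 * c * l.time (l.cut b) k := by
        have : (0 : ℝ) ≤ c := by positivity
        nlinarith
      _ ≤ (2 * c + a) * (((M + 1) * (l.size + B + 1)) * (4 ^ k * L)) :=
        mul_le_mul (by simp) h2 (by positivity) (by positivity)
      _ = _ := by ring
  · have h1 : Instance.size (fun Z => (g l Z).toFinset) = (g l).size :=
      Finset.sum_congr rfl fun Z _ => List.toFinset_card_of_nodup (hg1 Z)
    rw [h1]
    calc ((g l).size : ℝ) ≤ a * (l.cut b * l.lg ^ k) := by exact_mod_cast hg2
      _ ≤ (2 * c + a) * (((M + 1) * B) * (4 ^ k * L)) := by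
        refine mul_le_mul (by simp) (mul_le_mul (hcut.trans ?_) hlog (by positivity) (by positivity))
          (by positivity) (by positivity)
        linarith
      _ = _ := by ring
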